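/- **Local collections.** Let $\boldsymbol T=\{\lambda\in\mathbb R^3:\lambda_i\ge 0,\ \lambda_1+\lambda_2+\lambda_3=1\}$, red-refined into the corner triangles $\boldsymbol T_i=\{\lambda_i\ge\frac12\}$ ($i\le 3$) and $\boldsymbol T_4=\{\lambda_1,\lambda_2,\lambda_3\le\frac12\}$. Number the points of $\boldsymbol T$ with coordinates in $\frac14\mathbb N_0$ as $(1,0,0)$, $(0,1,0)$, $(0,0,1)$; $(0,\frac12,\frac12)$, $(\frac12,0,\frac12)$, $(\frac12,\frac12,0)$; $(0,\frac34,\frac14)$, $(0,\frac14,\frac34)$, $(\frac14,0,\frac34)$, $(\frac34,0,\frac14)$, $(\frac34,\frac14,0)$, $(\frac14,\frac34,0)$; $(\frac12,\frac14,\frac14)$, $(\frac14,\frac12,\frac14)$, $(\frac14,\frac14,\frac12)$. Let $n_1,\dots,n_{15}$ be the nodal basis, for these points, of $C(\boldsymbol T)\cap\prod_{i=1}^4P_2(\boldsymbol T_i)$, and let $\tilde n_1,\dots,\tilde n_6$ be the nodal basis, for the first six points, of $C(\boldsymbol T)\cap\prod_{i=1}^4P_1(\boldsymbol T_i)$. Each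 function below is labelled by one of the points; up to permutations of the barycentric coordinates the collections are - $\boldsymbol\Theta$ (labels $1$–$6$): $\boldsymbol\theta_1=72n_1+6(n_{10}+n_{11})$, $\ \boldsymbol\theta_4=\frac{1560}{81}n_4+\frac{530}{81}(n_7+n_8)+\frac{50}{81}(n_{14}+n_{15})$; - $\boldsymbol\Xi$ (labels $7$–$15$): $\boldsymbol\xi_7=n_7-\frac{2}{25}n_8-\frac{12}{25}n_4-\frac{8}{25}n_{14}+\frac1{25}n_{15}$, $\ \boldsymbol\xi_{13}=-\frac54n_{13}+n_{14}+n_{15}$; - $\tilde{\boldsymbol\Phi}$ (labels $1$–$6$): $\tilde{\boldsymbol\phi}_1=\tilde n_1-\frac4{27}(\tilde n_5+\tilde n_6)$, $\ \tilde{\boldsymbol\phi}_4=\tilde n_4$. Then: 1. Each of $\boldsymbol\Theta,\boldsymbol\Xi,\tilde{\boldsymbol\Phi}$ is a linearly independent, permutation invariant collection of continuous functions, each function vanishing on every edge and vertex of $\boldsymbol T$ that does not contain its label. $\tilde{\boldsymbol\Phi}$ is a basis of $C(\boldsymbol T)\cap\prod_iP_1(\boldsymbol T_i)$. 2. $\langle\boldsymbol\Theta,\tilde{\boldsymbol\Phi}\rangle_{L_2(\boldsymbol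 T)}=\mathrm{vol}(\boldsymbol T)\,\mathrm{Id}$. 3. The $15\times15$ matrix of the coefficients of $\boldsymbol\Theta\cup\boldsymbol\Xi$ with respect to $n_1,\dots,n_{15}$ has non-zero determinant, and $\boldsymbol\Theta\cup\boldsymbol\Xi$ is a basis of $C(\boldsymbol T)\cap\prod_iP_2(\boldsymbol T_i)$. 4. $\langle\boldsymbol\xi_7,\tilde{\boldsymbol\phi}_k\rangle_{L_2(\boldsymbol T)}/\mathrm{vol}(\boldsymbol T)$ equals $\frac3{100}$ for $k=2$ and $0$ otherwise; $\langle\boldsymbol\xi_{13},\tilde{\boldsymbol\phi}_k\rangle_{L_2(\boldsymbol T)}/\mathrm{vol}(\boldsymbol T)$ equals $-\frac1{48}$ for $k=1$, $\frac{27}{240}$ for $k=4$, and $0$ otherwise; the other values follow by permutation. **Global collections.** Let $\mathcal T_0$ be a finite conforming triangulation of a closed polygon $\bar\Omega\subset\mathbb R^2$ with interior $\Omega$, let $\mathcal T_{j+1}$ be the red-refinement of $\mathcal T_j$, and let $\Gamma\subset\partial\Omega$ be a (possibly empty) union of closed edges of $\mathcal T_0$. Let $V_j$ be the continuous piecewise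 quadratics with respect to $\mathcal T_j$, and $\tilde V_j$ the continuous piecewise linears with respect to $\mathcal T_{j+1}$, that vanish on $\Gamma$. With $\lambda_T$ the barycentric coordinates on $T$, a local collection $\{\boldsymbol\sigma_\lambda\}$ gives, for every $x\in\bar\Omega\setminus\Gamma$ such that $\lambda_T(x)$ is a label for some $T\in\mathcal T_j$, the global function that at $y$ equals $$\Big(\sum_{T'\in\mathcal T_j,\ T'\ni x}\mathrm{vol}(T')\Big)^{-1/2}\boldsymbol\sigma_{\lambda_T(x)}(\lambda_T(y))\ \text{ if } x,y\in T\in\mathcal T_j,\qquad 0\ \text{ otherwise.}$$ Applied on $\mathcal T_j$ to $\boldsymbol\Theta$, $\boldsymbol\Xi$, $\tilde{\boldsymbol\Phi}$ and the nodal basis of $P_2(\boldsymbol T)$, this gives $\Theta_j$, $\Xi_{j+1}$, $\tilde\Phi_j$ and $N_j$. Put $\Psi_0=N_0$ and $$\Psi_{j+1}=\Xi_{j+1}-\langle\Xi_{j+1},\tilde\Phi_j\rangle_{L_2(\Omega)}\Theta_j\qquad(j\ge0).$$ There are absolute constants $0<c\le C<\infty$ such that, for all $\mathcal T_0$, $\Gamma$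 and $j\ge0$, the collections $N_j$, $\Theta_j\cup\Xi_{j+1}$, $\tilde\Phi_j$ and $\Psi_{j+1}$ are $L_2(\Omega)$-Riesz bases, with (squared) bounds $c$ and $C$, of $V_j$, $V_{j+1}$, $\tilde V_j$ and $V_{j+1}\cap\tilde V_j^{\perp_{L_2(\Omega)}}$, respectively, and $\langle\Theta_j,\tilde\Phi_j\rangle_{L_2(\Omega)}=\mathrm{Id}$. **Number of nodal functions.** Each wavelet $\psi_{j+1,x}\in\Psi_{j+1}$ is a linear combination of the nodal functions $N_{j+1}$, and the number of non-zero coefficients is as follows. Let $y$ be the vertex of $\mathcal T_j$ nearest to $x$ in a triangle of $\mathcal T_j$ containing $x$ (the one at which $x$ has its largest barycentric coordinate), and let $v$ be the number of edges of $\mathcal T_j$ at $y$. - If $x$ is on an edge of $\mathcal T_j$ that belongs to $n\in\{1,2\}$ triangles of $\mathcal T_j$, the number is $3+2n+v$ when $y\notin\Gamma$, and $3+2n$ when $y\in\Gamma$. - If $x$ is interior to a triangle of $\mathcal T_j$ whose edge opposite to $y$ has midpoint $m$ and belongs to $n$ triangles, the number is $p+q$, with $p=4+2n$ if $m\notin\Gamma$,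 $p=3$ if $m\in\Gamma$, $q=1+v$ if $y\notin\Gamma$, $q=0$ if $y\in\Gamma$. In particular, for $v=6$ and away from $\Gamma$ the two numbers are $11$ and $13$ when the edge in question belongs to one triangle, and $13$ and $15$ when it is shared by two triangles. -/

import Mathlib

open Set MeasureTheory

noncomputable section

namespace QuadWavelet

/-- The Euclidean plane. -/
abbrev Plane : Type := EuclideanSpace ℝ (Fin 2)

/-- Barycentric coordinates (three real numbers). -/
abbrev Bary : Type := Fin 3 → ℝ

/-! ### The reference triangle -/

/-- The reference triangle `{l : l 0 + l 1 + l 2 = 1, 0 ≤ l i}` in `ℝ³`. -/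
def refTriangle : Set Bary := stdSimplex ℝ (Fin 3)

/-- The surface measure of the reference triangle: the parametrization
`(s, t) ↦ (1 - s - t, s, t)` multiplies areas by `√3`. -/
def refMeasure : Measure Bary :=
  ENNReal.ofReal (Real.sqrt 3) •
    ((volume : Measure (ℝ × ℝ)).restrict
      {p | 0 ≤ p.1 ∧ 0 ≤ p.2 ∧ p.1 + p.2 ≤ 1}).map
        (fun p => ![1 - p.1 - p.2, p.1, p.2])

/-- The area of the reference triangle. -/
def refVol : ℝ := refMeasure.real refTriangle

/-- The `L₂` inner product on the reference triangle. -/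
def refInner (f g : Bary → ℝ) : ℝ := ∫ l in refTriangle, f l * g l ∂refMeasure

/-- The four triangles of the red-refinement of the reference triangle: the three corner
triangles and the middle one. -/
def refSub : Fin 4 → Set Bary :=
  ![{l ∈ refTriangle | 1 / 2 ≤ l 0}, {l ∈ refTriangle | 1 / 2 ≤ l 1},
    {l ∈ refTriangle | 1 / 2 ≤ l 2}, {l ∈ refTriangle | ∀ i, l i ≤ 1 / 2}]

/-- Continuous functions on the reference triangle that are polynomials of degree at most `k`
on each of the four triangles of its red-refinement. -/
def refSpace (k : ℕ) : Set (refTriangle → ℝ) :=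
  {f | Continuous f ∧ ∀ i : Fin 4, ∃ p : MvPolynomial (Fin 3) ℝ, p.totalDegree ≤ k ∧
    ∀ l : refTriangle, (l : Bary) ∈ refSub i → f l = MvPolynomial.eval (l : Bary) p}

/-- The points of the reference triangle whose barycentric coordinates are multiples of `1/4`:
the three vertices, the three midpoints of the edges, the six remaining points on the edges,
and the three interior points. -/
def refNode : Fin 15 → Bary :=
  ![![1, 0, 0], ![0, 1, 0], ![0, 0, 1],
    ![0, 1 / 2, 1 / 2], ![1 / 2, 0, 1 / 2], ![1 / 2, 1 / 2, 0],
    ![0, 3 / 4, 1 / 4], ![0, 1 / 4, 3 / 4], ![1 / 4, 0, 3 / 4], ![3 / 4, 0, 1 / 4],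
    ![3 / 4, 1 / 4, 0], ![1 / 4, 3 / 4, 0],
    ![1 / 2, 1 / 4, 1 / 4], ![1 / 4, 1 / 2, 1 / 4], ![1 / 4, 1 / 4, 1 / 2]]

/-- The nodal basis of the quadratic polynomials on the reference triangle, for the vertices
and the midpoints of the edges. -/
def quadNodal : Fin 6 → Bary → ℝ :=
  ![fun l => l 0 * (2 * l 0 - 1), fun l => l 1 * (2 * l 1 - 1), fun l => l 2 * (2 * l 2 - 1),
    fun l => 4 * (l 1 * l 2), fun l => 4 * (l 0 * l 2), fun l => 4 * (l 0 * l 1)]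

/-- The nodal basis of the continuous piecewise linears on the red-refined reference triangle,
for the vertices and the midpoints of the edges. -/
def hat : Fin 6 → Bary → ℝ :=
  ![fun l => max 0 (2 * l 0 - 1), fun l => max 0 (2 * l 1 - 1), fun l => max 0 (2 * l 2 - 1),
    fun l => max 0 (min (min (2 * l 1) (2 * l 2)) (1 - 2 * l 0)),
    fun l => max 0 (min (min (2 * l 0) (2 * l 2)) (1 - 2 * l 1)),
    fun l => max 0 (min (min (2 * l 0) (2 * l 1)) (1 - 2 * l 2))]

/-- The nodal basis of the continuous piecewise quadratics on the red-refined reference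
triangle, for the fifteen points `refNode`. On each of the four triangles the functions `hat`
are the barycentric coordinates of that triangle (or zero). -/
def fineNodal : Fin 15 → Bary → ℝ :=
  ![fun l => hat 0 l * (2 * hat 0 l - 1), fun l => hat 1 l * (2 * hat 1 l - 1),
    fun l => hat 2 l * (2 * hat 2 l - 1), fun l => hat 3 l * (2 * hat 3 l - 1),
    fun l => hat 4 l * (2 * hat 4 l - 1), fun l => hat 5 l * (2 * hat 5 l - 1),
    fun l => 4 * (hat 1 l * hat 3 l), fun l => 4 * (hat 2 l * hat 3 l),
    fun l => 4 * (hat 2 l * hat 4 l), fun l => 4 * (hat 0 l * hat 4 l),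
    fun l => 4 * (hat 0 l * hat 5 l), fun l => 4 * (hat 1 l * hat 5 l),
    fun l => 4 * (hat 4 l * hat 5 l), fun l => 4 * (hat 3 l * hat 5 l),
    fun l => 4 * (hat 3 l * hat 4 l)]

/-- The coefficients of `Θ ∪ Ξ` in the nodal basis `fineNodal`: the columns `0, …, 5` are
the functions of `Θ`, the columns `6, …, 14` those of `Ξ`. -/
def coeffMatrix : Matrix (Fin 15) (Fin 15) ℝ :=
  !![72, 0, 0, 0, 0, 0, 0, 0, 0, 0, 0, 0, 0, 0, 0;
     0, 72, 0, 0, 0, 0, 0, 0, 0, 0, 0, 0, 0, 0, 0;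
     0, 0, 72, 0, 0, 0, 0, 0, 0, 0, 0, 0, 0, 0, 0;
     0, 0, 0, 1560/81, 0, 0, -12/25, -12/25, 0, 0, 0, 0, 0, 0, 0;
     0, 0, 0, 0, 1560/81, 0, 0, 0, -12/25, -12/25, 0, 0, 0, 0, 0;
     0, 0, 0, 0, 0, 1560/81, 0, 0, 0, 0, -12/25, -12/25, 0, 0, 0;
     0, 6, 0, 530/81, 0, 0, 1, -2/25, 0, 0, 0, 0, 0, 0, 0;
     0, 0, 6, 530/81, 0, 0, -2/25, 1, 0, 0, 0, 0, 0, 0, 0;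
     0, 0, 6, 0, 530/81, 0, 0, 0, 1, -2/25, 0, 0, 0, 0, 0;
     6, 0, 0, 0, 530/81, 0, 0, 0, -2/25, 1, 0, 0, 0, 0, 0;
     6, 0, 0, 0, 0, 530/81, 0, 0, 0, 0, 1, -2/25, 0, 0, 0;
     0, 6, 0, 0, 0, 530/81, 0, 0, 0, 0, -2/25, 1, 0, 0, 0;
     0, 0, 0, 0, 50/81, 50/81, 0, 0, 1/25, -8/25, -8/25, 1/25, -5/4, 1, 1;
     0, 0, 0, 50/81, 0, 50/81, -8/25, 1/25, 0, 0, 1/25, -8/25, 1, -5/4, 1;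
     0, 0, 0, 50/81, 50/81, 0, 1/25, -8/25, -8/25, 1/25, 0, 0, 1, 1, -5/4]

/-- The coefficients of the functions of `Φ̃` (columns) in the nodal basis `hat`. -/
def dualMatrix : Matrix (Fin 6) (Fin 6) ℝ :=
  !![1, 0, 0, 0, 0, 0;
     0, 1, 0, 0, 0, 0;
     0, 0, 1, 0, 0, 0;
     0, -4/27, -4/27, 1, 0, 0;
     -4/27, 0, -4/27, 0, 1, 0;
     -4/27, -4/27, 0, 0, 0, 1]

/-- The matrix `⟨Ξ, Φ̃⟩ / vol`. -/
def xiPhiMatrix : Matrix (Fin 9) (Fin 6) ℝ :=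
  !![0, 3/100, 0, 0, 0, 0;
     0, 0, 3/100, 0, 0, 0;
     0, 0, 3/100, 0, 0, 0;
     3/100, 0, 0, 0, 0, 0;
     3/100, 0, 0, 0, 0, 0;
     0, 3/100, 0, 0, 0, 0;
     -1/48, 0, 0, 27/240, 0, 0;
     0, -1/48, 0, 0, 27/240, 0;
     0, 0, -1/48, 0, 0, 27/240]

/-! ### Local collections -/

/-- A finite collection of functions on the reference triangle, each one labelled by a point
of the reference triangle. -/
structure LocalCollection (ι : Type) where
  /-- the label of a function -/
  node : ι → Bary
  /-- the function -/
  fn : ι → Bary → ℝ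

/-- The conditions on a local collection: each function vanishes on every edge and at every
vertex that does not contain its label; the collection is invariant under permutations of the
barycentric coordinates; the functions are continuous and linearly independent, with distinct
labels in the reference triangle. -/
structure LocalCollection.IsAdmissible {ι : Type} (S : LocalCollection ι) : Prop where
  node_mem : ∀ i, S.node i ∈ refTriangle
  node_injective : Function.Injective S.node
  vanish_edge : ∀ i k, S.node i k ≠ 0 → ∀ l ∈ refTriangle, l k = 0 → S.fn i l = 0
  vanish_vertex : ∀ i k, S.node i ≠ Pi.single k 1 → S.fn i (Pi.single k 1) = 0
  symmetric : ∀ (π : Equiv.Perm (Fin 3)) (i : ι), ∃ i', S.node i' = S.node i ∘ π ∧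
    ∀ l ∈ refTriangle, S.fn i l = S.fn i' (l ∘ π)
  continuous : ∀ i, ContinuousOn (S.fn i) refTriangle
  independent : LinearIndependent ℝ fun i => refTriangle.domRestrict (S.fn i)

/-- The family `f` is a basis of the linear space of functions `W` on the reference
triangle. -/
def IsLocalBasis {ι : Type} (f : ι → Bary → ℝ) (W : Set (refTriangle → ℝ)) : Prop :=
  LinearIndependent ℝ (fun i => refTriangle.domRestrict (f i)) ∧
    (Submodule.span ℝ (range fun i => refTriangle.domRestrict (f i)) : Set (refTriangle → ℝ)) = W

/-- The collection `N`. -/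
def locN : LocalCollection (Fin 6) where
  node i := refNode (Fin.castLE (by norm_num) i)
  fn := quadNodal

/-- The collection `Θ`. -/
def locTheta : LocalCollection (Fin 6) where
  node i := refNode (Fin.castLE (by norm_num) i)
  fn i l := ∑ k, coeffMatrix k (Fin.castLE (by norm_num) i) * fineNodal k l

/-- The collection `Ξ`. -/
def locXi : LocalCollection (Fin 9) where
  node i := refNode (Fin.natAdd 6 i)
  fn i l := ∑ k, coeffMatrix k (Fin.natAdd 6 i) * fineNodal k l

/-- The collection `Φ̃`. -/
def locPhi : LocalCollection (Fin 6) where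
  node i := refNode (Fin.castLE (by norm_num) i)
  fn i l := ∑ k, dualMatrix k i * hat k l

/-! ### Triangulations -/

/-- A triangle in the plane, given by its vertices in some order. -/
abbrev Tri : Type := Fin 3 → Plane

/-- The closed triangle with the given vertices. -/
def hull (T : Tri) : Set Plane := convexHull ℝ (range T)

/-- The area of a triangle. -/
def vol (T : Tri) : ℝ := (volume : Measure Plane).real (hull T)

/-- The point with given barycentric coordinates. -/
def point (T : Tri) (l : Bary) : Plane := ∑ i, l i • T i

/-- Twice the signed area of the triangle `a b c`. -/
def signedArea (a b c : Plane) : ℝ :=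
  (b 0 - a 0) * (c 1 - a 1) - (b 1 - a 1) * (c 0 - a 0)

/-- The barycentric coordinates of a point with respect to a non-degenerate triangle. -/
def bary (T : Tri) (x : Plane) : Bary := fun i =>
  signedArea x (T (i + 1)) (T (i + 2)) / signedArea (T 0) (T 1) (T 2)

/-- A finite conforming triangulation: non-degenerate triangles, no triangle listed twice, and
two different triangles meet exactly in the convex hull of their common vertices (nothing, a
common vertex, or a common edge). -/
structure IsConforming (𝒯 : Finset Tri) : Prop where
  nondegenerate : ∀ T ∈ 𝒯, AffineIndependent ℝ T
  distinct : ∀ S ∈ 𝒯, ∀ T ∈ 𝒯, S ≠ T → range S ≠ range T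
  inter : ∀ S ∈ 𝒯, ∀ T ∈ 𝒯, S ≠ T → hull S ∩ hull T = convexHull ℝ (range S ∩ range T)

/-- The union of the closed triangles (the closed polygon). -/
def carrier (𝒯 : Finset Tri) : Set Plane := ⋃ T ∈ 𝒯, hull T

/-- The open polygon `Ω`. -/
def domain (𝒯 : Finset Tri) : Set Plane := interior (carrier 𝒯)

/-- The closed edges of a triangulation. -/
def edges (𝒯 : Finset Tri) : Set (Set Plane) :=
  {e | ∃ T ∈ 𝒯, ∃ i : Fin 3, e = segment ℝ (T (i + 1)) (T (i + 2))}

/-- `Γ` is a (possibly empty) union of edges and is contained in the boundary of `Ω`. -/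
def IsDirichletPart (𝒯 : Finset Tri) (Γ : Set Plane) : Prop :=
  (∃ E ⊆ edges 𝒯, Γ = ⋃₀ E) ∧ Γ ⊆ frontier (domain 𝒯)

/-- The four triangles of the red-refinement of a triangle. -/
def child (T : Tri) : Fin 4 → Tri :=
  ![![T 0, midpoint ℝ (T 0) (T 1), midpoint ℝ (T 0) (T 2)],
    ![midpoint ℝ (T 0) (T 1), T 1, midpoint ℝ (T 1) (T 2)],
    ![midpoint ℝ (T 0) (T 2), midpoint ℝ (T 1) (T 2), T 2],
    ![midpoint ℝ (T 1) (T 2), midpoint ℝ (T 0) (T 2), midpoint ℝ (T 0) (T 1)]]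

open Classical in
/-- Red-refinement of a triangulation. -/
def red (𝒯 : Finset Tri) : Finset Tri := 𝒯.biUnion fun T => Finset.univ.image (child T)

/-- The triangulation `𝒯_j` obtained by `j` red-refinements. -/
def level (𝒯 : Finset Tri) (j : ℕ) : Finset Tri := red^[j] 𝒯

/-- Continuous functions on the closed polygon, extended by zero, that are polynomials of degree
at most `k` on each triangle and vanish on `Γ`. -/
def feSpace (k : ℕ) (𝒯 : Finset Tri) (Γ : Set Plane) : Set (Plane → ℝ) :=
  {f | ContinuousOn f (carrier 𝒯) ∧ (∀ x ∉ carrier 𝒯, f x = 0) ∧ (∀ x ∈ Γ, f x = 0) ∧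
    ∀ T ∈ 𝒯, ∃ p : MvPolynomial (Fin 2) ℝ, p.totalDegree ≤ k ∧
      ∀ x ∈ hull T, f x = MvPolynomial.eval (fun i => x i) p}

/-- `V_j`: quadratics with respect to `𝒯_j`. -/
def primal (𝒯 : Finset Tri) (Γ : Set Plane) (j : ℕ) : Set (Plane → ℝ) :=
  feSpace 2 (level 𝒯 j) Γ

/-- `Ṽ_j`: linears with respect to `𝒯_{j+1}`. -/
def dual (𝒯 : Finset Tri) (Γ : Set Plane) (j : ℕ) : Set (Plane → ℝ) :=
  feSpace 1 (level 𝒯 (j + 1)) Γ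

/-- The `L₂(Ω)` inner product. -/
def inner₂ (Ω : Set Plane) (f g : Plane → ℝ) : ℝ := ∫ x in Ω, f x * g x

/-- `V_{j+1} ∩ Ṽ_j^⊥`, the orthogonal complement being taken in `L₂(Ω)`. -/
def waveletSpace (𝒯 : Finset Tri) (Γ : Set Plane) (j : ℕ) : Set (Plane → ℝ) :=
  {f ∈ primal 𝒯 Γ (j + 1) | ∀ g ∈ dual 𝒯 Γ j, inner₂ (domain 𝒯) f g = 0}

/-- The finite family `σ` spans `W`, and `c ‖a‖² ≤ ‖∑ a_i σ_i‖² ≤ C ‖a‖²` in `L₂(Ω)`, for all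
coefficient vectors `a`. -/
def IsRieszBasis {ι : Type} [Fintype ι] (Ω : Set Plane) (c C : ℝ) (σ : ι → Plane → ℝ)
    (W : Set (Plane → ℝ)) : Prop :=
  (Submodule.span ℝ (range σ) : Set (Plane → ℝ)) = W ∧
    ∀ a : ι → ℝ,
      c * ∑ i, a i ^ 2 ≤ inner₂ Ω (∑ i, a i • σ i) (∑ i, a i • σ i) ∧
      inner₂ Ω (∑ i, a i • σ i) (∑ i, a i • σ i) ≤ C * ∑ i, a i ^ 2

/-! ### From local to global collections -/

open Classical in
/-- The points outside `Γ` whose barycentric coordinates with respect to some triangle are a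
label of the local collection. -/
def index {ι : Type} [Fintype ι] (S : LocalCollection ι) (𝒯 : Finset Tri) (Γ : Set Plane) :
    Finset Plane :=
  ((𝒯 ×ˢ (Finset.univ : Finset ι)).image fun q => point q.1 (S.node q.2)).filter (· ∉ Γ)

open Classical in
/-- The triangles that contain `x`. -/
def star (𝒯 : Finset Tri) (x : Plane) : Finset Tri := 𝒯.filter fun T => x ∈ hull T

/-- The scaling factor: the total area of the triangles that contain `x`, to the power
`-1/2`. -/
def scaling (𝒯 : Finset Tri) (x : Plane) : ℝ := (Real.sqrt (∑ T ∈ star 𝒯 x, vol T))⁻¹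

open Classical in
/-- The global function with label `x`. If `x` and `y` are in a triangle `T` of the
triangulation, and `S.node i` are the barycentric coordinates of `x` in `T`, then its value at
`y` is the scaled value of the `i`-th local function at the barycentric coordinates of `y`;
otherwise it is zero. -/
def globalFn {ι : Type} (S : LocalCollection ι) (𝒯 : Finset Tri) (x y : Plane) : ℝ :=
  if h : ∃ q : Tri × ι, q.1 ∈ 𝒯 ∧ x = point q.1 (S.node q.2) ∧ y ∈ hull q.1 then
    scaling 𝒯 x * S.fn h.choose.2 (bary h.choose.1 y)
  else 0

/-- The index set of `N_j` (all vertices of `𝒯_{j+1}` outside `Γ`). -/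
def idxN (𝒯 : Finset Tri) (Γ : Set Plane) (j : ℕ) : Finset Plane := index locN (level 𝒯 j) Γ

/-- The index set of `Θ_j` and of `Φ̃_j` (all vertices of `𝒯_{j+1}` outside `Γ`). -/
def idxTheta (𝒯 : Finset Tri) (Γ : Set Plane) (j : ℕ) : Finset Plane :=
  index locTheta (level 𝒯 j) Γ

/-- The index set of `Ξ_{j+1}` and of `Ψ_{j+1}` (the vertices of `𝒯_{j+2}` outside `Γ` that are
not vertices of `𝒯_{j+1}`). -/
def idxXi (𝒯 : Finset Tri) (Γ : Set Plane) (j : ℕ) : Finset Plane := index locXi (level 𝒯 j) Γ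

/-- The functions of `N_j` (multiples of the nodal functions of `V_j`). -/
def nodal (𝒯 : Finset Tri) (j : ℕ) : Plane → Plane → ℝ := globalFn locN (level 𝒯 j)

/-- The functions of `Θ_j`. -/
def theta (𝒯 : Finset Tri) (j : ℕ) : Plane → Plane → ℝ := globalFn locTheta (level 𝒯 j)

/-- The functions of `Ξ_{j+1}`. -/
def xi (𝒯 : Finset Tri) (j : ℕ) : Plane → Plane → ℝ := globalFn locXi (level 𝒯 j)

/-- The functions of `Φ̃_j`. -/
def phi (𝒯 : Finset Tri) (j : ℕ) : Plane → Plane → ℝ := globalFn locPhi (level 𝒯 j)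

/-- The wavelets `Ψ_{j+1} = Ξ_{j+1} - ⟨Ξ_{j+1}, Φ̃_j⟩ Θ_j`. -/
def psi (𝒯 : Finset Tri) (Γ : Set Plane) (j : ℕ) (x : Plane) : Plane → ℝ :=
  xi 𝒯 j x - ∑ y ∈ idxTheta 𝒯 Γ j, inner₂ (domain 𝒯) (xi 𝒯 j x) (phi 𝒯 j y) • theta 𝒯 j y

/-! ### Counting nodal functions -/

/-- The valence of a vertex: the number of edges that emanate from it. -/
def valence (𝒯 : Finset Tri) (y : Plane) : ℕ :=
  {z | ∃ T ∈ 𝒯, ∃ i k : Fin 3, i ≠ k ∧ T i = y ∧ T k = z}.ncard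

/-- `f` is a linear combination of the functions of `N_j`, with exactly `n` non-zero
coefficients. -/
def IsCombinationOf (𝒯 : Finset Tri) (Γ : Set Plane) (j : ℕ) (f : Plane → ℝ) (n : ℕ) : Prop :=
  (∃ a : Plane → ℝ, f = ∑ z ∈ idxN 𝒯 Γ j, a z • nodal 𝒯 j z) ∧
    ∀ a : Plane → ℝ, f = ∑ z ∈ idxN 𝒯 Γ j, a z • nodal 𝒯 j z →
      {z ∈ (idxN 𝒯 Γ j : Set Plane) | a z ≠ 0}.ncard = n

end QuadWavelet

end

noncomputable section

namespace QuadWavelet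

/-! Everything is pulled back to the reference triangle. On a triangle T the inner product equals
vol(T) times one fixed form `nInner` of the pulled-back functions (`setIntegral_hull`); the shape of
T does not enter. A global combination with coefficients a_x restricts to T as a local combination
with coefficients a_x s_x, where s_x is the scaling factor. The local functions are independent, so
their Gram matrix lies between constants c > 0 and C that depend on the local collection alone.
Summed over T, the local bounds become c and C times Σ_x a_x² s_x² Σ_{T ∋ x} vol(T) = Σ_x a_x². This
is why the constants are absolute (`riesz_bounds_of_gram`), and the same normalisation turns local
into global biorthogonality (`inner₂_theta_phi`).

Gluing rests on `IsConforming.exists_matching`: for two triangles of a conforming triangulation, one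
permutation of the vertices relates the barycentric coordinates of all common points. Permutation
invariance then makes the global functions well defined; vanishing on edges away from the label
makes them continuous and zero on Γ. Red-refinement preserves conformity and the property of Γ that
is needed (`IsFaceUnion`), so every level can be treated as an initial triangulation. The lower
Riesz bound gives independence, piecewise interpolation gives unisolvence at the labels, and
equality of the two counts gives spanning (`span_eq_of_unisolvent`).

By biorthogonality, f ↦ f - Σ_y ⟨f, φ̃_y⟩ θ_y annihilates Θ and maps into the complement of Φ̃.
Applied to Σ b_x ξ_x it leaves the Ξ-coefficients b_x unchanged, so the lower bound for Θ ∪ Ξ is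
inherited by Ψ; the new Θ-coefficients are controlled by a Bessel inequality (`bessel`,
`isRieszBasis_wavelet`).

For the counts, a nodal coefficient of ψ_x is non-zero exactly where ψ_x is non-zero at that node.
The function ξ_x is corrected by θ at one vertex or, for interior x, at one vertex and one midpoint,
and those outside Γ only. The node supports of these functions are patterns of columns of
`coeffMatrix`. Where two of them overlap, the values cannot cancel, because the correction is small
and the ratio of star areas is at most one. So the count is the size of a union.

The numerical facts about the local collections reduce to one formula for integrals of cubics and to
finite checks on integer matrices. -/

/-! ### Barycentric coordinates and closed triangles. -/

theorem point_apply (T : Tri) (l : Bary) (k : Fin 2) : point T l k = ∑ i, l i * T i k := by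
  simp [point]

theorem point_add (T : Tri) (l m : Bary) : point T (l + m) = point T l + point T m := by
  simp [point, add_smul, Finset.sum_add_distrib]

theorem point_smul (T : Tri) (a : ℝ) (l : Bary) : point T (a • l) = a • point T l := by
  simp [point, Finset.smul_sum, mul_smul]

theorem point_single (T : Tri) (k : Fin 3) : point T (Pi.single k 1) = T k := by
  simp [point, Pi.single_apply]

theorem point_comp (T : Tri) (l : Bary) (π : Equiv.Perm (Fin 3)) :
    point T (l ∘ π) = point (T ∘ π.symm) l := by
  simp only [point, Function.comp_apply]
  exact Fintype.sum_equiv π _ _ (by simp)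

theorem signedArea_ne_zero {T : Tri} (h : AffineIndependent ℝ T) :
    signedArea (T 0) (T 1) (T 2) ≠ 0 := by
  intro h0
  rw [affineIndependent_iff] at h
  simp only [signedArea] at h0
  have key : ∀ u v : ℝ, u * (T 1 0 - T 0 0) + v * (T 2 0 - T 0 0) = 0 →
      u * (T 1 1 - T 0 1) + v * (T 2 1 - T 0 1) = 0 → u = 0 ∧ v = 0 := by
    intro u v h1 h2
    have := h Finset.univ ![-u - v, u, v] (by simp [Fin.sum_univ_three]; ring) (by
      ext k
      fin_cases k <;> simp [Fin.sum_univ_three] <;> linarith)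
    exact ⟨by simpa using this 1 (by simp), by simpa using this 2 (by simp)⟩
  -- If the determinant vanishes, then each row of coordinates, swapped and with one sign changed,
  -- is a dependency between the two edge vectors. So all their coordinates vanish, and then (1, 0)
  -- is a dependency as well.
  have h1 := key (T 2 0 - T 0 0) (-(T 1 0 - T 0 0)) (by ring) (by linarith)
  have h2 := key (T 2 1 - T 0 1) (-(T 1 1 - T 0 1)) (by linarith) (by ring)
  have h3 := key 1 0 (by linarith [h1.2]) (by linarith [h2.2])
  exact one_ne_zero h3.1

theorem affineIndependent_of_signedArea {T : Tri} (h : signedArea (T 0) (T 1) (T 2) ≠ 0) :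
    AffineIndependent ℝ T := by
  rw [affineIndependent_iff_of_fintype]
  intro w hw h0
  rw [Finset.weightedVSub_eq_linear_combination _ hw] at h0
  have e0 := congrArg (fun v : Plane => v 0) h0
  have e1 := congrArg (fun v : Plane => v 1) h0
  simp [Fin.sum_univ_three] at hw e0 e1
  simp only [signedArea] at h
  have w0 : w 0 = -w 1 - w 2 := by linarith
  rw [w0] at e0 e1
  have h1 : w 1 = 0 := by
    refine (mul_eq_zero.1 (?_ : w 1 * _ = 0)).resolve_right h
    linear_combination (T 2 1 - T 0 1) * e0 - (T 2 0 - T 0 0) * e1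
  have h2 : w 2 = 0 := by
    refine (mul_eq_zero.1 (?_ : w 2 * _ = 0)).resolve_right h
    linear_combination (T 1 0 - T 0 0) * e1 - (T 1 1 - T 0 1) * e0
  intro i
  fin_cases i
  · simp [w0, h1, h2]
  · exact h1
  · exact h2

theorem bary_sum {T : Tri} (h : AffineIndependent ℝ T) (x : Plane) : ∑ i, bary T x i = 1 := by
  have := signedArea_ne_zero h
  simp only [bary, Fin.sum_univ_three, ← add_div]
  rw [div_eq_one_iff_eq this]
  simp [signedArea]
  ring

theorem point_bary {T : Tri} (h : AffineIndependent ℝ T) (x : Plane) : point T (bary T x) = x := by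
  have h0 := signedArea_ne_zero h
  ext k
  rw [point_apply]
  simp only [bary, Fin.sum_univ_three, div_mul_eq_mul_div, ← add_div]
  rw [div_eq_iff h0]
  fin_cases k <;> simp [signedArea] <;> ring

theorem bary_point {T : Tri} (h : AffineIndependent ℝ T) {l : Bary} (hl : ∑ i, l i = 1) :
    bary T (point T l) = l := by
  have h0 := signedArea_ne_zero h
  rw [Fin.sum_univ_three] at hl
  have h1 : l 0 = 1 - l 1 - l 2 := by linarith
  funext k
  simp only [bary]
  rw [div_eq_iff h0]
  fin_cases k <;> simp [signedArea, point_apply, Fin.sum_univ_three, h1] <;> ring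

theorem bary_vertex {T : Tri} (h : AffineIndependent ℝ T) (k : Fin 3) :
    bary T (T k) = Pi.single k 1 := by
  rw [← point_single T k, bary_point h (by simp)]

theorem mem_refTriangle {l : Bary} : l ∈ refTriangle ↔ (∀ i, 0 ≤ l i) ∧ ∑ i, l i = 1 := Iff.rfl

/-- `point T` is linear on ℝ³, hence commutes with convex hulls, and the simplex is the hull of the
unit vectors. -/
theorem hull_eq (T : Tri) : hull T = point T '' refTriangle := by
  have h : point T = ⇑(∑ i, (LinearMap.proj (R := ℝ) (φ := fun _ : Fin 3 => ℝ) i).smulRight (T i)) := by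
    ext1 l
    simp [point]
  rw [refTriangle, ← convexHull_rangle_single_eq_stdSimplex, h, LinearMap.image_convexHull, ← h,
    ← range_comp, hull]
  congr 2
  funext k
  exact (point_single T k).symm

theorem point_mem_hull (T : Tri) {l : Bary} (hl : l ∈ refTriangle) : point T l ∈ hull T := by
  rw [hull_eq]
  exact mem_image_of_mem _ hl

theorem mem_hull {T : Tri} (h : AffineIndependent ℝ T) {x : Plane} :
    x ∈ hull T ↔ bary T x ∈ refTriangle := by
  rw [hull_eq]
  constructor
  · rintro ⟨l, hl, rfl⟩
    rwa [bary_point h hl.2]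
  · exact fun hx => ⟨_, hx, point_bary h x⟩

theorem vertex_mem_hull (T : Tri) (k : Fin 3) : T k ∈ hull T :=
  subset_convexHull ℝ _ (mem_range_self k)

theorem point_injective {T : Tri} (h : AffineIndependent ℝ T) {l m : Bary} (hl : ∑ i, l i = 1)
    (hm : ∑ i, m i = 1) (e : point T l = point T m) : l = m := by
  rw [← bary_point h hl, e, bary_point h hm]

theorem continuous_bary (T : Tri) : Continuous (bary T) := by
  refine continuous_pi fun i => ?_
  simp only [bary, signedArea]
  fun_prop

theorem continuous_point (T : Tri) : Continuous (point T) := by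
  unfold point
  fun_prop

theorem isCompact_hull (T : Tri) : IsCompact (hull T) := by
  rw [hull_eq]
  exact (isCompact_stdSimplex ℝ _).image (continuous_point T)

theorem isClosed_hull (T : Tri) : IsClosed (hull T) := (isCompact_hull T).isClosed

/-! ### Integration over a triangle -/

/-- The parameter domain of the reference triangle. -/
def paramDomain : Set (ℝ × ℝ) := {p | 0 ≤ p.1 ∧ 0 ≤ p.2 ∧ p.1 + p.2 ≤ 1}

/-- The parametrization of the plane of the reference triangle. -/
def param (p : ℝ × ℝ) : Bary := ![1 - p.1 - p.2, p.1, p.2]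

theorem continuous_param : Continuous param := by
  refine continuous_pi fun i => ?_
  fin_cases i <;> simp [param] <;> fun_prop

theorem param_sum (p : ℝ × ℝ) : ∑ i, param p i = 1 := by
  simp [param, Fin.sum_univ_three]
  ring

theorem param_injective : Function.Injective param := by
  intro p q h
  have h1 := congrFun h 1
  have h2 := congrFun h 2
  simp [param] at h1 h2
  exact Prod.ext h1 h2

theorem param_mem {p : ℝ × ℝ} : param p ∈ refTriangle ↔ p ∈ paramDomain := by
  rw [mem_refTriangle]
  simp only [param_sum, and_true, Fin.forall_fin_succ]
  simp [param, paramDomain]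
  constructor
  · rintro ⟨a, b, c⟩
    exact ⟨b, c, by linarith⟩
  · rintro ⟨a, b, c⟩
    exact ⟨by linarith, a, b⟩

theorem param_surj {l : Bary} (hl : ∑ i, l i = 1) : param (l 1, l 2) = l := by
  rw [Fin.sum_univ_three] at hl
  funext i
  fin_cases i <;> simp [param]
  linarith

theorem isClosed_paramDomain : IsClosed paramDomain := by
  refine (isClosed_le continuous_const continuous_fst).inter
    ((isClosed_le continuous_const continuous_snd).inter
    (isClosed_le (continuous_fst.add continuous_snd) continuous_const))

theorem paramDomain_subset : paramDomain ⊆ Icc 0 1 ×ˢ Icc 0 1 := by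
  rintro ⟨a, b⟩ ⟨h1, h2, h3⟩
  simp only at h1 h2 h3
  exact ⟨⟨h1, by linarith⟩, ⟨h2, by linarith⟩⟩

theorem isCompact_paramDomain : IsCompact paramDomain :=
  (isCompact_Icc.prod isCompact_Icc).of_isClosed_subset isClosed_paramDomain paramDomain_subset

theorem measurableEmbedding_param : MeasurableEmbedding param :=
  continuous_param.measurableEmbedding param_injective

theorem preimage_param : param ⁻¹' refTriangle = paramDomain := ext fun _ => param_mem

theorem refMeasure_eq : refMeasure =
    ENNReal.ofReal (Real.sqrt 3) • ((volume : Measure (ℝ × ℝ)).restrict paramDomain).map param :=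
  rfl

/-- The `L₂` inner product on the reference triangle, for the measure of total mass one. -/
def nInner (f g : Bary → ℝ) : ℝ := 2 * ∫ p in paramDomain, f (param p) * g (param p)

theorem setIntegral_refTriangle (f : Bary → ℝ) :
    ∫ l in refTriangle, f l ∂refMeasure = Real.sqrt 3 * ∫ p in paramDomain, f (param p) := by
  rw [refMeasure_eq, Measure.restrict_smul, integral_smul_measure,
    measurableEmbedding_param.restrict_map, preimage_param, Measure.restrict_restrict
    isClosed_paramDomain.measurableSet, inter_self, measurableEmbedding_param.integral_map,
    ENNReal.toReal_ofReal (Real.sqrt_nonneg _), smul_eq_mul]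

/-- The affine parametrization of the plane by a triangle. -/
theorem map_point_param {T : Tri} (h : AffineIndependent ℝ T) :
    (volume : Measure (ℝ × ℝ)).map (fun p => point T (param p)) =
      ENNReal.ofReal |(signedArea (T 0) (T 1) (T 2))⁻¹| • (volume : Measure Plane) := by
  have h0 := signedArea_ne_zero h
  let L : (ℝ × ℝ) →ₗ[ℝ] ℝ × ℝ := Matrix.toLin (Module.Basis.finTwoProd ℝ) (Module.Basis.finTwoProd ℝ)
    !![T 1 0 - T 0 0, T 2 0 - T 0 0; T 1 1 - T 0 1, T 2 1 - T 0 1]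
  have hdet : LinearMap.det L = signedArea (T 0) (T 1) (T 2) := by
    rw [LinearMap.det_toLin, Matrix.det_fin_two_of, signedArea]
    ring
  have hL := Measure.map_linearMap_addHaar_eq_smul_addHaar (volume : Measure (ℝ × ℝ))
    (f := L) (by rwa [hdet])
  rw [hdet] at hL
  let e : ℝ × ℝ ≃ᵐ Plane := (MeasurableEquiv.finTwoArrow (α := ℝ)).symm.trans
    (MeasurableEquiv.toLp 2 (Fin 2 → ℝ))
  have he : MeasurePreserving e volume volume :=
    (EuclideanSpace.volume_preserving_symm_measurableEquiv_toLp (Fin 2)).symm.comp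
      ((volume_preserving_finTwoArrow ℝ).symm)
  -- Of the three factors only the linear map `L`, whose determinant is the signed area, changes the
  -- measure; `e` and the translation preserve it.
  have hcomp : (fun p => point T (param p)) = (fun x => T 0 + x) ∘ e ∘ L := by
    funext p
    ext k
    rw [point_apply]
    simp only [L, Function.comp_apply, Matrix.toLin_finTwoProd_apply]
    fin_cases k <;> simp [e, Fin.sum_univ_three, param, MeasurableEquiv.finTwoArrow] <;> ring
  rw [hcomp, ← Measure.map_map (measurable_const_add _)
    (e.measurable.comp L.continuous_of_finiteDimensional.measurable),
    ← Measure.map_map e.measurable L.continuous_of_finiteDimensional.measurable, hL,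
    Measure.map_smul, he.map_eq, Measure.map_smul, map_add_left_eq_self]

/-- The parametrization is a measurable embedding, so the change of variables holds for arbitrary
`f`, without measurability or integrability. -/
theorem setIntegral_hull_eq {T : Tri} (h : AffineIndependent ℝ T) (f : Plane → ℝ) :
    ∫ x in hull T, f x =
      |signedArea (T 0) (T 1) (T 2)| * ∫ p in paramDomain, f (point T (param p)) := by
  have h0 := signedArea_ne_zero h
  have hemb : MeasurableEmbedding fun p => point T (param p) :=
    ((continuous_point T).comp continuous_param).measurableEmbedding fun p q hpq =>
      param_injective (point_injective h (param_sum p) (param_sum q) hpq)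
  have hpre : (fun p => point T (param p)) ⁻¹' hull T = paramDomain := by
    ext p
    rw [mem_preimage, mem_hull h, bary_point h (param_sum p), param_mem]
  have hvol : (volume : Measure Plane) = ENNReal.ofReal |signedArea (T 0) (T 1) (T 2)| •
      (volume : Measure (ℝ × ℝ)).map (fun p => point T (param p)) := by
    rw [map_point_param h, smul_smul, ← ENNReal.ofReal_mul (abs_nonneg _), ← abs_mul,
      mul_inv_cancel₀ h0]
    simp
  rw [hvol, Measure.restrict_smul, integral_smul_measure, hemb.restrict_map, hpre,
    hemb.integral_map, ENNReal.toReal_ofReal (abs_nonneg _), smul_eq_mul]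

theorem integrableOn_paramDomain {f : ℝ × ℝ → ℝ} (hf : ContinuousOn f paramDomain) :
    IntegrableOn f paramDomain :=
  hf.integrableOn_compact isCompact_paramDomain

theorem setIntegral_paramDomain {f : ℝ × ℝ → ℝ} (hf : ContinuousOn f paramDomain) :
    ∫ p in paramDomain, f p = ∫ s in (0 : ℝ)..1, ∫ t in (0 : ℝ)..(1 - s), f (s, t) := by
  have hm := isClosed_paramDomain.measurableSet
  rw [← integral_indicator hm, Measure.volume_eq_prod, integral_prod _
    ((integrable_indicator_iff hm).2 (integrableOn_paramDomain hf)),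
    intervalIntegral.integral_of_le zero_le_one, ← integral_Icc_eq_integral_Ioc,
    ← integral_indicator measurableSet_Icc]
  congr 1
  funext s
  by_cases hs : s ∈ Icc (0 : ℝ) 1
  · rw [indicator_of_mem hs, intervalIntegral.integral_of_le (by linarith [hs.2]),
      ← integral_Icc_eq_integral_Ioc, ← integral_indicator measurableSet_Icc]
    congr 1
    funext t
    simp only [indicator]
    congr 1
    have := hs.1
    simp only [paramDomain, mem_ofPred_eq, mem_Icc, eq_iff_iff]
    constructor
    · rintro ⟨_, h2, h3⟩
      exact ⟨h2, by linarith⟩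
    · rintro ⟨h2, h3⟩
      exact ⟨this, h2, by linarith⟩
  · rw [indicator_of_notMem hs]
    convert integral_zero ℝ ℝ with t
    refine indicator_of_notMem (fun h => hs ?_) _
    exact (paramDomain_subset h).1

/-- A quadratic nodal function times a barycentric coordinate is cubic in the two parameters, so
every numerical inner product below comes from this formula. The weights are ∫ sᵃtᵇ = a! b! / (a + b
+ 2)!. -/
theorem integral_cubic (c : Fin 10 → ℝ) :
    ∫ p in paramDomain, (c 0 + c 1 * p.1 + c 2 * p.2 + c 3 * p.1 ^ 2 + c 4 * (p.1 * p.2) +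
      c 5 * p.2 ^ 2 + c 6 * p.1 ^ 3 + c 7 * (p.1 ^ 2 * p.2) + c 8 * (p.1 * p.2 ^ 2) +
      c 9 * p.2 ^ 3) =
    c 0 / 2 + (c 1 + c 2) / 6 + (c 3 + c 5) / 12 + c 4 / 24 + (c 6 + c 9) / 20 +
      (c 7 + c 8) / 60 := by
  rw [setIntegral_paramDomain (by fun_prop)]
  have h1 : ∀ s : ℝ, ∫ t in (0 : ℝ)..(1 - s), (c 0 + c 1 * s + c 2 * t + c 3 * s ^ 2 +
      c 4 * (s * t) + c 5 * t ^ 2 + c 6 * s ^ 3 + c 7 * (s ^ 2 * t) + c 8 * (s * t ^ 2) +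
      c 9 * t ^ 3) = (c 0 + c 1 * s + c 3 * s ^ 2 + c 6 * s ^ 3) * (1 - s) +
      (c 2 + c 4 * s + c 7 * s ^ 2) * ((1 - s) ^ 2 / 2) + (c 5 + c 8 * s) * ((1 - s) ^ 3 / 3) +
      c 9 * ((1 - s) ^ 4 / 4) := by
    intro s
    let F : ℝ → ℝ := fun t => (c 0 + c 1 * s + c 3 * s ^ 2 + c 6 * s ^ 3) * t +
      (c 2 + c 4 * s + c 7 * s ^ 2) * (t ^ 2 / 2) + (c 5 + c 8 * s) * (t ^ 3 / 3) +
      c 9 * (t ^ 4 / 4)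
    rw [intervalIntegral.integral_eq_sub_of_hasDerivAt (f := F)]
    · simp [F]
    · intro t _
      have h := ((((hasDerivAt_id t).const_mul (c 0 + c 1 * s + c 3 * s ^ 2 + c 6 * s ^ 3)).add
        (((hasDerivAt_pow 2 t).div_const 2).const_mul (c 2 + c 4 * s + c 7 * s ^ 2))).add
        (((hasDerivAt_pow 3 t).div_const 3).const_mul (c 5 + c 8 * s))).add
        (((hasDerivAt_pow 4 t).div_const 4).const_mul (c 9))
      refine h.congr_deriv ?_
      norm_num
      ring
    · exact Continuous.intervalIntegrable (by fun_prop) _ _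
  simp only [h1]
  -- The primitive of the inner integral, after expansion in powers of `s`.
  let F : ℝ → ℝ := fun s => (c 0 + c 2 / 2 + c 5 / 3 + c 9 / 4) * s +
    (c 1 - c 0 + c 4 / 2 - c 2 + c 8 / 3 - c 5 - c 9) * (s ^ 2 / 2) +
    (c 3 - c 1 + c 2 / 2 - c 4 + c 7 / 2 + c 5 - c 8 + 3 / 2 * c 9) * (s ^ 3 / 3) +
    (c 6 - c 3 + c 4 / 2 - c 7 - c 5 / 3 + c 8 - c 9) * (s ^ 4 / 4) +
    (-c 6 + c 7 / 2 - c 8 / 3 + c 9 / 4) * (s ^ 5 / 5)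
  rw [intervalIntegral.integral_eq_sub_of_hasDerivAt (f := F)]
  · simp [F]
    ring
  · intro s _
    have h := (((((hasDerivAt_id s).const_mul (c 0 + c 2 / 2 + c 5 / 3 + c 9 / 4)).add
      (((hasDerivAt_pow 2 s).div_const 2).const_mul
        (c 1 - c 0 + c 4 / 2 - c 2 + c 8 / 3 - c 5 - c 9))).add
      (((hasDerivAt_pow 3 s).div_const 3).const_mul
        (c 3 - c 1 + c 2 / 2 - c 4 + c 7 / 2 + c 5 - c 8 + 3 / 2 * c 9))).add
      (((hasDerivAt_pow 4 s).div_const 4).const_mul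
        (c 6 - c 3 + c 4 / 2 - c 7 - c 5 / 3 + c 8 - c 9))).add
      (((hasDerivAt_pow 5 s).div_const 5).const_mul (-c 6 + c 7 / 2 - c 8 / 3 + c 9 / 4))
    refine h.congr_deriv ?_
    norm_num
    ring
  · exact Continuous.intervalIntegrable (by fun_prop) _ _

theorem integral_paramDomain_one : ∫ _ in paramDomain, (1 : ℝ) = 1 / 2 := by
  have := integral_cubic ![1, 0, 0, 0, 0, 0, 0, 0, 0, 0]
  simpa using this

theorem vol_eq {T : Tri} (h : AffineIndependent ℝ T) :
    vol T = |signedArea (T 0) (T 1) (T 2)| / 2 := by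
  have := setIntegral_hull_eq h (fun _ => 1)
  rw [integral_paramDomain_one, setIntegral_const, smul_eq_mul, mul_one] at this
  rw [vol, this]
  ring

theorem vol_pos {T : Tri} (h : AffineIndependent ℝ T) : 0 < vol T := by
  rw [vol_eq h]
  exact half_pos (abs_pos.2 (signedArea_ne_zero h))

/-- The Jacobian is twice the area and `nInner` carries the factor 2. Only the area of the triangle
survives; hence bounds that do not depend on its shape. -/
theorem setIntegral_hull {T : Tri} (h : AffineIndependent ℝ T) (f g : Plane → ℝ) :
    ∫ x in hull T, f x * g x = vol T * nInner (f ∘ point T) (g ∘ point T) := by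
  rw [setIntegral_hull_eq h, vol_eq h, nInner]
  simp only [Function.comp_apply]
  ring

theorem refVol_eq : refVol = Real.sqrt 3 / 2 := by
  have := setIntegral_refTriangle (fun _ => 1)
  rw [integral_paramDomain_one, setIntegral_const, smul_eq_mul, mul_one] at this
  rw [refVol, this]
  ring

theorem refInner_eq (f g : Bary → ℝ) : refInner f g = refVol * nInner f g := by
  rw [refInner, setIntegral_refTriangle, refVol_eq, nInner]
  ring

theorem nInner_congr {f f' g g' : Bary → ℝ} (hf : EqOn f f' refTriangle)
    (hg : EqOn g g' refTriangle) : nInner f g = nInner f' g' := by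
  rw [nInner, nInner]
  congr 1
  refine setIntegral_congr_fun isClosed_paramDomain.measurableSet fun p hp => ?_
  simp only [hf (param_mem.2 hp), hg (param_mem.2 hp)]

theorem nInner_comm (f g : Bary → ℝ) : nInner f g = nInner g f := by
  simp only [nInner, mul_comm]

theorem continuousOn_comp_param {f : Bary → ℝ} (hf : ContinuousOn f refTriangle) :
    ContinuousOn (fun p => f (param p)) paramDomain :=
  hf.comp continuous_param.continuousOn fun _ => param_mem.2

theorem nInner_sum_left {ι : Type*} (s : Finset ι) (f : ι → Bary → ℝ) (g : Bary → ℝ) (a : ι → ℝ)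
    (hf : ∀ i ∈ s, ContinuousOn (f i) refTriangle) (hg : ContinuousOn g refTriangle) :
    nInner (fun l => ∑ i ∈ s, a i * f i l) g = ∑ i ∈ s, a i * nInner (f i) g := by
  simp only [nInner, Finset.sum_mul]
  rw [integral_finsetSum]
  · rw [Finset.mul_sum]
    refine Finset.sum_congr rfl fun i _ => ?_
    simp only [mul_assoc]
    rw [integral_const_mul]
    ring
  · intro i hi
    exact integrableOn_paramDomain ((continuousOn_const.mul
      (continuousOn_comp_param (hf i hi))).mul (continuousOn_comp_param hg))

theorem nInner_sum_right {ι : Type*} (s : Finset ι) (f : ι → Bary → ℝ) (g : Bary → ℝ) (a : ι → ℝ)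
    (hf : ∀ i ∈ s, ContinuousOn (f i) refTriangle) (hg : ContinuousOn g refTriangle) :
    nInner g (fun l => ∑ i ∈ s, a i * f i l) = ∑ i ∈ s, a i * nInner g (f i) := by
  rw [nInner_comm, nInner_sum_left s f g a hf hg]
  simp only [nInner_comm g]

/-! ### Positive definiteness and Gram bounds. -/

/-- Allows a continuous function that vanishes almost everywhere on the closed triangle to be zero
at its boundary points too. -/
theorem subset_closure_interior_paramDomain : paramDomain ⊆ closure (interior paramDomain) := by
  have hconv : Convex ℝ paramDomain := by
    rintro ⟨a, b⟩ ⟨h1, h2, h3⟩ ⟨c, d⟩ ⟨h4, h5, h6⟩ u v hu hv huv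
    simp only [paramDomain, mem_ofPred_eq, Prod.smul_mk, Prod.mk_add_mk, smul_eq_mul] at *
    refine ⟨by positivity, by positivity, ?_⟩
    nlinarith
  rw [hconv.closure_interior_eq_closure_of_nonempty_interior]
  · exact subset_closure
  · refine ⟨(1 / 4, 1 / 4), ?_⟩
    rw [mem_interior]
    refine ⟨{p | 0 < p.1 ∧ 0 < p.2 ∧ p.1 + p.2 < 1}, ?_, ?_, by norm_num⟩
    · rintro p ⟨h1, h2, h3⟩
      exact ⟨h1.le, h2.le, h3.le⟩
    · exact (isOpen_lt continuous_const continuous_fst).inter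
        ((isOpen_lt continuous_const continuous_snd).inter
        (isOpen_lt (continuous_fst.add continuous_snd) continuous_const))

theorem nInner_self_nonneg (f : Bary → ℝ) : 0 ≤ nInner f f :=
  mul_nonneg zero_le_two (integral_nonneg fun _ => mul_self_nonneg _)

theorem eqOn_zero_of_nInner_self {f : Bary → ℝ} (hf : ContinuousOn f refTriangle)
    (h : nInner f f = 0) : EqOn f 0 refTriangle := by
  have hc := continuousOn_comp_param hf
  have h1 : ∫ p in paramDomain, f (param p) * f (param p) = 0 := by
    simpa [nInner] using h
  rw [setIntegral_eq_zero_iff_of_nonneg_ae (Filter.Eventually.of_forall fun _ => mul_self_nonneg _)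
    (integrableOn_paramDomain (hc.mul hc))] at h1
  have h2 : EqOn (fun p => f (param p)) 0 paramDomain := by
    refine Measure.eqOn_of_ae_eq (μ := volume) ?_ hc continuousOn_const
      subset_closure_interior_paramDomain
    filter_upwards [h1] with p hp
    simpa using hp
  intro l hl
  have := h2 (x := (l 1, l 2)) (param_mem.1 (by rwa [param_surj hl.2]))
  simpa [param_surj hl.2] using this

/-- A linearly independent family of continuous functions has positive definite Gram matrix. -/
theorem exists_gram_bounds {ι : Type} [Fintype ι] (f : ι → Bary → ℝ)
    (hf : ∀ i, ContinuousOn (f i) refTriangle)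
    (hli : LinearIndependent ℝ fun i => refTriangle.domRestrict (f i)) :
    ∃ c C : ℝ, 0 < c ∧ ∀ a : ι → ℝ,
      c * ∑ i, a i ^ 2 ≤ nInner (fun l => ∑ i, a i * f i l) (fun l => ∑ i, a i * f i l) ∧
      nInner (fun l => ∑ i, a i * f i l) (fun l => ∑ i, a i * f i l) ≤ C * ∑ i, a i ^ 2 := by
  set Q : (ι → ℝ) → ℝ := fun a =>
    nInner (fun l => ∑ i, a i * f i l) (fun l => ∑ i, a i * f i l) with hQ
  have hsum : ∀ a : ι → ℝ, ContinuousOn (fun l => ∑ i, a i * f i l) refTriangle := fun a =>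
    continuousOn_finsetSum _ fun i _ => continuousOn_const.mul (hf i)
  have hQ' : ∀ a, Q a = ∑ i, a i * ∑ j, a j * nInner (f i) (f j) := by
    intro a
    rw [hQ]
    simp only
    rw [nInner_sum_left _ _ _ _ (fun i _ => hf i) (hsum a)]
    refine Finset.sum_congr rfl fun i _ => ?_
    rw [nInner_sum_right _ _ _ _ (fun i _ => hf i) (hf i)]
  have hQc : Continuous Q := by
    rw [funext hQ']
    fun_prop
  have hpos : ∀ a, a ≠ 0 → 0 < Q a := by
    intro a ha
    refine lt_of_le_of_ne (nInner_self_nonneg _) fun h => ha ?_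
    have h0 := eqOn_zero_of_nInner_self (hsum a) h.symm
    funext i
    refine Fintype.linearIndependent_iff.1 hli a ?_ i
    funext l
    have := h0 l.2
    simpa using this
  -- The quadratic form is continuous and positive on this compact sphere; its extrema there are the
  -- constants, and homogeneity extends the bounds to all vectors.
  let S : Set (ι → ℝ) := {a | ∑ i, a i ^ 2 = 1}
  have hS : IsCompact S := by
    refine Metric.isCompact_of_isClosed_isBounded (isClosed_eq (by fun_prop) continuous_const) ?_
    refine (Metric.isBounded_iff_subset_closedBall 0).2 ⟨1, fun a ha => ?_⟩
    rw [mem_closedBall_zero_iff, pi_norm_le_iff_of_nonneg zero_le_one]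
    intro i
    have h1 : a i ^ 2 ≤ 1 := by
      rw [← show ∑ i, a i ^ 2 = 1 from ha]
      exact Finset.single_le_sum (f := fun i => a i ^ 2) (fun j _ => sq_nonneg _) (Finset.mem_univ i)
    exact (sq_le_one_iff_abs_le_one _).1 h1
  obtain ⟨c, C, hc, hb⟩ : ∃ c C : ℝ, 0 < c ∧ ∀ a ∈ S, c ≤ Q a ∧ Q a ≤ C := by
    rcases S.eq_empty_or_nonempty with h | h
    -- The sphere is empty only if there are no indices; then any constants do.
    · exact ⟨1, 1, one_pos, by simp [h]⟩
    · obtain ⟨a, ha, hmin⟩ := hS.exists_isMinOn h hQc.continuousOn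
      obtain ⟨b, _, hmax⟩ := hS.exists_isMaxOn h hQc.continuousOn
      refine ⟨Q a, Q b, hpos a ?_, fun x hx => ⟨hmin hx, hmax hx⟩⟩
      rintro rfl
      simp [S] at ha
  refine ⟨c, C, hc, fun a => ?_⟩
  change c * ∑ i, a i ^ 2 ≤ Q a ∧ Q a ≤ C * ∑ i, a i ^ 2
  have hs0 : 0 ≤ ∑ i, a i ^ 2 := Finset.sum_nonneg fun i _ => sq_nonneg _
  rcases hs0.eq_or_lt with h | h
  · have : a = 0 := by
      funext i
      have := (Finset.sum_eq_zero_iff_of_nonneg fun i _ => sq_nonneg (a i)).1 h.symm i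
        (Finset.mem_univ i)
      simpa using this
    subst this
    simp [hQ']
  · set s := ∑ i, a i ^ 2
    have hr := Real.sqrt_pos.2 h
    have hr2 : Real.sqrt s ^ 2 = s := Real.sq_sqrt hs0
    obtain ⟨h1, h2⟩ := hb (fun i => a i / Real.sqrt s) (by
      simp only [S, mem_ofPred_eq, div_pow, ← Finset.sum_div, hr2]
      exact div_self h.ne')
    have hscale : Q (fun i => a i / Real.sqrt s) * s = Q a := by
      simp only [hQ', Finset.mul_sum, Finset.sum_mul]
      refine Finset.sum_congr rfl fun i _ => Finset.sum_congr rfl fun j _ => ?_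
      rw [show a i / Real.sqrt s * (a j / Real.sqrt s * nInner (f i) (f j)) * s =
        a i * (a j * nInner (f i) (f j)) * (s / Real.sqrt s ^ 2) by ring, hr2, div_self h.ne',
        mul_one]
    rw [← hscale]
    exact ⟨mul_le_mul_of_nonneg_right h1 hs0, mul_le_mul_of_nonneg_right h2 hs0⟩

/-! ### Tables -/

/-- Four times the coordinates of the points `refNode`. -/
def nodeN : Fin 15 → Fin 3 → ℕ :=
  ![![4, 0, 0], ![0, 4, 0], ![0, 0, 4], ![0, 2, 2], ![2, 0, 2], ![2, 2, 0],
    ![0, 3, 1], ![0, 1, 3], ![1, 0, 3], ![3, 0, 1], ![3, 1, 0], ![1, 3, 0],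
    ![2, 1, 1], ![1, 2, 1], ![1, 1, 2]]

/-- The inclusion of the first six indices. -/
abbrev low (m : Fin 6) : Fin 15 := Fin.castLE (by norm_num) m

/-- The inclusion of the last nine indices. -/
abbrev high (m : Fin 9) : Fin 15 := Fin.natAdd 6 m

/-- The vertices of the children of the reference triangle. -/
def childVertex : Fin 4 → Fin 3 → Fin 6 := ![![0, 5, 4], ![5, 1, 3], ![4, 3, 2], ![3, 4, 5]]

/-- The vertices and midpoints of edges of the children of the reference triangle. -/
def childNode : Fin 4 → Fin 6 → Fin 15 :=
  ![![0, 5, 4, 12, 9, 10], ![5, 1, 3, 6, 13, 11], ![4, 3, 2, 7, 8, 14], ![3, 4, 5, 12, 13, 14]]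

/-- The first factor of a fine nodal function. -/
def factorA : Fin 15 → Fin 6 := ![0, 1, 2, 3, 4, 5, 1, 2, 2, 0, 0, 1, 4, 3, 3]

/-- The second factor of a fine nodal function. -/
def factorB : Fin 15 → Fin 6 := ![0, 1, 2, 3, 4, 5, 3, 3, 4, 4, 5, 5, 5, 5, 4]

/-- The index of a vertex. -/
abbrev corner (k : Fin 3) : Fin 6 := ⟨k, by lia⟩

/-- The index of the midpoint of the edge opposite to a vertex. -/
abbrev opposite (k : Fin 3) : Fin 6 := ⟨3 + k, by lia⟩

/-- The index of the point `3/4 e_a + 1/4 e_b`. -/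
def edgeNode : Fin 3 → Fin 3 → Fin 15 := ![![0, 10, 9], ![11, 1, 6], ![8, 7, 2]]

/-- The index of the point `1/2 e_a + 1/4 e_b + 1/4 e_c`. -/
def innerNode (k : Fin 3) : Fin 15 := ⟨12 + k, by lia⟩

/-- The action of a permutation of the coordinates on vertices and midpoints. -/
def actSix (π : Fin 3 → Fin 3) : Fin 6 → Fin 6 :=
  ![corner (π 0), corner (π 1), corner (π 2), opposite (π 0), opposite (π 1), opposite (π 2)]

/-- The action of a permutation of the coordinates on the fifteen points. -/
def actAll (π : Fin 3 → Fin 3) : Fin 15 → Fin 15 :=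
  ![low (corner (π 0)), low (corner (π 1)), low (corner (π 2)), low (opposite (π 0)),
    low (opposite (π 1)), low (opposite (π 2)), edgeNode (π 1) (π 2), edgeNode (π 2) (π 1),
    edgeNode (π 2) (π 0), edgeNode (π 0) (π 2), edgeNode (π 0) (π 1), edgeNode (π 1) (π 0),
    innerNode (π 0), innerNode (π 1), innerNode (π 2)]

/-- Turns a statement about all permutations into six statements about explicit functions, which the
kernel can evaluate on the tables. -/
theorem forall_perm {P : (Fin 3 → Fin 3) → Prop}
    (h : ∀ f ∈ [![0, 1, 2], ![0, 2, 1], ![1, 0, 2], ![1, 2, 0], ![2, 0, 1], ![2, 1, 0]], P f)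
    (π : Equiv.Perm (Fin 3)) : P π := by
  refine h _ ?_
  revert π
  decide +kernel

/-- The matrix `coeffMatrix`, times `8100`. -/
def coeffZ : Fin 15 → Fin 15 → ℤ :=
  ![![583200, 0, 0, 0, 0, 0, 0, 0, 0, 0, 0, 0, 0, 0, 0],
     ![0, 583200, 0, 0, 0, 0, 0, 0, 0, 0, 0, 0, 0, 0, 0],
     ![0, 0, 583200, 0, 0, 0, 0, 0, 0, 0, 0, 0, 0, 0, 0],
     ![0, 0, 0, 156000, 0, 0, -3888, -3888, 0, 0, 0, 0, 0, 0, 0],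
     ![0, 0, 0, 0, 156000, 0, 0, 0, -3888, -3888, 0, 0, 0, 0, 0],
     ![0, 0, 0, 0, 0, 156000, 0, 0, 0, 0, -3888, -3888, 0, 0, 0],
     ![0, 48600, 0, 53000, 0, 0, 8100, -648, 0, 0, 0, 0, 0, 0, 0],
     ![0, 0, 48600, 53000, 0, 0, -648, 8100, 0, 0, 0, 0, 0, 0, 0],
     ![0, 0, 48600, 0, 53000, 0, 0, 0, 8100, -648, 0, 0, 0, 0, 0],
     ![48600, 0, 0, 0, 53000, 0, 0, 0, -648, 8100, 0, 0, 0, 0, 0],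
     ![48600, 0, 0, 0, 0, 53000, 0, 0, 0, 0, 8100, -648, 0, 0, 0],
     ![0, 48600, 0, 0, 0, 53000, 0, 0, 0, 0, -648, 8100, 0, 0, 0],
     ![0, 0, 0, 0, 5000, 5000, 0, 0, 324, -2592, -2592, 324, -10125, 8100, 8100],
     ![0, 0, 0, 5000, 0, 5000, -2592, 324, 0, 0, 324, -2592, 8100, -10125, 8100],
     ![0, 0, 0, 5000, 5000, 0, 324, -2592, -2592, 324, 0, 0, 8100, 8100, -10125]]

/-- The matrix `dualMatrix`, times `27`. -/
def dualZ : Fin 6 → Fin 6 → ℤ :=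
  ![![27, 0, 0, 0, 0, 0],
     ![0, 27, 0, 0, 0, 0],
     ![0, 0, 27, 0, 0, 0],
     ![0, -4, -4, 27, 0, 0],
     ![-4, 0, -4, 0, 27, 0],
     ![-4, -4, 0, 0, 0, 27]]

theorem refNode_eq (k : Fin 15) (i : Fin 3) : refNode k i = nodeN k i / 4 := by
  fin_cases k <;> fin_cases i <;> norm_num [refNode, nodeN]

/-- Peels one entry off a row, so that a real matrix literal is compared with its integer version
entry by entry. -/
theorem vecCons_eq_mul {d : ℝ} {n : ℕ} {a : ℝ} {v : Fin n → ℝ} {b : ℤ} {w : Fin n → ℤ}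
    (h : a = d * b) (h' : ∀ j, v j = d * w j) (j : Fin (n + 1)) :
    Matrix.vecCons a v j = d * (Matrix.vecCons b w j : ℤ) := by
  cases j using Fin.cases with
  | zero => exact h
  | succ j => exact h' j

theorem vecCons_vecCons_eq_mul {d : ℝ} {n m : ℕ} {a : Fin m → ℝ} {v : Fin n → Fin m → ℝ}
    {b : Fin m → ℤ} {w : Fin n → Fin m → ℤ} (h : ∀ j, a j = d * b j)
    (h' : ∀ i j, v i j = d * w i j) (i : Fin (n + 1)) :
    ∀ j, Matrix.vecCons a v i j = d * (Matrix.vecCons b w i j : ℤ) := by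
  cases i using Fin.cases with
  | zero => exact h
  | succ i => exact h' i

/-- The denominators 81, 25 and 4 are cleared by 8100; from here on, facts about the matrix are
decidable facts about integers. -/
theorem coeffMatrix_apply : ∀ i j : Fin 15, coeffMatrix i j = (8100 : ℝ)⁻¹ * coeffZ i j := by
  unfold coeffMatrix coeffZ
  simp only [Matrix.of_apply]
  repeat' refine vecCons_vecCons_eq_mul ?_ ?_
  all_goals repeat' refine vecCons_eq_mul ?_ ?_
  all_goals norm_num

theorem dualMatrix_apply : ∀ i j : Fin 6, dualMatrix i j = (27 : ℝ)⁻¹ * dualZ i j := by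
  unfold dualMatrix dualZ
  simp only [Matrix.of_apply]
  repeat' refine vecCons_vecCons_eq_mul ?_ ?_
  all_goals repeat' refine vecCons_eq_mul ?_ ?_
  all_goals norm_num

theorem coeffMatrix_eq_zero_iff {i j : Fin 15} : coeffMatrix i j = 0 ↔ coeffZ i j = 0 := by
  simp [coeffMatrix_apply]

theorem dualMatrix_eq_zero_iff {i j : Fin 6} : dualMatrix i j = 0 ↔ dualZ i j = 0 := by
  simp [dualMatrix_apply]

theorem refNode_eq_zero_iff {k : Fin 15} {i : Fin 3} : refNode k i = 0 ↔ nodeN k i = 0 := by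
  simp [refNode_eq]

theorem refNode_inj {k m : Fin 15} : refNode k = refNode m ↔ k = m := by
  refine ⟨fun h => ?_, fun h => by rw [h]⟩
  have h' : ∀ i, nodeN k i = nodeN m i := fun i => by
    have := congrFun h i
    simp only [refNode_eq] at this
    exact_mod_cast (div_left_inj' (by norm_num)).1 this
  have : ∀ k m : Fin 15, (∀ i, nodeN k i = nodeN m i) → k = m := by decide +kernel
  exact this k m h'

theorem refNode_mem (k : Fin 15) : refNode k ∈ refTriangle := by
  refine ⟨fun i => by rw [refNode_eq]; positivity, ?_⟩
  have : ∀ k : Fin 15, ∑ i, nodeN k i = 4 := by decide +kernel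
  simp only [refNode_eq, ← Finset.sum_div]
  rw [div_eq_one_iff_eq (by norm_num)]
  exact_mod_cast this k

theorem refNode_act (π : Equiv.Perm (Fin 3)) (k : Fin 15) :
    refNode k = refNode (actAll π k) ∘ π := by
  have : ∀ i : Fin 3, nodeN k i = nodeN (actAll π k) (π i) :=
    forall_perm (P := fun π => ∀ (k : Fin 15) (i : Fin 3), nodeN k i = nodeN (actAll π k) (π i))
      (by decide +kernel) π k
  funext i
  simp only [Function.comp_apply, refNode_eq, this i]

/-- The vertices and the midpoints of the edges of the reference triangle. -/
def nodeSix : Fin 6 → Bary :=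
  ![![1, 0, 0], ![0, 1, 0], ![0, 0, 1], ![0, 1 / 2, 1 / 2], ![1 / 2, 0, 1 / 2], ![1 / 2, 1 / 2, 0]]

theorem refNode_low : ∀ m, refNode (low m) = nodeSix m
  | 0 | 1 | 2 | 3 | 4 | 5 => rfl

theorem refNode_corner (k : Fin 3) : refNode (low (corner k)) = Pi.single k 1 := by
  rw [refNode_low]
  funext i
  revert k
  refine fun | 0 => ?_ | 1 => ?_ | 2 => ?_ <;> fin_cases i <;> simp [nodeSix, corner]

theorem hat_corner (l : Bary) : ∀ k, hat (corner k) l = max 0 (2 * l k - 1)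
  | 0 | 1 | 2 => rfl

theorem hat_opposite (l : Bary) : ∀ k, hat (opposite k) l =
    max 0 (min (min (2 * l (k + 1)) (2 * l (k + 2))) (1 - 2 * l k))
  | 0 => rfl
  | 1 => by rw [min_comm (2 * l (1 + 1))]; rfl
  | 2 => rfl

theorem quadNodal_corner (l : Bary) : ∀ k, quadNodal (corner k) l = l k * (2 * l k - 1)
  | 0 | 1 | 2 => rfl

theorem quadNodal_opposite (l : Bary) : ∀ k, quadNodal (opposite k) l = 4 * (l (k + 1) * l (k + 2))
  | 0 => rfl
  | 1 => by rw [mul_comm (l (1 + 1))]; rfl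
  | 2 => rfl

/-- A permutation of three points keeps or reverses the cyclic order. The functions at an edge
midpoint are symmetric in the two coordinates of that edge, so either case serves for their
equivariance. -/
theorem perm_succ (π : Equiv.Perm (Fin 3)) (k : Fin 3) :
    π (k + 1) = π k + 1 ∧ π (k + 2) = π k + 2 ∨ π (k + 1) = π k + 2 ∧ π (k + 2) = π k + 1 := by
  revert k
  exact forall_perm (P := fun π => ∀ k, π (k + 1) = π k + 1 ∧ π (k + 2) = π k + 2 ∨
    π (k + 1) = π k + 2 ∧ π (k + 2) = π k + 1) (by decide +kernel) π

theorem eq_corner_or_opposite (m : Fin 6) : ∃ k, m = corner k ∨ m = opposite k := by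
  revert m
  decide +kernel

theorem actSix_corner (π : Equiv.Perm (Fin 3)) : ∀ k, actSix π (corner k) = corner (π k)
  | 0 | 1 | 2 => rfl

theorem actSix_opposite (π : Equiv.Perm (Fin 3)) : ∀ k, actSix π (opposite k) = opposite (π k)
  | 0 | 1 | 2 => rfl

theorem actAll_low (π : Equiv.Perm (Fin 3)) (k : Fin 6) : actAll π (low k) = low (actSix π k) := by
  revert k
  exact forall_perm (P := fun π => ∀ k, actAll π (low k) = low (actSix π k)) (by decide +kernel) π

theorem hat_act (π : Equiv.Perm (Fin 3)) (m : Fin 6) (l : Bary) :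
    hat m (l ∘ π) = hat (actSix π m) l := by
  obtain ⟨k, rfl | rfl⟩ := eq_corner_or_opposite m
  · rw [actSix_corner, hat_corner, hat_corner]
    rfl
  · rw [actSix_opposite, hat_opposite, hat_opposite]
    simp only [Function.comp_apply]
    rcases perm_succ π k with ⟨h1, h2⟩ | ⟨h1, h2⟩ <;> rw [h1, h2]
    rw [min_comm (2 * l (π k + 2))]

theorem quadNodal_act (π : Equiv.Perm (Fin 3)) (m : Fin 6) (l : Bary) :
    quadNodal m (l ∘ π) = quadNodal (actSix π m) l := by
  obtain ⟨k, rfl | rfl⟩ := eq_corner_or_opposite m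
  · rw [actSix_corner, quadNodal_corner, quadNodal_corner]
    rfl
  · rw [actSix_opposite, quadNodal_opposite, quadNodal_opposite]
    simp only [Function.comp_apply]
    rcases perm_succ π k with ⟨h1, h2⟩ | ⟨h1, h2⟩ <;> rw [h1, h2]
    rw [mul_comm (l (π k + 2))]

theorem fineNodal_eq (k : Fin 15) (l : Bary) : fineNodal k l =
    if k.val < 6 then hat (factorA k) l * (2 * hat (factorA k) l - 1)
    else 4 * (hat (factorA k) l * hat (factorB k) l) := by
  fin_cases k <;> simp [fineNodal, factorA, factorB]

theorem fineNodal_act (π : Equiv.Perm (Fin 3)) (k : Fin 15) (l : Bary) :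
    fineNodal k (l ∘ π) = fineNodal (actAll π k) l := by
  have h : ∀ k : Fin 15, ((actAll π k).val < 6 ↔ k.val < 6) ∧
      (factorA (actAll π k) = actSix π (factorA k) ∧ factorB (actAll π k) = actSix π (factorB k) ∨
      6 ≤ k.val ∧ factorA (actAll π k) = actSix π (factorB k) ∧
        factorB (actAll π k) = actSix π (factorA k)) :=
    forall_perm (P := fun π => ∀ k : Fin 15, ((actAll π k).val < 6 ↔ k.val < 6) ∧
      (factorA (actAll π k) = actSix π (factorA k) ∧ factorB (actAll π k) = actSix π (factorB k) ∨
      6 ≤ k.val ∧ factorA (actAll π k) = actSix π (factorB k) ∧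
        factorB (actAll π k) = actSix π (factorA k))) (by decide +kernel) π
  obtain ⟨h1, h2⟩ := h k
  rw [fineNodal_eq, fineNodal_eq, hat_act, hat_act]
  simp only [h1]
  rcases h2 with ⟨h2, h3⟩ | ⟨h2, h3, h4⟩
  · rw [h2, h3]
  · rw [if_neg (by lia), if_neg (by lia), h3, h4, mul_comm (hat _ l)]

theorem actAll_bijective (π : Equiv.Perm (Fin 3)) : Function.Bijective (actAll π) := by
  rw [← Finite.injective_iff_bijective]
  exact forall_perm (P := fun π => ∀ k m, actAll π k = actAll π m → k = m) (by decide +kernel) π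

theorem actSix_bijective (π : Equiv.Perm (Fin 3)) : Function.Bijective (actSix π) := by
  rw [← Finite.injective_iff_bijective]
  exact forall_perm (P := fun π => ∀ k m, actSix π k = actSix π m → k = m) (by decide +kernel) π

theorem coeffZ_act (π : Equiv.Perm (Fin 3)) (k m : Fin 15) :
    coeffZ (actAll π k) (actAll π m) = coeffZ k m := by
  revert k m
  exact forall_perm (P := fun π => ∀ k m, coeffZ (actAll π k) (actAll π m) = coeffZ k m)
    (by decide +kernel) π

theorem dualZ_act (π : Equiv.Perm (Fin 3)) (k m : Fin 6) :
    dualZ (actSix π k) (actSix π m) = dualZ k m := by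
  revert k m
  exact forall_perm (P := fun π => ∀ k m, dualZ (actSix π k) (actSix π m) = dualZ k m)
    (by decide +kernel) π

/-! ### The children of the reference triangle -/

/-- The affine parametrization of a child of the reference triangle. -/
def sub (c : Fin 4) (μ : Bary) : Bary := fun k => ∑ r, μ r * refNode (low (childVertex c r)) k

/-- The barycentric coordinates with respect to a child of the reference triangle. -/
def subInv : Fin 4 → Bary → Bary :=
  ![fun l => ![2 * l 0 - 1, 2 * l 1, 2 * l 2], fun l => ![2 * l 0, 2 * l 1 - 1, 2 * l 2],
    fun l => ![2 * l 0, 2 * l 1, 2 * l 2 - 1], fun l => ![1 - 2 * l 0, 1 - 2 * l 1, 1 - 2 * l 2]]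

theorem sub_sum (c : Fin 4) {μ : Bary} (h : ∑ i, μ i = 1) : ∑ i, sub c μ i = 1 := by
  simp only [sub]
  rw [Finset.sum_comm]
  simp only [← Finset.mul_sum, (refNode_mem _).2, mul_one, h]

theorem sub_mem (c : Fin 4) {μ : Bary} (h : μ ∈ refTriangle) : sub c μ ∈ refTriangle :=
  ⟨fun _ => Finset.sum_nonneg fun _ _ => mul_nonneg (h.1 _) ((refNode_mem _).1 _), sub_sum c h.2⟩

theorem sub_subInv (c : Fin 4) {l : Bary} (h : ∑ i, l i = 1) : sub c (subInv c l) = l := by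
  rw [Fin.sum_univ_three] at h
  have h0 : l 0 = 1 - l 1 - l 2 := by linarith
  funext k
  fin_cases c <;> fin_cases k <;>
    simp [sub, subInv, childVertex, refNode_low, nodeSix, Fin.sum_univ_three, h0] <;> ring

theorem subInv_sum (c : Fin 4) {l : Bary} (h : ∑ i, l i = 1) : ∑ i, subInv c l i = 1 := by
  rw [Fin.sum_univ_three] at h
  fin_cases c <;> simp [subInv, Fin.sum_univ_three] <;> linarith

theorem subInv_sub (c : Fin 4) {μ : Bary} (h : ∑ i, μ i = 1) : subInv c (sub c μ) = μ := by
  rw [Fin.sum_univ_three] at h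
  have h0 : μ 0 = 1 - μ 1 - μ 2 := by linarith
  funext k
  fin_cases c <;> fin_cases k <;>
    simp [sub, subInv, childVertex, refNode_low, nodeSix, Fin.sum_univ_three, h0] <;> ring

theorem mem_refSub {c : Fin 4} {l : Bary} (hl : l ∈ refTriangle) :
    l ∈ refSub c ↔ subInv c l ∈ refTriangle := by
  rw [mem_refTriangle]
  have h0 := hl.1 0
  have h1 := hl.1 1
  have h2 := hl.1 2
  simp only [subInv_sum c hl.2, and_true]
  fin_cases c <;> simp [refSub, subInv, Fin.forall_fin_succ, hl, h0, h1, h2] <;>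
    constructor <;> intros <;> grind

theorem refSub_subset (c : Fin 4) : refSub c ⊆ refTriangle := by
  fin_cases c <;> exact fun l hl => hl.1

theorem refSub_eq (c : Fin 4) : refSub c = sub c '' refTriangle := by
  ext l
  constructor
  · intro h
    have hl := refSub_subset c h
    exact ⟨subInv c l, (mem_refSub hl).1 h, sub_subInv c hl.2⟩
  · rintro ⟨μ, hμ, rfl⟩
    rw [mem_refSub (sub_mem c hμ), subInv_sub c hμ.2]
    exact hμ

theorem exists_sub {l : Bary} (hl : l ∈ refTriangle) : ∃ c, ∃ μ ∈ refTriangle, sub c μ = l := by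
  have : ∃ c, l ∈ refSub c := by
    by_cases h0 : 1 / 2 ≤ l 0
    · exact ⟨0, hl, h0⟩
    by_cases h1 : 1 / 2 ≤ l 1
    · exact ⟨1, hl, h1⟩
    by_cases h2 : 1 / 2 ≤ l 2
    · exact ⟨2, hl, h2⟩
    refine ⟨3, hl, fun i => ?_⟩
    push Not at h0 h1 h2
    fin_cases i
    exacts [h0.le, h1.le, h2.le]
  obtain ⟨c, hc⟩ := this
  rw [refSub_eq] at hc
  exact ⟨c, hc⟩

theorem two_mul_sub {μ : Bary} (h : ∑ i, μ i = 1) : ∀ (c : Fin 4) (i : Fin 3),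
    2 * sub c μ i = if c = 3 then 1 - μ i else if c.val = i.val then μ i + 1 else μ i := by
  intro c i
  rw [Fin.sum_univ_three] at h
  have h0 : μ 0 = 1 - μ 1 - μ 2 := by linarith
  simp only [sub, refNode_low]
  fin_cases c <;> fin_cases i <;> simp [childVertex, nodeSix, Fin.sum_univ_three, h0] <;> ring

theorem hat_sub (c : Fin 4) (m : Fin 6) {μ : Bary} (h : μ ∈ refTriangle) :
    hat m (sub c μ) = ∑ r, if childVertex c r = m then μ r else 0 := by
  have h0 := h.1 0
  have h1 := h.1 1
  have h2 := h.1 2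
  have h3 := h.2
  have e := two_mul_sub h3
  rw [Fin.sum_univ_three] at h3 ⊢
  obtain ⟨k, rfl | rfl⟩ := eq_corner_or_opposite m
  · rw [hat_corner, e]
    revert c k
    refine fun | 0 => ?_ | 1 => ?_ | 2 => ?_ | 3 => ?_ <;>
    refine fun | 0 => ?_ | 1 => ?_ | 2 => ?_ <;>
    simp +decide only [if_true, if_false] <;> grind
  · rw [hat_opposite, e, e, e]
    revert c k
    refine fun | 0 => ?_ | 1 => ?_ | 2 => ?_ | 3 => ?_ <;>
    refine fun | 0 => ?_ | 1 => ?_ | 2 => ?_ <;>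
    simp +decide only [if_true, if_false] <;> grind

/-- On a child the hats restrict to its barycentric coordinates or to zero, so the product formula
for a fine nodal function becomes that of the quadratic nodal function of the child at the same
node, or zero if the child does not have that node. -/
theorem fineNodal_sub (c : Fin 4) (k : Fin 15) {μ : Bary} (h : μ ∈ refTriangle) :
    fineNodal k (sub c μ) = ∑ r, if childNode c r = k then quadNodal r μ else 0 := by
  rw [fineNodal_eq, hat_sub c _ h, hat_sub c _ h]
  fin_cases c <;> fin_cases k <;>
    simp [childVertex, childNode, factorA, factorB, quadNodal, Fin.sum_univ_succ]
  all_goals ring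

theorem sub_refNode (c : Fin 4) (r : Fin 6) : sub c (refNode (low r)) = refNode (childNode c r) := by
  have : ∀ (c : Fin 4) (r : Fin 6) (k : Fin 3),
      ∑ i, nodeN (low r) i * nodeN (low (childVertex c i)) k = 4 * nodeN (childNode c r) k := by
    decide +kernel
  funext k
  have h : ((∑ i, nodeN (low r) i * nodeN (low (childVertex c i)) k : ℕ) : ℝ) =
    (4 * nodeN (childNode c r) k : ℕ) := by rw [this]
  push_cast at h
  simp only [sub, refNode_eq, div_mul_div_comm, ← Finset.sum_div]
  rw [h]
  ring

theorem quadNodal_refNode (r s : Fin 6) : quadNodal r (refNode (low s)) = if r = s then 1 else 0 := by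
  have h : ∀ (s : Fin 6) (k : Fin 3), (nodeN (low s) k * (2 * nodeN (low s) k - 4 : ℤ) =
      if corner k = s then 16 else 0) ∧ (4 * (nodeN (low s) (k + 1) * nodeN (low s) (k + 2)) : ℤ) =
      if opposite k = s then 16 else 0 := by decide +kernel
  obtain ⟨k, rfl | rfl⟩ := eq_corner_or_opposite r
  · have h1 := congrArg (Int.cast : ℤ → ℝ) (h s k).1
    push_cast at h1
    rw [quadNodal_corner, refNode_eq]
    split_ifs at h1 ⊢ <;> linarith
  · have h1 := congrArg (Int.cast : ℤ → ℝ) (h s k).2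
    push_cast at h1
    rw [quadNodal_opposite, refNode_eq, refNode_eq]
    split_ifs at h1 ⊢ <;> linarith

theorem exists_childNode (k : Fin 15) : ∃ c r, childNode c r = k := by
  revert k
  decide +kernel

theorem fineNodal_refNode (k m : Fin 15) : fineNodal k (refNode m) = if k = m then 1 else 0 := by
  obtain ⟨c, r, rfl⟩ := exists_childNode m
  rw [← sub_refNode, fineNodal_sub _ _ (refNode_mem _)]
  simp only [quadNodal_refNode, ← ite_and]
  split_ifs with h
  · rw [Finset.sum_eq_single r]
    · simp [h]
    · intro s _ hs
      simp [hs]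
    · simp
  · refine Finset.sum_eq_zero fun s _ => ?_
    rw [if_neg]
    rintro ⟨h1, rfl⟩
    exact h h1.symm

theorem hat_refNode (k m : Fin 6) : hat k (refNode (low m)) = if k = m then 1 else 0 := by
  obtain ⟨c, r, h⟩ : ∃ c r, childVertex c r = m := by
    revert m
    decide +kernel
  have h' := sub_refNode c (corner r)
  rw [refNode_corner] at h'
  have h2 : ∀ c r, childNode c (corner r) = low (childVertex c r) := by decide +kernel
  have h3 : ∀ c, Function.Injective (childVertex c) := by decide +kernel
  rw [← h, ← h2, ← h', hat_sub _ _ (single_mem_stdSimplex ℝ r)]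
  rw [Finset.sum_eq_single r]
  · simp [eq_comm (a := k)]
  · intro b _ hb
    simp [hb]
  · simp

theorem continuous_hat (m : Fin 6) : Continuous (hat m) := by
  obtain ⟨k, rfl | rfl⟩ := eq_corner_or_opposite m
  · simp only [funext fun l => hat_corner l k]
    fun_prop
  · simp only [funext fun l => hat_opposite l k]
    fun_prop

theorem continuous_fineNodal (k : Fin 15) : Continuous (fineNodal k) := by
  have := continuous_hat
  rw [funext (fineNodal_eq k)]
  split_ifs <;> fun_prop

theorem continuous_quadNodal (m : Fin 6) : Continuous (quadNodal m) := by
  obtain ⟨k, rfl | rfl⟩ := eq_corner_or_opposite m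
  · simp only [funext fun l => quadNodal_corner l k]
    fun_prop
  · simp only [funext fun l => quadNodal_opposite l k]
    fun_prop

theorem hat_eq_zero {l : Bary} {m : Fin 6} {k : Fin 3} (hk : l k = 0)
    (hm : nodeN (low m) k ≠ 0) : hat m l = 0 := by
  have h0 : ∀ m k : Fin 3, nodeN (low (corner m)) k ≠ 0 → k = m := by decide +kernel
  have h1 : ∀ m k : Fin 3, nodeN (low (opposite m)) k ≠ 0 → k = m + 1 ∨ k = m + 2 := by
    decide +kernel
  obtain ⟨m, rfl | rfl⟩ := eq_corner_or_opposite m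
  · rw [hat_corner, ← h0 m k hm, hk]
    norm_num
  · rw [hat_opposite]
    refine max_eq_left ((min_le_left _ _).trans ?_)
    rcases h1 m k hm with rfl | rfl
    · exact (min_le_left _ _).trans (by simp [hk])
    · exact (min_le_right _ _).trans (by simp [hk])

theorem quadNodal_eq_zero {l : Bary} {m : Fin 6} {k : Fin 3} (hk : l k = 0)
    (hm : nodeN (low m) k ≠ 0) : quadNodal m l = 0 := by
  have h0 : ∀ m k : Fin 3, nodeN (low (corner m)) k ≠ 0 → k = m := by decide +kernel
  have h1 : ∀ m k : Fin 3, nodeN (low (opposite m)) k ≠ 0 → k = m + 1 ∨ k = m + 2 := by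
    decide +kernel
  obtain ⟨m, rfl | rfl⟩ := eq_corner_or_opposite m
  · rw [quadNodal_corner, ← h0 m k hm, hk, zero_mul]
  · rw [quadNodal_opposite]
    rcases h1 m k hm with rfl | rfl <;> simp [hk]

theorem fineNodal_eq_zero {l : Bary} {m : Fin 15} {k : Fin 3} (hk : l k = 0)
    (hm : nodeN m k ≠ 0) : fineNodal m l = 0 := by
  have h : ∀ (m : Fin 15) (k : Fin 3), nodeN m k ≠ 0 → nodeN (low (factorA m)) k ≠ 0 ∨
      6 ≤ m.val ∧ nodeN (low (factorB m)) k ≠ 0 := by decide +kernel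
  rw [fineNodal_eq]
  rcases h m k hm with h | ⟨h, h'⟩
  · rw [hat_eq_zero hk h]
    simp
  · rw [if_neg (by lia), hat_eq_zero hk h']
    simp

/-! ### Polynomials of bounded degree -/

/-- `f` is a polynomial of degree at most `k`. -/
def IsPolyLE {σ : Type} (k : ℕ) (f : (σ → ℝ) → ℝ) : Prop :=
  ∃ p : MvPolynomial σ ℝ, p.totalDegree ≤ k ∧ ∀ x, f x = MvPolynomial.eval x p

namespace IsPolyLE

variable {σ : Type} {k m : ℕ} {f g : (σ → ℝ) → ℝ}

theorem const (a : ℝ) : IsPolyLE (σ := σ) k fun _ => a :=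
  ⟨MvPolynomial.C a, by simp, by simp⟩

theorem coord (i : σ) : IsPolyLE 1 fun x : σ → ℝ => x i :=
  ⟨MvPolynomial.X i, by simp, by simp⟩

theorem add (hf : IsPolyLE k f) (hg : IsPolyLE k g) : IsPolyLE k fun x => f x + g x := by
  obtain ⟨p, hp, hp'⟩ := hf
  obtain ⟨q, hq, hq'⟩ := hg
  exact ⟨p + q, (MvPolynomial.totalDegree_add p q).trans (max_le hp hq), by simp [hp', hq']⟩

theorem mul (hf : IsPolyLE k f) (hg : IsPolyLE m g) : IsPolyLE (k + m) fun x => f x * g x := by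
  obtain ⟨p, hp, hp'⟩ := hf
  obtain ⟨q, hq, hq'⟩ := hg
  exact ⟨p * q, (MvPolynomial.totalDegree_mul p q).trans (add_le_add hp hq), by simp [hp', hq']⟩

theorem const_mul (hf : IsPolyLE k f) (a : ℝ) : IsPolyLE k fun x => a * f x := by
  have := (const (σ := σ) (k := 0) a).mul hf
  rwa [zero_add] at this

theorem sum {ι : Type} (s : Finset ι) {F : ι → (σ → ℝ) → ℝ} (h : ∀ i ∈ s, IsPolyLE k (F i)) :
    IsPolyLE k fun x => ∑ i ∈ s, F i x := by
  classical
  induction s using Finset.induction_on with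
  | empty => simpa using const (k := k) 0
  | insert a s ha ih =>
    simp only [Finset.sum_insert ha]
    exact (h a (by simp)).add (ih fun i hi => h i (Finset.mem_insert_of_mem hi))

theorem quadNodal_comp {F : (σ → ℝ) → Bary} (h : ∀ i, IsPolyLE 1 fun x => F x i) (r : Fin 6) :
    IsPolyLE 2 fun x => quadNodal r (F x) := by
  obtain ⟨k, rfl | rfl⟩ := eq_corner_or_opposite r
  · simp only [quadNodal_corner, sub_eq_add_neg]
    exact (h k).mul (((h k).const_mul 2).add (const _))
  · simp only [quadNodal_opposite]
    exact ((h _).mul (h _)).const_mul 4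

end IsPolyLE

/-- An exponent vector of degree at most 2 is a multiset of at most two variables. The degree bound
kept in the last case is what rules that case out for linear polynomials. -/
theorem monomial_cases {σ : Type} (s : σ →₀ ℕ) (hs : (s.sum fun _ e => e) ≤ 2) :
    (∀ x : σ → ℝ, ∏ i ∈ s.support, x i ^ s i = 1) ∨
    (∃ a, ∀ x : σ → ℝ, ∏ i ∈ s.support, x i ^ s i = x a) ∨
    (2 ≤ s.sum fun _ e => e) ∧ ∃ a b, ∀ x : σ → ℝ, ∏ i ∈ s.support, x i ^ s i = x a * x b := by
  have h : ∀ x : σ → ℝ, ∏ i ∈ s.support, x i ^ s i = (s.toMultiset.map x).prod := by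
    intro x
    rw [Finsupp.toMultiset_map, Finsupp.prod_toMultiset, Finsupp.prod_mapDomain_index]
    · rfl
    · simp
    · intros
      rw [pow_add]
  have hc := Finsupp.card_toMultiset s
  simp only [h]
  have h3 : s.toMultiset.card = 0 ∨ s.toMultiset.card = 1 ∨ s.toMultiset.card = 2 := by
    change _ = s.sum fun _ e => e at hc
    lia
  rcases h3 with h3 | h3 | h3
  · rw [Multiset.card_eq_zero] at h3
    simp [h3]
  · obtain ⟨a, ha⟩ := Multiset.card_eq_one.1 h3
    exact Or.inr (Or.inl ⟨a, by simp [ha]⟩)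
  · obtain ⟨a, b, ha⟩ := Multiset.card_eq_two.1 h3
    refine Or.inr (Or.inr ⟨?_, a, b, by simp [ha]⟩)
    rw [h3] at hc
    exact hc.le

/-- Both sides are linear in `p`, so it suffices to check the monomials 1, x_a and x_a x_b, composed
with the affine map given by `v`. -/
theorem quad_interpolation {σ : Type} {p : MvPolynomial σ ℝ} (hp : p.totalDegree ≤ 2)
    (v : Fin 3 → σ → ℝ) {l : Bary} (hl : ∑ i, l i = 1) :
    MvPolynomial.eval (fun s => ∑ i, l i * v i s) p =
      ∑ r, quadNodal r l * MvPolynomial.eval (fun s => ∑ i, refNode (low r) i * v i s) p := by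
  simp only [MvPolynomial.eval_eq, Finset.mul_sum]
  rw [Finset.sum_comm]
  refine Finset.sum_congr rfl fun d hd => ?_
  simp only [mul_left_comm _ (p.coeff d), ← Finset.mul_sum]
  congr 1
  rw [Fin.sum_univ_three] at hl
  have h0 : l 0 = 1 - l 1 - l 2 := by linarith
  simp only [refNode_low]
  rcases monomial_cases d ((MvPolynomial.le_totalDegree hd).trans hp) with
    h | ⟨a, h⟩ | ⟨-, a, b, h⟩ <;> simp only [h] <;>
    simp [Fin.sum_univ_succ, quadNodal, nodeSix, h0] <;> ring

theorem linear_interpolation {σ : Type} {p : MvPolynomial σ ℝ} (hp : p.totalDegree ≤ 1)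
    (v : Fin 3 → σ → ℝ) {l : Bary} (hl : ∑ i, l i = 1) :
    MvPolynomial.eval (fun s => ∑ i, l i * v i s) p = ∑ r, l r * MvPolynomial.eval (v r) p := by
  simp only [MvPolynomial.eval_eq, Finset.mul_sum]
  rw [Finset.sum_comm]
  refine Finset.sum_congr rfl fun d hd => ?_
  simp only [mul_left_comm _ (p.coeff d), ← Finset.mul_sum]
  congr 1
  have hd' := (MvPolynomial.le_totalDegree hd).trans hp
  rcases monomial_cases d (hd'.trans one_le_two) with h | ⟨a, h⟩ | ⟨h', -⟩
  · simp [h, hl]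
  · simp [h]
  · exact absurd (h'.trans hd') (by norm_num)

/-- Evaluation at the points embeds `W` in ℝ^X, so the dimension of `W` is at most the number of
points; this equals the number of independent functions. Serves both on the reference triangle and
on the polygon. -/
theorem span_eq_of_unisolvent {α ι X : Type*} [Fintype ι] [Fintype X] (W : Submodule ℝ (α → ℝ))
    (f : ι → α → ℝ) (hf : ∀ i, f i ∈ W) (hli : LinearIndependent ℝ f) (p : X → α)
    (huni : ∀ g ∈ W, (∀ x, g (p x) = 0) → g = 0) (hcard : Fintype.card X = Fintype.card ι) :
    Submodule.span ℝ (range f) = W := by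
  let E : W →ₗ[ℝ] X → ℝ := (LinearMap.funLeft ℝ ℝ p).comp W.subtype
  have hE : Function.Injective E := by
    rw [← LinearMap.ker_eq_bot, LinearMap.ker_eq_bot']
    intro g hg
    exact Subtype.ext (huni g g.2 fun x => congrFun hg x)
  have : FiniteDimensional ℝ W := FiniteDimensional.of_injective E hE
  refine Submodule.eq_of_le_of_finrank_le (Submodule.span_le.2 ?_) ?_
  · rintro _ ⟨i, rfl⟩
    exact hf i
  · rw [finrank_span_eq_card hli, ← hcard, ← Module.finrank_fintype_fun_eq_card ℝ]
    exact LinearMap.finrank_le_finrank_of_injective hE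

/-! ### The local spaces -/

/-- The set `refSpace k` as a linear space. -/
def refSubmodule (k : ℕ) : Submodule ℝ (refTriangle → ℝ) where
  carrier := refSpace k
  zero_mem' := ⟨continuous_const, fun _ => ⟨0, by simp, by simp⟩⟩
  add_mem' := by
    rintro f g ⟨hf, hf'⟩ ⟨hg, hg'⟩
    refine ⟨hf.add hg, fun i => ?_⟩
    obtain ⟨p, hp, hp'⟩ := hf' i
    obtain ⟨q, hq, hq'⟩ := hg' i
    exact ⟨p + q, (MvPolynomial.totalDegree_add p q).trans (max_le hp hq), fun l hl => by
      simp [hp' l hl, hq' l hl]⟩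
  smul_mem' := by
    rintro a f ⟨hf, hf'⟩
    refine ⟨continuous_const.mul hf, fun i => ?_⟩
    obtain ⟨p, hp, hp'⟩ := hf' i
    exact ⟨a • p, (MvPolynomial.totalDegree_smul_le a p).trans hp, fun l hl => by
      simp [hp' l hl, MvPolynomial.smul_eval]⟩

theorem isPolyLE_subInv (c : Fin 4) (i : Fin 3) : IsPolyLE 1 fun l => subInv c l i := by
  have h : ∀ (c : Fin 4) (i : Fin 3) (l : Bary), subInv c l i =
      (if c = 3 then -2 else 2) * l i + if c = 3 then 1 else if c.val = i.val then -1 else 0 := by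
    refine fun | 0 => ?_ | 1 => ?_ | 2 => ?_ | 3 => ?_ <;>
    refine fun | 0 => ?_ | 1 => ?_ | 2 => ?_ <;> intro l <;>
    simp +decide only [if_true, if_false] <;> simp [subInv] <;> ring
  simp only [h]
  exact ((IsPolyLE.coord i).const_mul _).add (IsPolyLE.const _)

theorem fineNodal_mem_refSpace (k : Fin 15) : refTriangle.domRestrict (fineNodal k) ∈ refSubmodule 2 := by
  refine ⟨(continuous_fineNodal k).comp continuous_subtype_val, fun c => ?_⟩
  obtain ⟨p, hp, h⟩ : IsPolyLE 2 fun l =>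
      ∑ r, if childNode c r = k then quadNodal r (subInv c l) else 0 := by
    refine IsPolyLE.sum _ fun r _ => ?_
    split_ifs
    · exact IsPolyLE.quadNodal_comp (isPolyLE_subInv c) r
    · exact IsPolyLE.const 0
  refine ⟨p, hp, fun l hl => ?_⟩
  rw [← h]
  simp only
  rw [← fineNodal_sub c k ((mem_refSub l.2).1 hl), sub_subInv c l.2.2]
  rfl

theorem hat_mem_refSpace (k : Fin 6) : refTriangle.domRestrict (hat k) ∈ refSubmodule 1 := by
  refine ⟨(continuous_hat k).comp continuous_subtype_val, fun c => ?_⟩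
  obtain ⟨p, hp, h⟩ : IsPolyLE 1 fun l =>
      ∑ r, if childVertex c r = k then subInv c l r else 0 := by
    refine IsPolyLE.sum _ fun r _ => ?_
    split_ifs
    · exact isPolyLE_subInv c r
    · exact IsPolyLE.const 0
  refine ⟨p, hp, fun l hl => ?_⟩
  rw [← h]
  simp only
  rw [← hat_sub c k ((mem_refSub l.2).1 hl), sub_subInv c l.2.2]
  rfl

theorem refSpace_two_unisolvent (f : refTriangle → ℝ) (hf : f ∈ refSubmodule 2)
    (h : ∀ k, f ⟨refNode k, refNode_mem k⟩ = 0) : f = 0 := by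
  funext ⟨l, hl⟩
  obtain ⟨c, μ, hμ, rfl⟩ := exists_sub hl
  obtain ⟨p, hp, hp'⟩ := hf.2 c
  have hs : ∀ ν ∈ refTriangle, sub c ν ∈ refSub c := fun ν hν => by
    rw [refSub_eq]
    exact mem_image_of_mem _ hν
  rw [hp' _ (hs μ hμ)]
  change MvPolynomial.eval (sub c μ) p = 0
  unfold sub
  rw [quad_interpolation hp _ hμ.2]
  refine Finset.sum_eq_zero fun r _ => ?_
  change _ * MvPolynomial.eval (sub c (refNode (low r))) p = 0
  have := hp' ⟨sub c (refNode (low r)), sub_mem c (refNode_mem _)⟩ (hs _ (refNode_mem _))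
  simp only at this
  rw [← this]
  simp only [sub_refNode, h, mul_zero]

theorem refSpace_one_unisolvent (f : refTriangle → ℝ) (hf : f ∈ refSubmodule 1)
    (h : ∀ k, f ⟨refNode (low k), refNode_mem (low k)⟩ = 0) : f = 0 := by
  funext ⟨l, hl⟩
  obtain ⟨c, μ, hμ, rfl⟩ := exists_sub hl
  obtain ⟨p, hp, hp'⟩ := hf.2 c
  have hs : ∀ ν ∈ refTriangle, sub c ν ∈ refSub c := fun ν hν => by
    rw [refSub_eq]
    exact mem_image_of_mem _ hν
  rw [hp' _ (hs μ hμ)]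
  change MvPolynomial.eval (sub c μ) p = 0
  unfold sub
  rw [linear_interpolation hp _ hμ.2]
  refine Finset.sum_eq_zero fun r _ => ?_
  have h2 : sub c (refNode (low (corner r))) = refNode (low (childVertex c r)) := by
    have h2 : ∀ c r, childNode c (corner r) = low (childVertex c r) := by decide +kernel
    rw [sub_refNode, h2]
  have := hp' ⟨refNode (low (childVertex c r)), refNode_mem _⟩ (by
    simp only [← h2]
    exact hs _ (refNode_mem _))
  rw [h] at this
  simp only at this
  rw [← this, mul_zero]

/-! ### Local collections -/

/-- Admissibility is read off the coefficient matrix in a nodal basis: its zero pattern gives the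
vanishing, its invariance together with equivariance of the basis gives the symmetry, and
injectivity gives independence through the values at the nodes. -/
theorem isAdmissible_of_table {ι : Type} [Fintype ι] [DecidableEq ι] (S : LocalCollection ι)
    (base : ι → Bary → ℝ) (A : ι → ι → ℝ) (act : (Fin 3 → Fin 3) → ι → ι)
    (hmem : ∀ i, S.node i ∈ refTriangle) (hinj : Function.Injective S.node)
    (hfn : ∀ i, S.fn i = fun l => ∑ k, A k i * base k l)
    (hbase : ∀ k l j, l j = 0 → S.node k j ≠ 0 → base k l = 0)
    (hdelta : ∀ k m, base k (S.node m) = if k = m then 1 else 0)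
    (hvertex : ∀ j, ∃ m, S.node m = Pi.single j 1)
    (hcont : ∀ k, Continuous (base k))
    (hedge : ∀ i k j, S.node i j ≠ 0 → S.node k j = 0 → A k i = 0)
    (hcorner : ∀ i m j, S.node m = Pi.single j 1 → i ≠ m → A m i = 0)
    (hact : ∀ π : Equiv.Perm (Fin 3), Function.Bijective (act π))
    (hact_node : ∀ (π : Equiv.Perm (Fin 3)) k, S.node k = S.node (act π k) ∘ π)
    (hact_base : ∀ (π : Equiv.Perm (Fin 3)) k l, base k (l ∘ π) = base (act π k) l)
    (hact_A : ∀ (π : Equiv.Perm (Fin 3)) k i, A (act π k) (act π i) = A k i)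
    (hA : ∀ v : ι → ℝ, (∀ k, ∑ i, A k i * v i = 0) → v = 0) : S.IsAdmissible where
  node_mem := hmem
  node_injective := hinj
  vanish_edge i j hij l _ hlj := by
    rw [hfn]
    -- Each term vanishes: if node `k` lies on the edge then its coefficient is zero, and otherwise
    -- its basis function is zero along the edge.
    refine Finset.sum_eq_zero fun k _ => ?_
    by_cases hk : S.node k j = 0
    · rw [hedge i k j hij hk, zero_mul]
    · rw [hbase k l j hlj hk, mul_zero]
  vanish_vertex i j hij := by
    obtain ⟨m, hm⟩ := hvertex j
    rw [hfn, ← hm]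
    simp only [hdelta, mul_ite, mul_one, mul_zero, Finset.sum_ite_eq', Finset.mem_univ, if_true]
    refine hcorner i m j hm ?_
    rintro rfl
    exact hij hm
  symmetric π i := by
    obtain ⟨i', rfl⟩ := (hact π).2 i
    refine ⟨i', hact_node π i', fun l _ => ?_⟩
    simp only [hfn, hact_base]
    refine (Fintype.sum_bijective _ (hact π) _ _ fun k => ?_).symm
    rw [hact_A]
  continuous i := by
    rw [hfn]
    have := hcont
    fun_prop
  independent := by
    rw [Fintype.linearIndependent_iff]
    intro v hv
    refine congrFun (hA v fun m => ?_)
    have := congrFun hv ⟨S.node m, hmem m⟩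
    simpa [hfn, hdelta, mul_comm] using this

/-- An integer certificate B A = d · Id proves injectivity of A, and so also the non-vanishing of a
determinant, without computing the determinant. -/
theorem eq_zero_of_inverse {ι : Type} [Fintype ι] [DecidableEq ι] (A B : ι → ι → ℤ) (d : ℤ)
    (hd : d ≠ 0) (h : ∀ i j, ∑ k, B i k * A k j = if i = j then d else 0) (v : ι → ℝ)
    (hv : ∀ k, ∑ j, (A k j : ℝ) * v j = 0) : v = 0 := by
  funext i
  have h1 : ∑ k, (B i k : ℝ) * ∑ j, (A k j : ℝ) * v j = d * v i := by
    simp only [Finset.mul_sum]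
    rw [Finset.sum_comm]
    have : ∀ j, ∑ k, (B i k : ℝ) * ((A k j : ℝ) * v j) = (if i = j then d else 0 : ℤ) * v j := by
      intro j
      rw [← h i j]
      push_cast
      simp only [Finset.sum_mul, mul_assoc]
    simp [this]
  simp only [hv, mul_zero, Finset.sum_const_zero] at h1
  simpa [hd] using h1.symm

/-- The matrix `coeffZ⁻¹`, times `393660000`. -/
def coeffInv : Fin 15 → Fin 15 → ℤ :=
  ![![675, 0, 0, 0, 0, 0, 0, 0, 0, 0, 0, 0, 0, 0, 0],
     ![0, 675, 0, 0, 0, 0, 0, 0, 0, 0, 0, 0, 0, 0, 0],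
     ![0, 0, 675, 0, 0, 0, 0, 0, 0, 0, 0, 0, 0, 0, 0],
     ![0, -81, -81, 1863, 0, 0, 972, 972, 0, 0, 0, 0, 0, 0, 0],
     ![-81, 0, -81, 0, 1863, 0, 0, 0, 972, 972, 0, 0, 0, 0, 0],
     ![-81, -81, 0, 0, 0, 1863, 0, 0, 0, 0, 972, 972, 0, 0, 0],
     ![0, -3500, 250, -13250, 0, 0, 42000, -3000, 0, 0, 0, 0, 0, 0, 0],
     ![0, 250, -3500, -13250, 0, 0, -3000, 42000, 0, 0, 0, 0, 0, 0, 0],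
     ![250, 0, -3500, 0, -13250, 0, 0, 0, 42000, -3000, 0, 0, 0, 0, 0],
     ![-3500, 0, 250, 0, -13250, 0, 0, 0, -3000, 42000, 0, 0, 0, 0, 0],
     ![-3500, 250, 0, 0, 0, -13250, 0, 0, 0, 0, 42000, -3000, 0, 0, 0],
     ![250, -3500, 0, 0, 0, -13250, 0, 0, 0, 0, -3000, 42000, 0, 0, 0],
     ![0, -1080, -1080, -5760, -3600, -3600, 5760, 5760, 7200, 0, 0, 7200, 7200, 28800, 28800],
     ![-1080, 0, -1080, -3600, -5760, -3600, 0, 7200, 5760, 5760, 7200, 0, 28800, 7200, 28800],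
     ![-1080, -1080, 0, -3600, -3600, -5760, 7200, 0, 0, 7200, 5760, 5760, 28800, 28800, 7200]]

theorem coeffZ_injective (v : Fin 15 → ℝ) (hv : ∀ k, ∑ j, (coeffZ k j : ℝ) * v j = 0) : v = 0 :=
  eq_zero_of_inverse coeffZ coeffInv 393660000 (by norm_num) (by decide +kernel) v hv

theorem dualZ_injective (v : Fin 6 → ℝ) (hv : ∀ k, ∑ j, (dualZ k j : ℝ) * v j = 0) : v = 0 :=
  eq_zero_of_inverse dualZ ![![27, 0, 0, 0, 0, 0], ![0, 27, 0, 0, 0, 0], ![0, 0, 27, 0, 0, 0],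
    ![0, 4, 4, 27, 0, 0], ![4, 0, 4, 0, 27, 0], ![4, 4, 0, 0, 0, 27]] 729 (by norm_num)
    (by decide +kernel) v hv

theorem coeffMatrix_det_ne_zero : coeffMatrix.det ≠ 0 := by
  intro h
  obtain ⟨v, hv, h0⟩ := Matrix.exists_mulVec_eq_zero_iff.2 h
  refine hv (coeffZ_injective v fun k => ?_)
  have := congrFun h0 k
  simp only [Matrix.mulVec, dotProduct, coeffMatrix_apply, mul_assoc, ← Finset.mul_sum] at this
  simpa using this

/-- The collection `Θ ∪ Ξ`. -/
def locAll : LocalCollection (Fin 15) where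
  node := refNode
  fn i l := ∑ k, coeffMatrix k i * fineNodal k l

theorem low_injective : Function.Injective low := Fin.castLE_injective _

theorem refNode_single (j : Fin 3) : ∃ m, refNode (low m) = Pi.single j 1 :=
  ⟨_, refNode_corner j⟩

theorem locAll_isAdmissible : locAll.IsAdmissible := by
  refine isAdmissible_of_table locAll fineNodal coeffMatrix actAll refNode_mem
    (fun _ _ => refNode_inj.1) (fun _ => rfl)
    (fun k l j hl hk => fineNodal_eq_zero hl fun h => hk (refNode_eq_zero_iff.2 h))
    fineNodal_refNode (fun j => ⟨low (corner j), refNode_corner j⟩) continuous_fineNodal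
    ?_ ?_ actAll_bijective refNode_act fineNodal_act ?_ ?_
  · have : ∀ (i k : Fin 15) (j : Fin 3), nodeN i j ≠ 0 → nodeN k j = 0 → coeffZ k i = 0 := by
      decide +kernel
    intro i k j h1 h2
    exact coeffMatrix_eq_zero_iff.2 (this i k j (fun h => h1 (refNode_eq_zero_iff.2 h))
      (refNode_eq_zero_iff.1 h2))
  · have : ∀ (i : Fin 15) (j : Fin 3), i ≠ low (corner j) → coeffZ (low (corner j)) i = 0 := by
      decide +kernel
    intro i m j h1 h2
    rw [← refNode_corner] at h1
    obtain rfl := refNode_inj.1 h1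
    exact coeffMatrix_eq_zero_iff.2 (this i j h2)
  · intro π k i
    rw [coeffMatrix_apply, coeffMatrix_apply, coeffZ_act]
  · intro v hv
    refine coeffZ_injective v fun k => ?_
    simpa [coeffMatrix_apply, mul_assoc, ← Finset.mul_sum] using hv k

theorem locPhi_isAdmissible : locPhi.IsAdmissible := by
  refine isAdmissible_of_table locPhi hat dualMatrix actSix (fun i => refNode_mem (low i))
    (fun _ _ h => low_injective (refNode_inj.1 h)) (fun _ => rfl)
    (fun k l j hl hk => hat_eq_zero hl fun h => hk (refNode_eq_zero_iff.2 h))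
    hat_refNode refNode_single continuous_hat
    ?_ ?_ actSix_bijective (fun π k => ?_) hat_act ?_ ?_
  · have : ∀ (i k : Fin 6) (j : Fin 3), nodeN (low i) j ≠ 0 → nodeN (low k) j = 0 →
        dualZ k i = 0 := by
      decide +kernel
    intro i k j h1 h2
    exact dualMatrix_eq_zero_iff.2 (this i k j (fun h => h1 (refNode_eq_zero_iff.2 h))
      (refNode_eq_zero_iff.1 h2))
  · have : ∀ (i : Fin 6) (j : Fin 3), i ≠ corner j → dualZ (corner j) i = 0 := by
      decide +kernel
    intro i m j h1 h2
    rw [← refNode_corner] at h1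
    obtain rfl := low_injective (refNode_inj.1 h1)
    exact dualMatrix_eq_zero_iff.2 (this i j h2)
  · change refNode (low k) = refNode (low (actSix π k)) ∘ π
    rw [← actAll_low]
    exact refNode_act π _
  · intro π k i
    rw [dualMatrix_apply, dualMatrix_apply, dualZ_act]
  · intro v hv
    refine dualZ_injective v fun k => ?_
    simpa [dualMatrix_apply, mul_assoc, ← Finset.mul_sum] using hv k

theorem locN_isAdmissible : locN.IsAdmissible := by
  refine isAdmissible_of_table locN quadNodal (fun k i => if k = i then 1 else 0) actSix
    (fun i => refNode_mem (low i))
    (fun _ _ h => low_injective (refNode_inj.1 h)) (fun i => ?_)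
    (fun k l j hl hk => quadNodal_eq_zero hl fun h => hk (refNode_eq_zero_iff.2 h))
    quadNodal_refNode refNode_single continuous_quadNodal
    ?_ ?_ actSix_bijective (fun π k => ?_) quadNodal_act ?_ ?_
  · funext l
    simp [locN]
  · intro i k j h1 h2
    rw [if_neg]
    rintro rfl
    exact h1 h2
  · intro i m j _ h
    rw [if_neg h.symm]
  · change refNode (low k) = refNode (low (actSix π k)) ∘ π
    rw [← actAll_low]
    exact refNode_act π _
  · intro π k i
    simp only [(actSix_bijective π).1.eq_iff]
  · intro v hv
    funext k
    simpa using hv k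

/-- All conditions but one pass to any subcollection; symmetry requires that its labels be closed
under permutations of the coordinates. Θ and Ξ are obtained in this way from their union. -/
theorem LocalCollection.IsAdmissible.comp {ι κ : Type} {S : LocalCollection ι} (hS : S.IsAdmissible)
    {S' : LocalCollection κ} (e : κ → ι) (he : Function.Injective e)
    (hnode : ∀ i, S'.node i = S.node (e i)) (hfn : ∀ i, S'.fn i = S.fn (e i))
    (hsymm : ∀ (π : Equiv.Perm (Fin 3)) i j, S.node j = S.node (e i) ∘ π → j ∈ range e) :
    S'.IsAdmissible where
  node_mem i := hnode i ▸ hS.node_mem _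
  node_injective i j h := he (hS.node_injective (by rw [← hnode, ← hnode, h]))
  vanish_edge i k h l hl hk := hfn i ▸ hS.vanish_edge _ k (hnode i ▸ h) l hl hk
  vanish_vertex i k h := hfn i ▸ hS.vanish_vertex _ k (hnode i ▸ h)
  symmetric π i := by
    obtain ⟨j, h1, h2⟩ := hS.symmetric π (e i)
    obtain ⟨i', rfl⟩ := hsymm π i j h1
    exact ⟨i', by rw [hnode, hnode, h1], fun l hl => by rw [hfn, hfn, h2 l hl]⟩
  continuous i := hfn i ▸ hS.continuous _
  independent := by
    simp only [hfn]
    exact hS.independent.comp e he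

theorem refNode_comp_mem (π : Equiv.Perm (Fin 3)) (i j : Fin 15) (h : refNode j = refNode i ∘ π) :
    i.val < 6 ↔ j.val < 6 := by
  rw [refNode_act π j] at h
  have h1 : actAll π j = i := refNode_inj.1 (π.surjective.injective_comp_right h)
  have : ∀ j : Fin 15, ((actAll π j).val < 6 ↔ j.val < 6) :=
    forall_perm (P := fun π => ∀ j : Fin 15, ((actAll π j).val < 6 ↔ j.val < 6))
      (by decide +kernel) π
  rw [← h1]
  exact this j

theorem locTheta_isAdmissible : locTheta.IsAdmissible := by
  refine locAll_isAdmissible.comp low low_injective (fun _ => rfl) (fun _ => rfl) ?_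
  intro π i j h
  exact ⟨⟨j, (refNode_comp_mem π (low i) j h).1 i.2⟩, rfl⟩

theorem high_injective : Function.Injective high := Fin.natAdd_injective _ _

theorem locXi_isAdmissible : locXi.IsAdmissible := by
  refine locAll_isAdmissible.comp high high_injective (fun _ => rfl) (fun _ => rfl) ?_
  intro π i j h
  have h1 := (refNode_comp_mem π (high i) j h).not.1 (by simp)
  refine ⟨⟨j - 6, by lia⟩, ?_⟩
  ext
  simp
  lia

/-- The indices of `Θ ∪ Ξ`. -/
def sumEquiv : Fin 6 ⊕ Fin 9 ≃ Fin 15 := finSumFinEquiv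

theorem locAll_comp_sumEquiv : Sum.elim locTheta.fn locXi.fn = locAll.fn ∘ sumEquiv := by
  funext i
  rcases i with i | i <;> rfl

theorem locAll_isLocalBasis : IsLocalBasis (Sum.elim locTheta.fn locXi.fn) (refSpace 2) := by
  have hli : LinearIndependent ℝ
      fun i => refTriangle.domRestrict (Sum.elim locTheta.fn locXi.fn i) := by
    rw [locAll_comp_sumEquiv]
    exact locAll_isAdmissible.independent.comp _ sumEquiv.injective
  refine ⟨hli, ?_⟩
  rw [span_eq_of_unisolvent (refSubmodule 2) _ (fun i => ?_) hli
    (fun k : Fin 15 => ⟨refNode k, refNode_mem k⟩) refSpace_two_unisolvent (by simp)]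
  · rfl
  · rw [locAll_comp_sumEquiv]
    have : refTriangle.domRestrict (locAll.fn (sumEquiv i)) =
        ∑ k, coeffMatrix k (sumEquiv i) • refTriangle.domRestrict (fineNodal k) := by
      funext l
      simp [locAll]
    rw [Function.comp_apply, this]
    exact Submodule.sum_mem _ fun k _ => Submodule.smul_mem _ _ (fineNodal_mem_refSpace k)

theorem locPhi_isLocalBasis : IsLocalBasis locPhi.fn (refSpace 1) := by
  refine ⟨locPhi_isAdmissible.independent, ?_⟩
  rw [span_eq_of_unisolvent (refSubmodule 1) _ (fun i => ?_) locPhi_isAdmissible.independent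
    (fun k : Fin 6 => ⟨refNode (low k), refNode_mem _⟩) refSpace_one_unisolvent (by simp)]
  · rfl
  · have : refTriangle.domRestrict (locPhi.fn i) =
        ∑ k, dualMatrix k i • refTriangle.domRestrict (hat k) := by
      funext l
      simp [locPhi]
    rw [this]
    exact Submodule.sum_mem _ fun k _ => Submodule.smul_mem _ _ (hat_mem_refSpace k)

/-! ### Triangles and their children -/

theorem bary_combo {T : Tri} (h : AffineIndependent ℝ T) {a b : ℝ} (hab : a + b = 1)
    (x y : Plane) : bary T (a • x + b • y) = a • bary T x + b • bary T y := by
  refine point_injective h (bary_sum h _) ?_ ?_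
  · simp [Finset.sum_add_distrib, ← Finset.mul_sum, bary_sum h, hab]
  · rw [point_bary h, point_add, point_smul, point_smul, point_bary h, point_bary h]

theorem convex_hull (T : Tri) : Convex ℝ (hull T) := convex_convexHull ℝ _

theorem mem_convexHull_of_weights {T : Tri} (h : AffineIndependent ℝ T) {x : Plane}
    (hx : x ∈ hull T) {s : Set Plane} (hs : ∀ k, bary T x k ≠ 0 → T k ∈ s) :
    x ∈ convexHull ℝ s := by
  have hb := (mem_hull h).1 hx
  rw [← point_bary h x, point, ← Finset.sum_filter_of_ne (p := fun k => bary T x k ≠ 0)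
    fun k _ hk hk' => hk (by rw [hk', zero_smul])]
  refine (convex_convexHull ℝ s).sum_mem (fun k _ => hb.1 k) ?_ fun k hk =>
    subset_convexHull ℝ s (hs k (Finset.mem_filter.1 hk).2)
  rw [Finset.sum_filter_ne_zero]
  exact hb.2

/-- Vertices of weight zero do not influence a point, so the two triangles need to agree only at
vertices of non-zero weight. -/
theorem point_match {S T : Tri} {π : Equiv.Perm (Fin 3)} {l : Bary}
    (h : ∀ k, l (π k) ≠ 0 → S k = T (π k)) : point S (l ∘ π) = point T l := by
  rw [point_comp]
  refine Finset.sum_congr rfl fun k _ => ?_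
  by_cases hk : l k = 0
  · rw [hk, zero_smul, zero_smul]
  · have := h (π.symm k) (by simpa using hk)
    rw [Function.comp_apply, this, Equiv.apply_symm_apply]

theorem child_eq (T : Tri) : ∀ c r, child T c r = point T (refNode (low (childVertex c r))) := by
  have h : ∀ a b : Plane, midpoint ℝ a b = (1 / 2 : ℝ) • a + (1 / 2 : ℝ) • b := fun a b => by
    rw [midpoint_eq_smul_add, smul_add, one_div, invOf_eq_inv]
  simp only [refNode_low]
  refine fun | 0 => ?_ | 1 => ?_ | 2 => ?_ | 3 => ?_ <;>
  refine fun | 0 => ?_ | 1 => ?_ | 2 => ?_ <;>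
  simp [child, childVertex, nodeSix, point, Fin.sum_univ_three, h]

theorem point_child (T : Tri) (c : Fin 4) (μ : Bary) : point (child T c) μ = point T (sub c μ) := by
  simp only [point, child_eq, sub, Finset.smul_sum, Finset.sum_smul, mul_smul]
  rw [Finset.sum_comm]

theorem signedArea_child (T : Tri) : ∀ c, signedArea (child T c 0) (child T c 1) (child T c 2) =
    signedArea (T 0) (T 1) (T 2) / 4 := by
  simp only [child_eq, refNode_low, signedArea, point_apply]
  refine fun | 0 => ?_ | 1 => ?_ | 2 => ?_ | 3 => ?_ <;>
  simp [childVertex, nodeSix, Fin.sum_univ_three] <;> ring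

theorem child_affineIndependent {T : Tri} (h : AffineIndependent ℝ T) (c : Fin 4) :
    AffineIndependent ℝ (child T c) := by
  refine affineIndependent_of_signedArea ?_
  rw [signedArea_child]
  exact div_ne_zero (signedArea_ne_zero h) (by norm_num)

theorem vol_child {T : Tri} (h : AffineIndependent ℝ T) (c : Fin 4) : vol (child T c) = vol T / 4 := by
  rw [vol_eq h, vol_eq (child_affineIndependent h c), signedArea_child, abs_div]
  norm_num
  ring

theorem bary_child {T : Tri} (h : AffineIndependent ℝ T) (c : Fin 4) (x : Plane) :
    bary T x = sub c (bary (child T c) x) := by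
  have hc := child_affineIndependent h c
  conv_lhs => rw [← point_bary hc x, point_child]
  exact bary_point h (sub_sum c (bary_sum hc x))

theorem hull_child_subset (T : Tri) (c : Fin 4) : hull (child T c) ⊆ hull T := by
  rw [hull_eq, hull_eq]
  rintro _ ⟨μ, hμ, rfl⟩
  rw [point_child]
  exact mem_image_of_mem _ (sub_mem c hμ)

theorem exists_mem_hull_child {T : Tri} {x : Plane} (hx : x ∈ hull T) :
    ∃ c, x ∈ hull (child T c) := by
  rw [hull_eq] at hx
  obtain ⟨l, hl, rfl⟩ := hx
  obtain ⟨c, μ, hμ, rfl⟩ := exists_sub hl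
  exact ⟨c, by rw [← point_child]; exact point_mem_hull _ hμ⟩

theorem childVertex_injective (c : Fin 4) : Function.Injective (childVertex c) := by
  revert c
  decide +kernel

theorem hat_bary_child {T : Tri} (h : AffineIndependent ℝ T) {c : Fin 4} {x : Plane}
    (hx : x ∈ hull (child T c)) (m : Fin 6) :
    hat m (bary T x) = ∑ r, if childVertex c r = m then bary (child T c) x r else 0 := by
  rw [bary_child h c x, hat_sub c m ((mem_hull (child_affineIndependent h c)).1 hx)]

/-! ### Conforming triangulations -/

namespace IsConforming

/-- If `S k` were not common, the convex set where the k-th coordinate vanishes would contain all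
common vertices, hence their hull, hence `x`. -/
theorem vertex_mem_range {𝒯 : Finset Tri} (h𝒯 : IsConforming 𝒯) {S T : Tri} (hS : S ∈ 𝒯) (hT : T ∈ 𝒯) {x : Plane} (hxS : x ∈ hull S)
    (hxT : x ∈ hull T) {k : Fin 3} (hk : bary S x k ≠ 0) : S k ∈ range T := by
  by_cases hST : S = T
  · rw [hST]
    exact mem_range_self k
  have hx : x ∈ convexHull ℝ (range S ∩ range T) := h𝒯.inter S hS T hT hST ▸ ⟨hxS, hxT⟩
  have ha := h𝒯.nondegenerate S hS
  by_contra hk'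
  have hconv : Convex ℝ {y | bary S y k = 0} := by
    intro y hy z hz a b _ _ hab
    rw [mem_ofPred_eq] at hy hz ⊢
    rw [bary_combo ha hab]
    simp [hy, hz]
  refine hk (convexHull_min ?_ hconv hx)
  rintro _ ⟨⟨i, rfl⟩, hi⟩
  rw [mem_ofPred_eq, bary_vertex ha, Pi.single_apply, if_neg]
  rintro rfl
  exact hk' hi

/-- The single permutation serves all common points at once. This is the form in which conformity is
used: changing the triangle amounts to permuting the barycentric coordinates. -/
theorem exists_matching {𝒯 : Finset Tri} (h𝒯 : IsConforming 𝒯) {S T : Tri} (hS : S ∈ 𝒯) (hT : T ∈ 𝒯) :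
    ∃ π : Equiv.Perm (Fin 3), (∀ k, S k ∈ range T → S k = T (π k)) ∧
      ∀ x ∈ hull S, x ∈ hull T → bary S x = bary T x ∘ π ∧
        ∀ k, bary S x k ≠ 0 → S k = T (π k) := by
  classical
  have hSa := h𝒯.nondegenerate S hS
  have hTa := h𝒯.nondegenerate T hT
  choose! f hf using fun (k : Fin 3) (hk : S k ∈ range T) => hk
  -- The correspondence of the common vertices is a partial injection of three indices, and extends
  -- to a permutation; the choice outside is immaterial, as common points have no weight there.
  obtain ⟨g, hg⟩ := Set.MapsTo.exists_equiv_extend_of_card_eq (s := {k | S k ∈ range T})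
    (t := (Finset.univ : Finset (Fin 3))) (f := f) (by simp) (fun _ _ => by simp)
    (fun a ha b hb hab => hSa.injective (by rw [← hf a ha, ← hf b hb, hab]))
  let π : Equiv.Perm (Fin 3) := g.trans (Equiv.subtypeUnivEquiv fun _ => Finset.mem_univ _)
  have hπ : ∀ k, S k ∈ range T → S k = T (π k) := fun k hk => by
    rw [← hf k hk, ← hg k hk]
    rfl
  refine ⟨π, hπ, fun x hxS hxT => ?_⟩
  have h2 : ∀ k, bary S x k ≠ 0 → S k = T (π k) := fun k hk =>
    hπ k (h𝒯.vertex_mem_range hS hT hxS hxT hk)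
  refine ⟨?_, h2⟩
  have h3 : point S ((bary S x ∘ π.symm) ∘ π) = point T (bary S x ∘ π.symm) :=
    point_match fun k hk => h2 k (by simpa using hk)
  have h4 : (bary S x ∘ π.symm) ∘ π = bary S x := by
    funext k
    simp
  rw [h4, point_bary hSa] at h3
  conv_rhs => rw [h3]
  rw [bary_point hTa, h4]
  rw [← bary_sum hSa x]
  exact Fintype.sum_equiv π.symm _ _ fun _ => rfl

end IsConforming

theorem mem_red {𝒯 : Finset Tri} {T' : Tri} : T' ∈ red 𝒯 ↔ ∃ T ∈ 𝒯, ∃ c, child T c = T' := by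
  simp [red]

theorem child_mem_red {𝒯 : Finset Tri} {T : Tri} (hT : T ∈ 𝒯) (c : Fin 4) : child T c ∈ red 𝒯 :=
  mem_red.2 ⟨T, hT, c, rfl⟩

theorem IsConforming.red {𝒯 : Finset Tri} (h𝒯 : IsConforming 𝒯) : IsConforming (red 𝒯) where
  nondegenerate T' hT' := by
    obtain ⟨T, hT, c, rfl⟩ := mem_red.1 hT'
    exact child_affineIndependent (h𝒯.nondegenerate T hT) c
  distinct S' hS' T' hT' hne hr := by
    obtain ⟨S, hS, c, rfl⟩ := mem_red.1 hS'
    obtain ⟨T, hT, d, rfl⟩ := mem_red.1 hT'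
    have hSa := h𝒯.nondegenerate S hS
    -- The centroid of a child has only non-zero barycentric coordinates in its parent. If two
    -- children have the same vertices, their parents share this point, hence all their vertices.
    have hμ : (fun _ => 1 / 3 : Bary) ∈ refTriangle := by
      refine ⟨fun _ => by norm_num, by simp⟩
    have hxS : point (child S c) (fun _ => 1 / 3) ∈ hull S :=
      hull_child_subset S c (point_mem_hull _ hμ)
    have hxT : point (child S c) (fun _ => 1 / 3) ∈ hull T := by
      refine hull_child_subset T d ?_
      rw [hull, ← hr]
      exact point_mem_hull _ hμ
    by_cases hST : S = T
    · subst hST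
      have h1 : ∀ r, ∃ s, childVertex d s = childVertex c r := by
        intro r
        obtain ⟨s, hs⟩ : child S c r ∈ range (child S d) := hr ▸ mem_range_self r
        refine ⟨s, low_injective (refNode_inj.1 (point_injective hSa (refNode_mem _).2
          (refNode_mem _).2 ?_))⟩
        rw [← child_eq, ← child_eq, hs]
      have h2 : ∀ c d, (∀ r, ∃ s, childVertex d s = childVertex c r) → c = d := by decide +kernel
      exact hne (by rw [h2 c d h1])
    · refine h𝒯.distinct S hS T hT hST ?_
      obtain ⟨π, -, hπ⟩ := h𝒯.exists_matching hS hT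
      have h1 : ∀ k, S k = T (π k) := by
        intro k
        refine (hπ _ hxS hxT).2 k ?_
        rw [point_child, bary_point hSa (sub_sum c hμ.2)]
        have : ∀ (c : Fin 4) (k : Fin 3), ∑ r, nodeN (low (childVertex c r)) k ≠ 0 := by
          decide +kernel
        simp only [sub, refNode_eq, ← Finset.mul_sum, ← Finset.sum_div]
        have h0 : ((∑ r, nodeN (low (childVertex c r)) k : ℕ) : ℝ) ≠ 0 := by exact_mod_cast this c k
        push_cast at h0
        exact mul_ne_zero (by norm_num) (div_ne_zero h0 (by norm_num))
      rw [show S = T ∘ π from funext h1, EquivLike.range_comp]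
  inter S' hS' T' hT' hne := by
    refine Subset.antisymm ?_ (subset_inter (convexHull_mono inter_subset_left)
      (convexHull_mono inter_subset_right))
    obtain ⟨S, hS, c, rfl⟩ := mem_red.1 hS'
    obtain ⟨T, hT, d, rfl⟩ := mem_red.1 hT'
    have hSa := h𝒯.nondegenerate S hS
    have hTa := h𝒯.nondegenerate T hT
    rintro x ⟨hxS', hxT'⟩
    refine mem_convexHull_of_weights (child_affineIndependent hSa c) hxS' fun r hr =>
      ⟨mem_range_self r, ?_⟩
    obtain ⟨π, -, hπ⟩ := h𝒯.exists_matching hS hT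
    obtain ⟨hb, hv⟩ := hπ x (hull_child_subset S c hxS') (hull_child_subset T d hxT')
    -- The weight of a child vertex at `x` is the value of a hat, and hats are equivariant. So the
    -- weight is seen from `T` as well, and forces the permuted vertex to be a vertex of the child
    -- of `T`. Non-vanishing of the hat also ensures that this vertex is supported on parent
    -- vertices that match.
    have h1 : hat (childVertex c r) (bary S x) ≠ 0 := by
      rw [hat_bary_child hSa hxS', Finset.sum_eq_single r]
      · simpa using hr
      · intro s _ hs
        rw [if_neg fun h => hs (childVertex_injective c h)]
      · simp
    have h2 := h1
    rw [hb, hat_act, hat_bary_child hTa hxT'] at h2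
    obtain ⟨s, -, hs⟩ := Finset.exists_ne_zero_of_sum_ne_zero h2
    have hs' : childVertex d s = actSix π (childVertex c r) := by
      by_contra h
      exact hs (if_neg h)
    refine ⟨s, ?_⟩
    rw [child_eq, child_eq, hs', refNode_act π (low (childVertex c r)), actAll_low]
    refine (point_match fun k hk => hv k fun h => h1 (hat_eq_zero h fun h0 => hk ?_)).symm
    have h3 := congrFun (refNode_act π (low (childVertex c r))) k
    rw [actAll_low, Function.comp_apply] at h3
    rw [← h3]
    exact refNode_eq_zero_iff.2 h0

theorem level_succ (𝒯 : Finset Tri) (j : ℕ) : level 𝒯 (j + 1) = red (level 𝒯 j) :=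
  Function.iterate_succ_apply' _ _ _

theorem IsConforming.level {𝒯 : Finset Tri} (h𝒯 : IsConforming 𝒯) (j : ℕ) :
    IsConforming (level 𝒯 j) := by
  induction j with
  | zero => exact h𝒯
  | succ j ih =>
    rw [level_succ]
    exact ih.red

theorem mem_carrier {𝒯 : Finset Tri} {x : Plane} : x ∈ carrier 𝒯 ↔ ∃ T ∈ 𝒯, x ∈ hull T := by
  simp [carrier]

theorem carrier_red (𝒯 : Finset Tri) : carrier (red 𝒯) = carrier 𝒯 := by
  ext x
  simp only [mem_carrier, mem_red]
  constructor
  · rintro ⟨_, ⟨T, hT, c, rfl⟩, hx⟩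
    exact ⟨T, hT, hull_child_subset T c hx⟩
  · rintro ⟨T, hT, hx⟩
    obtain ⟨c, hc⟩ := exists_mem_hull_child hx
    exact ⟨_, ⟨T, hT, c, rfl⟩, hc⟩

theorem carrier_level (𝒯 : Finset Tri) (j : ℕ) : carrier (level 𝒯 j) = carrier 𝒯 := by
  induction j with
  | zero => rfl
  | succ j ih => rw [level_succ, carrier_red, ih]

theorem domain_level (𝒯 : Finset Tri) (j : ℕ) : domain (level 𝒯 j) = domain 𝒯 := by
  rw [domain, domain, carrier_level]

theorem hull_subset_carrier {𝒯 : Finset Tri} {T : Tri} (hT : T ∈ 𝒯) : hull T ⊆ carrier 𝒯 :=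
  fun _ hx => mem_carrier.2 ⟨T, hT, hx⟩

theorem isCompact_carrier (𝒯 : Finset Tri) : IsCompact (carrier 𝒯) :=
  𝒯.isCompact_biUnion fun T _ => isCompact_hull T

/-! ### The Dirichlet part of the boundary -/

/-- With any point, `Γ` contains the smallest face of a triangle that contains the point. -/
def IsFaceUnion (𝒯 : Finset Tri) (Γ : Set Plane) : Prop :=
  ∀ T ∈ 𝒯, ∀ y ∈ hull T, y ∈ Γ → ∀ w ∈ hull T, (∀ k, bary T w k ≠ 0 → bary T y k ≠ 0) → w ∈ Γ

theorem mem_edge_iff {T : Tri} (h : AffineIndependent ℝ T) (i : Fin 3) (x : Plane) :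
    x ∈ segment ℝ (T (i + 1)) (T (i + 2)) ↔ x ∈ hull T ∧ bary T x i = 0 := by
  have hs : ∀ (f : Fin 3 → ℝ) (i : Fin 3), ∑ k, f k = f i + f (i + 1) + f (i + 2) := by
    intro f i
    rw [Fin.sum_univ_three]
    fin_cases i
    · simp
    · simp
      ring
    · simp
      ring
  have h1 : i + 1 ≠ i := by revert i; decide
  have h2 : i + 2 ≠ i := by revert i; decide
  have h3 : ∀ k : Fin 3, k = i ∨ k = i + 1 ∨ k = i + 2 := by revert i; decide
  constructor
  · intro hx
    refine ⟨(convex_hull T).segment_subset (vertex_mem_hull T _) (vertex_mem_hull T _) hx, ?_⟩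
    obtain ⟨a, b, _, _, hab, rfl⟩ := hx
    rw [bary_combo h hab, bary_vertex h, bary_vertex h]
    simp [h1.symm, h2.symm]
  · rintro ⟨hx, hi⟩
    rw [mem_hull h] at hx
    refine ⟨bary T x (i + 1), bary T x (i + 2), hx.1 _, hx.1 _, ?_, ?_⟩
    · have := hx.2
      rw [hs _ i, hi] at this
      linarith
    · have h4 := point_bary h x
      have h5 : point T (bary T x) = bary T x i • T i + bary T x (i + 1) • T (i + 1) +
          bary T x (i + 2) • T (i + 2) := by
        ext j
        rw [point_apply, hs _ i]
        simp
      rw [h5, hi, zero_smul, zero_add] at h4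
      exact h4

/-- If `y` lies on an edge of another triangle, matching carries the support of `y`, hence that of
`w`, to that edge. In this form the condition on Γ passes to refinements without subdividing its
edges. -/
theorem IsDirichletPart.isFaceUnion {𝒯 : Finset Tri} (h𝒯 : IsConforming 𝒯) {Γ : Set Plane}
    (hΓ : IsDirichletPart 𝒯 Γ) : IsFaceUnion 𝒯 Γ := by
  obtain ⟨⟨E, hE, rfl⟩, -⟩ := hΓ
  rintro T hT y hy ⟨e, he, hye⟩ w hw hwy
  obtain ⟨T', hT', i, rfl⟩ := hE he
  refine ⟨_, he, ?_⟩
  have ha := h𝒯.nondegenerate T hT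
  have ha' := h𝒯.nondegenerate T' hT'
  rw [mem_edge_iff ha'] at hye ⊢
  obtain ⟨π, -, hπ⟩ := h𝒯.exists_matching hT hT'
  obtain ⟨hb, hv⟩ := hπ y hy hye.1
  have h1 : point T ((bary T w ∘ π.symm) ∘ π) = point T' (bary T w ∘ π.symm) :=
    point_match fun k hk => hv k (hwy k (by simpa using hk))
  have h2 : (bary T w ∘ π.symm) ∘ π = bary T w := by
    funext k
    simp
  rw [h2, point_bary ha] at h1
  have hw' := (mem_hull ha).1 hw
  have h3 : bary T w ∘ π.symm ∈ refTriangle :=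
    ⟨fun _ => hw'.1 _, (Fintype.sum_equiv π.symm _ _ fun _ => rfl).trans hw'.2⟩
  refine ⟨h1 ▸ point_mem_hull _ h3, ?_⟩
  rw [h1, bary_point ha' h3.2]
  by_contra h
  refine hwy _ h ?_
  rw [hb]
  simpa using hye.2

/-- Barycentric coordinates in the parent are non-negative combinations of those in the child, so
nothing cancels and inclusion of supports in the child gives inclusion in the parent. -/
theorem IsFaceUnion.red {𝒯 : Finset Tri} (h𝒯 : IsConforming 𝒯) {Γ : Set Plane}
    (hΓ : IsFaceUnion 𝒯 Γ) : IsFaceUnion (red 𝒯) Γ := by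
  intro T' hT' y hy hyΓ w hw hwy
  obtain ⟨T, hT, c, rfl⟩ := mem_red.1 hT'
  have ha := h𝒯.nondegenerate T hT
  have hy' := (mem_hull (child_affineIndependent ha c)).1 hy
  refine hΓ T hT y (hull_child_subset T c hy) hyΓ w (hull_child_subset T c hw) fun k hk => ?_
  rw [bary_child ha c] at hk ⊢
  obtain ⟨r, -, hr⟩ := Finset.exists_ne_zero_of_sum_ne_zero hk
  have h1 := hwy r (left_ne_zero_of_mul hr)
  refine (show 0 < sub c (bary (child T c) y) k from Finset.sum_pos' (fun s _ => mul_nonneg (hy'.1 s) ((refNode_mem _).1 k))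
    ⟨r, Finset.mem_univ r, mul_pos ((hy'.1 r).lt_of_ne' h1)
      (((refNode_mem _).1 k).lt_of_ne' (right_ne_zero_of_mul hr))⟩).ne'

theorem IsDirichletPart.level {𝒯 : Finset Tri} (h𝒯 : IsConforming 𝒯) {Γ : Set Plane}
    (hΓ : IsDirichletPart 𝒯 Γ) (j : ℕ) : IsFaceUnion (level 𝒯 j) Γ := by
  induction j with
  | zero => exact hΓ.isFaceUnion h𝒯
  | succ j ih =>
    rw [level_succ]
    exact ih.red (h𝒯.level j)

/-! ### Integration over the polygon -/

/-- Some vertex of `S` is not common, so the intersection lies in a proper affine subspace, which is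
a null set. -/
theorem IsConforming.aedisjoint {𝒯 : Finset Tri} (h𝒯 : IsConforming 𝒯) {S T : Tri} (hS : S ∈ 𝒯)
    (hT : T ∈ 𝒯) (hST : S ≠ T) : AEDisjoint (volume : Measure Plane) (hull S) (hull T) := by
  have ha := h𝒯.nondegenerate S hS
  obtain ⟨π, hπ, -⟩ := h𝒯.exists_matching hS hT
  obtain ⟨k, hk⟩ : ∃ k, S k ∉ range T := by
    by_contra! h
    refine h𝒯.distinct S hS T hT hST ?_
    rw [show S = T ∘ π from funext fun k => hπ k (h k), EquivLike.range_comp]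
  rw [AEDisjoint, h𝒯.inter S hS T hT hST]
  have hne : affineSpan ℝ (range S ∩ range T) ≠ ⊤ := by
    intro htop
    refine ha.notMem_affineSpan_sdiff k univ ?_
    refine affineSpan_mono ℝ ?_ (htop ▸ AffineSubspace.mem_top ℝ Plane (S k))
    rintro _ ⟨⟨i, rfl⟩, hi⟩
    refine mem_image_of_mem _ ⟨mem_univ i, ?_⟩
    rintro rfl
    exact hk hi
  exact measure_mono_null (convexHull_subset_affineSpan _)
    (Measure.addHaar_affineSubspace volume _ hne)

/-- A point of the polygon that is not interior to it lies on the frontier of some triangle, and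
frontiers of convex sets are null. -/
theorem domain_ae_eq (𝒯 : Finset Tri) : domain 𝒯 =ᵐ[(volume : Measure Plane)] carrier 𝒯 := by
  refine (LE.le.eventuallyLE interior_subset).antisymm ?_
  rw [ae_le_set]
  have : carrier 𝒯 \ domain 𝒯 ⊆ ⋃ T ∈ 𝒯, frontier (hull T) := by
    rintro x ⟨hx, hx'⟩
    obtain ⟨T, hT, hxT⟩ := mem_carrier.1 hx
    refine mem_biUnion hT ⟨subset_closure hxT, fun h => hx' ?_⟩
    exact interior_mono (hull_subset_carrier hT) h
  refine measure_mono_null this ?_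
  refine (measure_biUnion_null_iff (Finset.countable_toSet 𝒯)).2 ?_
  exact fun T _ => (convex_hull T).addHaar_frontier volume

theorem IsConforming.setIntegral_domain {𝒯 : Finset Tri} (h𝒯 : IsConforming 𝒯) {f : Plane → ℝ}
    (hf : ContinuousOn f (carrier 𝒯)) : ∫ x in domain 𝒯, f x = ∑ T ∈ 𝒯, ∫ x in hull T, f x := by
  have h1 : carrier 𝒯 = ⋃ T : 𝒯, hull T := by
    ext x
    simp [carrier]
  rw [setIntegral_congr_set (domain_ae_eq 𝒯), h1, integral_iUnion_ae, tsum_fintype,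
    Finset.sum_coe_sort 𝒯 fun T => ∫ x in hull T, f x]
  · exact fun T => (isClosed_hull T).measurableSet.nullMeasurableSet
  · intro S T hST
    exact h𝒯.aedisjoint S.2 T.2 fun h => hST (Subtype.ext h)
  · rw [← h1]
    exact hf.integrableOn_compact (isCompact_carrier 𝒯)

theorem IsConforming.inner₂_eq {𝒯 : Finset Tri} (h𝒯 : IsConforming 𝒯) {f g : Plane → ℝ}
    (hf : ContinuousOn f (carrier 𝒯)) (hg : ContinuousOn g (carrier 𝒯)) :
    inner₂ (domain 𝒯) f g = ∑ T ∈ 𝒯, vol T * nInner (f ∘ point T) (g ∘ point T) := by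
  rw [inner₂, h𝒯.setIntegral_domain (f := fun x => f x * g x) (hf.mul hg)]
  exact Finset.sum_congr rfl fun T hT => setIntegral_hull (h𝒯.nondegenerate T hT) f g

/-! ### Global collections -/

/-- If the support of the barycentric coordinates of `x` is contained in that of `y`, then `x` is in
every triangle that contains `y`. -/
theorem IsConforming.mem_hull_of_support {𝒯 : Finset Tri} (h𝒯 : IsConforming 𝒯) {S T : Tri}
    (hS : S ∈ 𝒯) (hT : T ∈ 𝒯) {x y : Plane} (hx : x ∈ hull S) (hyS : y ∈ hull S) (hyT : y ∈ hull T)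
    (h : ∀ k, bary S x k ≠ 0 → bary S y k ≠ 0) : x ∈ hull T :=
  mem_convexHull_of_weights (h𝒯.nondegenerate S hS) hx fun k hk =>
    h𝒯.vertex_mem_range hS hT hyS hyT (h k hk)

theorem nInner_const_mul (a b : ℝ) (f g : Bary → ℝ) :
    nInner (fun l => a * f l) (fun l => b * g l) = a * b * nInner f g := by
  have h : ∀ p, a * f (param p) * (b * g (param p)) = a * b * (f (param p) * g (param p)) :=
    fun p => by ring
  simp only [nInner, h]
  rw [integral_const_mul]
  ring

namespace LocalCollection.IsAdmissible

variable {ι : Type} {S : LocalCollection ι}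

theorem point_node_mem (hS : S.IsAdmissible) (T : Tri) (i : ι) : point T (S.node i) ∈ hull T :=
  point_mem_hull T (hS.node_mem i)

theorem bary_node (hS : S.IsAdmissible) {T : Tri} (hT : AffineIndependent ℝ T) (i : ι) :
    bary T (point T (S.node i)) = S.node i :=
  bary_point hT (hS.node_mem i).2

theorem point_node_injective (hS : S.IsAdmissible) {T : Tri} (hT : AffineIndependent ℝ T) :
    Function.Injective fun i => point T (S.node i) := fun i k h =>
  hS.node_injective (point_injective hT (hS.node_mem i).2 (hS.node_mem k).2 h)

theorem exists_label (hS : S.IsAdmissible) {𝒯 : Finset Tri} (h𝒯 : IsConforming 𝒯) {T T' : Tri}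
    (hT : T ∈ 𝒯) (hT' : T' ∈ 𝒯) {i : ι} (hx : point T (S.node i) ∈ hull T') :
    ∃ i', point T (S.node i) = point T' (S.node i') := by
  obtain ⟨π, -, hπ⟩ := h𝒯.exists_matching hT hT'
  obtain ⟨hb, -⟩ := hπ _ (hS.point_node_mem T i) hx
  rw [hS.bary_node (h𝒯.nondegenerate T hT)] at hb
  obtain ⟨i', hi', -⟩ := hS.symmetric π.symm i
  refine ⟨i', ?_⟩
  have h : S.node i' = bary T' (point T (S.node i)) := by
    rw [hi']
    funext k
    rw [Function.comp_apply, congrFun hb (π.symm k)]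
    simp
  rw [h, point_bary (h𝒯.nondegenerate T' hT')]

/-- The choice in `globalFn` is harmless. In two triangles that contain both `x` and `y` the
coordinates of both points differ by the same permutation; symmetry supplies a local function with
the permuted label, and distinctness of labels identifies it. -/
theorem globalFn_point (hS : S.IsAdmissible) {𝒯 : Finset Tri} (h𝒯 : IsConforming 𝒯) {T : Tri}
    (hT : T ∈ 𝒯) (i : ι) {y : Plane} (hy : y ∈ hull T) :
    globalFn S 𝒯 (point T (S.node i)) y =
      scaling 𝒯 (point T (S.node i)) * S.fn i (bary T y) := by
  have h : ∃ q : Tri × ι, q.1 ∈ 𝒯 ∧ point T (S.node i) = point q.1 (S.node q.2) ∧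
      y ∈ hull q.1 := ⟨(T, i), hT, rfl, hy⟩
  rw [globalFn, dif_pos h]
  obtain ⟨h1, h2, h3⟩ := h.choose_spec
  congr 1
  generalize h.choose = q at h1 h2 h3
  obtain ⟨Q, k⟩ := q
  simp only at h1 h2 h3 ⊢
  obtain ⟨π, -, hπ⟩ := h𝒯.exists_matching hT h1
  obtain ⟨hx, -⟩ := hπ _ (hS.point_node_mem T i) (h2 ▸ hS.point_node_mem Q k)
  obtain ⟨hy', -⟩ := hπ _ hy h3
  rw [hS.bary_node (h𝒯.nondegenerate T hT), h2, hS.bary_node (h𝒯.nondegenerate Q h1)] at hx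
  obtain ⟨i', h4, h5⟩ := hS.symmetric π k
  obtain rfl := hS.node_injective (h4.trans hx.symm)
  rw [h5 _ ((mem_hull (h𝒯.nondegenerate Q h1)).1 h3), hy']

theorem fn_eq_zero (hS : S.IsAdmissible) {T : Tri} (hT : AffineIndependent ℝ T) {i : ι} {y : Plane}
    (hy : y ∈ hull T)
    (h : ¬ ∀ k, bary T (point T (S.node i)) k ≠ 0 → bary T y k ≠ 0) : S.fn i (bary T y) = 0 := by
  push Not at h
  obtain ⟨k, hk, hk'⟩ := h
  rw [hS.bary_node hT] at hk
  exact hS.vanish_edge i k hk _ ((mem_hull hT).1 hy) hk'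

/-- Even if `y` is on an edge shared with a triangle at `x`, a non-zero value would force the
support of `x` into that of `y`, so that `x` would lie in `T` and be one of its labels. This gives
continuity of the extension by zero. -/
theorem globalFn_eq_zero (hS : S.IsAdmissible) {𝒯 : Finset Tri} (h𝒯 : IsConforming 𝒯) {T : Tri}
    (hT : T ∈ 𝒯) {x y : Plane} (hy : y ∈ hull T) (hx : ∀ i, x ≠ point T (S.node i)) :
    globalFn S 𝒯 x y = 0 := by
  by_cases h : ∃ q : Tri × ι, q.1 ∈ 𝒯 ∧ x = point q.1 (S.node q.2) ∧ y ∈ hull q.1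
  · obtain ⟨⟨Q, k⟩, h1, rfl, h3⟩ := h
    rw [hS.globalFn_point h𝒯 h1 k h3, hS.fn_eq_zero (h𝒯.nondegenerate Q h1) h3, mul_zero]
    intro h
    obtain ⟨i, hi⟩ := hS.exists_label h𝒯 h1 hT
      (h𝒯.mem_hull_of_support h1 hT (hS.point_node_mem Q k) h3 hy h)
    exact hx i hi
  · rw [globalFn, dif_neg h]

theorem globalFn_eq_zero_of_notMem (hS : S.IsAdmissible) {𝒯 : Finset Tri} (h𝒯 : IsConforming 𝒯)
    {T : Tri} (hT : T ∈ 𝒯) {x y : Plane} (hy : y ∈ hull T) (hx : x ∉ hull T) :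
    globalFn S 𝒯 x y = 0 :=
  hS.globalFn_eq_zero h𝒯 hT hy fun i h => hx (h ▸ hS.point_node_mem T i)

/-- A non-zero value at `y` puts `x` on the smallest face containing `y`, and that face lies in Γ.
-/
theorem globalFn_eq_zero_of_mem_gamma (hS : S.IsAdmissible) {𝒯 : Finset Tri} (h𝒯 : IsConforming 𝒯)
    {Γ : Set Plane} (hΓ : IsFaceUnion 𝒯 Γ) {x y : Plane} (hx : x ∉ Γ) (hy : y ∈ Γ) :
    globalFn S 𝒯 x y = 0 := by
  by_cases h : ∃ q : Tri × ι, q.1 ∈ 𝒯 ∧ x = point q.1 (S.node q.2) ∧ y ∈ hull q.1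
  · obtain ⟨⟨Q, k⟩, h1, rfl, h3⟩ := h
    rw [hS.globalFn_point h𝒯 h1 k h3, hS.fn_eq_zero (h𝒯.nondegenerate Q h1) h3, mul_zero]
    exact fun h => hx (hΓ Q h1 y h3 hy _ (hS.point_node_mem Q k) h)
  · rw [globalFn, dif_neg h]

end LocalCollection.IsAdmissible

theorem globalFn_of_notMem_carrier {ι : Type} (S : LocalCollection ι) {𝒯 : Finset Tri} {x y : Plane}
    (hy : y ∉ carrier 𝒯) : globalFn S 𝒯 x y = 0 := by
  rw [globalFn, dif_neg]
  rintro ⟨q, h1, -, h3⟩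
  exact hy (hull_subset_carrier h1 h3)

theorem continuousOn_carrier {𝒯 : Finset Tri} {f : Plane → ℝ}
    (h : ∀ T ∈ 𝒯, ContinuousOn f (hull T)) : ContinuousOn f (carrier 𝒯) := by
  have h1 : carrier 𝒯 = ⋃ T : 𝒯, hull T := by
    ext x
    simp [carrier]
  rw [h1]
  exact (locallyFinite_of_finite _).continuousOn_iUnion (fun T => isClosed_hull T)
    fun T => h T T.2

theorem mem_star {𝒯 : Finset Tri} {x : Plane} {T : Tri} : T ∈ star 𝒯 x ↔ T ∈ 𝒯 ∧ x ∈ hull T := by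
  simp [star]

theorem scaling_sq_mul {𝒯 : Finset Tri} (h𝒯 : IsConforming 𝒯) {T : Tri} (hT : T ∈ 𝒯) {x : Plane}
    (hx : x ∈ hull T) : 0 < scaling 𝒯 x ∧ scaling 𝒯 x ^ 2 * ∑ T ∈ star 𝒯 x, vol T = 1 := by
  have h : 0 < ∑ T ∈ star 𝒯 x, vol T :=
    Finset.sum_pos (fun S hS => vol_pos (h𝒯.nondegenerate S (mem_star.1 hS).1))
      ⟨T, mem_star.2 ⟨hT, hx⟩⟩
  refine ⟨inv_pos.2 (Real.sqrt_pos.2 h), ?_⟩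
  rw [scaling, inv_pow, Real.sq_sqrt h.le, inv_mul_cancel₀ h.ne']

section Index

variable {ι : Type} [Fintype ι] {S : LocalCollection ι} {𝒯 : Finset Tri} {Γ : Set Plane}

theorem mem_index {x : Plane} :
    x ∈ index S 𝒯 Γ ↔ (∃ T ∈ 𝒯, ∃ i, point T (S.node i) = x) ∧ x ∉ Γ := by
  simp only [index, Finset.mem_filter, Finset.mem_image, Finset.mem_product, Finset.mem_univ,
    and_true, Prod.exists]
  refine and_congr_left fun _ => ⟨?_, ?_⟩
  · rintro ⟨T, i, hT, h⟩
    exact ⟨T, hT, i, h⟩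
  · rintro ⟨T, hT, i, h⟩
    exact ⟨T, i, hT, h⟩

theorem LocalCollection.IsAdmissible.exists_label_of_mem_index (hS : S.IsAdmissible)
    (h𝒯 : IsConforming 𝒯) {x : Plane} (hx : x ∈ index S 𝒯 Γ) {T : Tri} (hT : T ∈ 𝒯)
    (hxT : x ∈ hull T) : ∃ i, x = point T (S.node i) := by
  obtain ⟨⟨Q, hQ, i, rfl⟩, -⟩ := mem_index.1 hx
  exact hS.exists_label h𝒯 hQ hT hxT

theorem continuousOn_globalFn (hS : S.IsAdmissible) (h𝒯 : IsConforming 𝒯) (x : Plane) :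
    ContinuousOn (globalFn S 𝒯 x) (carrier 𝒯) := by
  refine continuousOn_carrier fun T hT => ?_
  by_cases h : ∃ i, x = point T (S.node i)
  · obtain ⟨i, rfl⟩ := h
    refine ContinuousOn.congr (f := fun y => scaling 𝒯 (point T (S.node i)) * S.fn i (bary T y)) ?_
      fun y hy => hS.globalFn_point h𝒯 hT i hy
    exact continuousOn_const.mul ((hS.continuous i).comp (continuous_bary T).continuousOn
      fun y hy => (mem_hull (h𝒯.nondegenerate T hT)).1 hy)
  · push Not at h
    exact continuousOn_const.congr fun y hy => hS.globalFn_eq_zero h𝒯 hT hy h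

open Classical in
/-- A sum over the labels in a triangle. -/
theorem sum_labels (hS : S.IsAdmissible) (h𝒯 : IsConforming 𝒯) {T : Tri} (hT : T ∈ 𝒯)
    (g : Plane → ℝ) : ∑ i, (if point T (S.node i) ∈ Γ then 0 else g (point T (S.node i))) =
      ∑ x ∈ index S 𝒯 Γ, if x ∈ hull T then g x else 0 := by
  have h : (index S 𝒯 Γ).filter (· ∈ hull T) =
      (Finset.univ.filter fun i => point T (S.node i) ∉ Γ).image fun i => point T (S.node i) := by
    ext x
    simp only [Finset.mem_filter, Finset.mem_image, Finset.mem_univ, true_and]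
    constructor
    · rintro ⟨hx, hxT⟩
      obtain ⟨i, rfl⟩ := hS.exists_label_of_mem_index h𝒯 hx hT hxT
      exact ⟨i, (mem_index.1 hx).2, rfl⟩
    · rintro ⟨i, hi, rfl⟩
      exact ⟨mem_index.2 ⟨⟨T, hT, i, rfl⟩, hi⟩, hS.point_node_mem T i⟩
  rw [← Finset.sum_filter, h,
    Finset.sum_image fun i _ k _ hik => hS.point_node_injective (h𝒯.nondegenerate T hT) hik,
    Finset.sum_filter]
  simp only [ite_not]

open Classical in
/-- The coefficients of a linear combination of global functions on a triangle. -/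
def localCoeff (S : LocalCollection ι) (𝒯 : Finset Tri) (Γ : Set Plane) (a : Plane → ℝ) (T : Tri)
    (i : ι) : ℝ :=
  if point T (S.node i) ∈ Γ then 0 else a (point T (S.node i)) * scaling 𝒯 (point T (S.node i))

theorem sum_globalFn (hS : S.IsAdmissible) (h𝒯 : IsConforming 𝒯) {T : Tri} (hT : T ∈ 𝒯)
    (a : Plane → ℝ) {y : Plane} (hy : y ∈ hull T) :
    ∑ x ∈ index S 𝒯 Γ, a x * globalFn S 𝒯 x y =
      ∑ i, localCoeff S 𝒯 Γ a T i * S.fn i (bary T y) := by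
  classical
  have h := sum_labels (Γ := Γ) hS h𝒯 hT fun x => a x * globalFn S 𝒯 x y
  rw [Finset.sum_congr rfl fun x _ => (?_ : a x * globalFn S 𝒯 x y = _), ← h]
  · refine Finset.sum_congr rfl fun i _ => ?_
    rw [localCoeff, hS.globalFn_point h𝒯 hT i hy]
    split_ifs
    · rw [zero_mul]
    · ring
  · split_ifs with hx
    · rfl
    · rw [hS.globalFn_eq_zero_of_notMem h𝒯 hT hy hx, mul_zero]

/-- This is what the scaling is for: after exchanging the sums, a_x² is multiplied by s_x² times the
area of the star of x, which is one. -/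
theorem sum_localCoeff_sq (hS : S.IsAdmissible) (h𝒯 : IsConforming 𝒯) (a : Plane → ℝ) :
    ∑ T ∈ 𝒯, vol T * ∑ i, localCoeff S 𝒯 Γ a T i ^ 2 = ∑ x ∈ index S 𝒯 Γ, a x ^ 2 := by
  classical
  have h : ∀ T ∈ 𝒯, vol T * ∑ i, localCoeff S 𝒯 Γ a T i ^ 2 =
      ∑ x ∈ index S 𝒯 Γ, if x ∈ hull T then vol T * (a x ^ 2 * scaling 𝒯 x ^ 2) else 0 := by
    intro T hT
    rw [← sum_labels (Γ := Γ) hS h𝒯 hT fun x => vol T * (a x ^ 2 * scaling 𝒯 x ^ 2),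
      Finset.mul_sum]
    refine Finset.sum_congr rfl fun i _ => ?_
    rw [localCoeff]
    split_ifs
    · norm_num
    · ring
  rw [Finset.sum_congr rfl h, Finset.sum_comm]
  refine Finset.sum_congr rfl fun x hx => ?_
  obtain ⟨⟨T, hT, i, rfl⟩, -⟩ := mem_index.1 hx
  rw [← Finset.sum_filter, ← Finset.sum_mul]
  have := (scaling_sq_mul h𝒯 hT (hS.point_node_mem T i)).2
  rw [star] at this
  linear_combination a (point T (S.node i)) ^ 2 * this

theorem continuousOn_sum_globalFn (hS : S.IsAdmissible) (h𝒯 : IsConforming 𝒯) (a : Plane → ℝ) :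
    ContinuousOn (∑ x ∈ index S 𝒯 Γ, a x • globalFn S 𝒯 x) (carrier 𝒯) := by
  rw [show (∑ x ∈ index S 𝒯 Γ, a x • globalFn S 𝒯 x) =
    fun y => ∑ x ∈ index S 𝒯 Γ, a x * globalFn S 𝒯 x y by
      funext y
      simp]
  exact continuousOn_finsetSum _ fun x _ =>
    continuousOn_const.mul (continuousOn_globalFn hS h𝒯 x)

theorem inner₂_sum_globalFn (hS : S.IsAdmissible) (h𝒯 : IsConforming 𝒯) (a : Plane → ℝ) :
    inner₂ (domain 𝒯) (∑ x ∈ index S 𝒯 Γ, a x • globalFn S 𝒯 x)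
      (∑ x ∈ index S 𝒯 Γ, a x • globalFn S 𝒯 x) =
    ∑ T ∈ 𝒯, vol T * nInner (fun l => ∑ i, localCoeff S 𝒯 Γ a T i * S.fn i l)
      (fun l => ∑ i, localCoeff S 𝒯 Γ a T i * S.fn i l) := by
  have hc := continuousOn_sum_globalFn (Γ := Γ) hS h𝒯 a
  rw [h𝒯.inner₂_eq hc hc]
  refine Finset.sum_congr rfl fun T hT => ?_
  have h : EqOn ((∑ x ∈ index S 𝒯 Γ, a x • globalFn S 𝒯 x) ∘ point T)
      (fun l => ∑ i, localCoeff S 𝒯 Γ a T i * S.fn i l) refTriangle := by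
    intro l hl
    have := sum_globalFn (Γ := Γ) hS h𝒯 hT a (point_mem_hull T hl)
    rw [bary_point (h𝒯.nondegenerate T hT) hl.2] at this
    simpa using this
  rw [nInner_congr h h]

/-- The local bounds, weighted by the areas, are added up over the triangles; no inverse inequality
or shape regularity is involved. -/
theorem riesz_bounds_of_gram (hS : S.IsAdmissible) (h𝒯 : IsConforming 𝒯) {c C : ℝ}
    (hc : ∀ a : ι → ℝ,
      c * ∑ i, a i ^ 2 ≤ nInner (fun l => ∑ i, a i * S.fn i l) (fun l => ∑ i, a i * S.fn i l) ∧
      nInner (fun l => ∑ i, a i * S.fn i l) (fun l => ∑ i, a i * S.fn i l) ≤ C * ∑ i, a i ^ 2)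
    (a : Plane → ℝ) :
    c * ∑ x ∈ index S 𝒯 Γ, a x ^ 2 ≤ inner₂ (domain 𝒯)
        (∑ x ∈ index S 𝒯 Γ, a x • globalFn S 𝒯 x) (∑ x ∈ index S 𝒯 Γ, a x • globalFn S 𝒯 x) ∧
      inner₂ (domain 𝒯) (∑ x ∈ index S 𝒯 Γ, a x • globalFn S 𝒯 x)
        (∑ x ∈ index S 𝒯 Γ, a x • globalFn S 𝒯 x) ≤ C * ∑ x ∈ index S 𝒯 Γ, a x ^ 2 := by
  rw [inner₂_sum_globalFn hS h𝒯, ← sum_localCoeff_sq hS h𝒯, Finset.mul_sum, Finset.mul_sum]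
  constructor <;> refine Finset.sum_le_sum fun T hT => ?_ <;> rw [mul_left_comm] <;>
    refine mul_le_mul_of_nonneg_left ?_ (vol_pos (h𝒯.nondegenerate T hT)).le
  exacts [(hc _).1, (hc _).2]

end Index

open Classical in
-- In each triangle at most one pair of labels fits. Keeping the double sum avoids choosing that
-- pair and covers the triangles in which there is none.
theorem inner₂_globalFn {ι κ : Type} [Fintype ι] [Fintype κ] {S : LocalCollection ι}
    {S' : LocalCollection κ} (hS : S.IsAdmissible) (hS' : S'.IsAdmissible) {𝒯 : Finset Tri}
    (h𝒯 : IsConforming 𝒯) (x y : Plane) :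
    inner₂ (domain 𝒯) (globalFn S 𝒯 x) (globalFn S' 𝒯 y) =
      scaling 𝒯 x * scaling 𝒯 y * ∑ T ∈ 𝒯, vol T * ∑ i, ∑ k,
        if x = point T (S.node i) ∧ y = point T (S'.node k) then nInner (S.fn i) (S'.fn k) else 0 := by
  rw [h𝒯.inner₂_eq (continuousOn_globalFn hS h𝒯 x) (continuousOn_globalFn hS' h𝒯 y),
    Finset.mul_sum]
  refine Finset.sum_congr rfl fun T hT => ?_
  rw [mul_left_comm]
  congr 1
  have ha := h𝒯.nondegenerate T hT
  by_cases hx : ∃ i, x = point T (S.node i)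
  · obtain ⟨i, rfl⟩ := hx
    by_cases hy : ∃ k, y = point T (S'.node k)
    · obtain ⟨k, rfl⟩ := hy
      rw [Finset.sum_eq_single i, Finset.sum_eq_single k, if_pos ⟨rfl, rfl⟩]
      · rw [← nInner_const_mul]
        refine nInner_congr (fun l hl => ?_) (fun l hl => ?_)
        · rw [Function.comp_apply, hS.globalFn_point h𝒯 hT i (point_mem_hull T hl),
            bary_point ha hl.2]
        · rw [Function.comp_apply, hS'.globalFn_point h𝒯 hT k (point_mem_hull T hl),
            bary_point ha hl.2]
      · intro k' _ hk'
        exact if_neg fun h => hk' (hS'.point_node_injective ha h.2).symm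
      · simp
      · intro i' _ hi'
        refine Finset.sum_eq_zero fun k _ => ?_
        exact if_neg fun h => hi' (hS.point_node_injective ha h.1).symm
      · simp
    · push Not at hy
      have h0 : EqOn (globalFn S' 𝒯 y ∘ point T) (fun _ => 0) refTriangle := fun l hl =>
        hS'.globalFn_eq_zero h𝒯 hT (point_mem_hull T hl) hy
      rw [Finset.sum_eq_zero fun i _ => Finset.sum_eq_zero fun k _ => if_neg fun h => hy k h.2,
        mul_zero, nInner_congr (fun _ _ => rfl) h0]
      simp [nInner]
  · push Not at hx
    have h0 : EqOn (globalFn S 𝒯 x ∘ point T) (fun _ => 0) refTriangle := fun l hl =>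
      hS.globalFn_eq_zero h𝒯 hT (point_mem_hull T hl) hx
    rw [Finset.sum_eq_zero fun i _ => Finset.sum_eq_zero fun k _ => if_neg fun h => hx i h.1,
      mul_zero, nInner_congr h0 fun _ _ => rfl]
    simp [nInner]

/-! ### Local inner products -/

theorem child_injective {T : Tri} (h : AffineIndependent ℝ T) : Function.Injective (child T) := by
  intro c d hcd
  have h1 : ∀ r, childVertex c r = childVertex d r := fun r => by
    refine low_injective (refNode_inj.1 (point_injective h (refNode_mem _).2 (refNode_mem _).2 ?_))
    rw [← child_eq, ← child_eq, hcd]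
  have h2 : ∀ c d, (∀ r, childVertex c r = childVertex d r) → c = d := by decide +kernel
  exact h2 c d h1

theorem isConforming_singleton {T : Tri} (h : AffineIndependent ℝ T) :
    IsConforming ({T} : Finset Tri) where
  nondegenerate := by simpa using h
  distinct := by simp
  inter := by simp

theorem nInner_eq_sum_sub {f g : Bary → ℝ} (hf : ContinuousOn f refTriangle)
    (hg : ContinuousOn g refTriangle) :
    nInner f g = ∑ c, nInner (f ∘ sub c) (g ∘ sub c) / 4 := by
  -- Any non-degenerate triangle would do: the integral over it and the sum over its red-refinement
  -- are the same integral, and dividing by the area gives the formula.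
  let T : Tri := ![0, EuclideanSpace.single 0 1, EuclideanSpace.single 1 1]
  have hT : AffineIndependent ℝ T :=
    affineIndependent_of_signedArea (by simp [T, signedArea])
  have h𝒯 := isConforming_singleton hT
  have hcont : ∀ f : Bary → ℝ, ContinuousOn f refTriangle →
      ContinuousOn (f ∘ bary T) (carrier {T}) := fun f hf =>
    continuousOn_carrier fun S hS => by
      rw [Finset.mem_singleton.1 hS]
      exact hf.comp (continuous_bary T).continuousOn fun y hy => (mem_hull hT).1 hy
  have h1 := h𝒯.inner₂_eq (hcont f hf) (hcont g hg)
  have h2 := h𝒯.red.inner₂_eq (f := f ∘ bary T) (g := g ∘ bary T)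
    (by rw [carrier_red]; exact hcont f hf) (by rw [carrier_red]; exact hcont g hg)
  have hd : domain (red {T}) = domain {T} := domain_level {T} 1
  have hr : red {T} = Finset.univ.image (child T) := by
    ext S
    simp [mem_red]
  rw [hd, h1, hr, Finset.sum_image fun c _ d _ h => child_injective hT h, Finset.sum_singleton] at h2
  have h3 : ∀ (f : Bary → ℝ) (c : Fin 4),
      EqOn ((f ∘ bary T) ∘ point (child T c)) (f ∘ sub c) refTriangle := by
    intro f c μ hμ
    simp only [Function.comp_apply]
    rw [point_child, bary_point hT (sub_sum c hμ.2)]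
  have h4 : ∀ f : Bary → ℝ, EqOn ((f ∘ bary T) ∘ point T) f refTriangle := by
    intro f l hl
    simp only [Function.comp_apply]
    rw [bary_point hT hl.2]
  rw [nInner_congr (h4 f) (h4 g)] at h2
  have h5 := (vol_pos hT).ne'
  refine mul_left_cancel₀ h5 (h2.trans ?_)
  rw [Finset.mul_sum]
  refine Finset.sum_congr rfl fun c _ => ?_
  rw [nInner_congr (h3 f c) (h3 g c), vol_child hT]
  ring

theorem integral_mul_affine (a b c : Fin 3 → ℝ) :
    ∫ p in paramDomain, (a 0 + a 1 * p.1 + a 2 * p.2) * (b 0 + b 1 * p.1 + b 2 * p.2) *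
      (c 0 + c 1 * p.1 + c 2 * p.2) =
    a 0 * b 0 * c 0 / 2 + (a 1 * b 0 * c 0 + a 0 * b 1 * c 0 + a 0 * b 0 * c 1 +
      (a 2 * b 0 * c 0 + a 0 * b 2 * c 0 + a 0 * b 0 * c 2)) / 6 +
    (a 1 * b 1 * c 0 + a 1 * b 0 * c 1 + a 0 * b 1 * c 1 +
      (a 2 * b 2 * c 0 + a 2 * b 0 * c 2 + a 0 * b 2 * c 2)) / 12 +
    (a 1 * b 2 * c 0 + a 2 * b 1 * c 0 + a 1 * b 0 * c 2 + a 2 * b 0 * c 1 + a 0 * b 1 * c 2 +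
      a 0 * b 2 * c 1) / 24 + (a 1 * b 1 * c 1 + a 2 * b 2 * c 2) / 20 +
    (a 1 * b 1 * c 2 + a 1 * b 2 * c 1 + a 2 * b 1 * c 1 +
      (a 1 * b 2 * c 2 + a 2 * b 1 * c 2 + a 2 * b 2 * c 1)) / 60 := by
  have h := integral_cubic ![a 0 * b 0 * c 0, a 1 * b 0 * c 0 + a 0 * b 1 * c 0 + a 0 * b 0 * c 1,
    a 2 * b 0 * c 0 + a 0 * b 2 * c 0 + a 0 * b 0 * c 2,
    a 1 * b 1 * c 0 + a 1 * b 0 * c 1 + a 0 * b 1 * c 1,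
    a 1 * b 2 * c 0 + a 2 * b 1 * c 0 + a 1 * b 0 * c 2 + a 2 * b 0 * c 1 + a 0 * b 1 * c 2 +
      a 0 * b 2 * c 1,
    a 2 * b 2 * c 0 + a 2 * b 0 * c 2 + a 0 * b 2 * c 2, a 1 * b 1 * c 1,
    a 1 * b 1 * c 2 + a 1 * b 2 * c 1 + a 2 * b 1 * c 1,
    a 1 * b 2 * c 2 + a 2 * b 1 * c 2 + a 2 * b 2 * c 1, a 2 * b 2 * c 2]
  simp at h
  rw [← h]
  congr 1
  funext p
  ring

/-- The inner products of the quadratic nodal functions and the barycentric coordinates,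
times `60`. -/
def massZ : Fin 6 → Fin 3 → ℤ :=
  ![![2, -1, -1], ![-1, 2, -1], ![-1, -1, 2], ![4, 8, 8], ![8, 4, 8], ![8, 8, 4]]

theorem nInner_quadNodal (r : Fin 6) (s : Fin 3) :
    nInner (quadNodal r) (fun l => l s) = massZ r s / 60 := by
  -- The rows are the coefficients of the barycentric coordinates as affine functions of the two
  -- parameters.
  let e : Fin 3 → Fin 3 → ℝ := ![![1, -1, -1], ![0, 1, 0], ![0, 0, 1]]
  have he : ∀ (p : ℝ × ℝ) i, param p i = e i 0 + e i 1 * p.1 + e i 2 * p.2 := by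
    intro p i
    fin_cases i <;> simp [param, e]
    ring
  have he' : (e 0 0 = 1 ∧ e 0 1 = -1 ∧ e 0 2 = -1) ∧ (e 1 0 = 0 ∧ e 1 1 = 1 ∧ e 1 2 = 0) ∧
      e 2 0 = 0 ∧ e 2 1 = 0 ∧ e 2 2 = 1 :=
    ⟨⟨rfl, rfl, rfl⟩, ⟨rfl, rfl, rfl⟩, rfl, rfl, rfl⟩
  have h3 : ∀ a b c : ℝ, (![a, b, c] : Fin 3 → ℝ) 2 = c := fun _ _ _ => rfl
  clear_value e
  obtain ⟨k, rfl | rfl⟩ := eq_corner_or_opposite r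
  · have h : ∀ p : ℝ × ℝ, quadNodal (corner k) (param p) * param p s =
        (e k 0 + e k 1 * p.1 + e k 2 * p.2) *
        ((![2 * e k 0 - 1, 2 * e k 1, 2 * e k 2] : Fin 3 → ℝ) 0 +
          (![2 * e k 0 - 1, 2 * e k 1, 2 * e k 2] : Fin 3 → ℝ) 1 * p.1 +
          (![2 * e k 0 - 1, 2 * e k 1, 2 * e k 2] : Fin 3 → ℝ) 2 * p.2) *
        (e s 0 + e s 1 * p.1 + e s 2 * p.2) := by
      intro p
      rw [quadNodal_corner, he, he]
      simp only [Matrix.cons_val_zero, Matrix.cons_val_one, Matrix.cons_val]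
      ring
    simp only [nInner, h]
    rw [integral_mul_affine]
    clear h
    revert k s
    refine fun | 0 => ?_ | 1 => ?_ | 2 => ?_ <;> intro s <;> fin_cases s <;>
      simp [he', massZ, corner, h3] <;> norm_num
  · have h : ∀ p : ℝ × ℝ, quadNodal (opposite k) (param p) * param p s =
        4 * ((e (k + 1) 0 + e (k + 1) 1 * p.1 + e (k + 1) 2 * p.2) *
        (e (k + 2) 0 + e (k + 2) 1 * p.1 + e (k + 2) 2 * p.2) *
        (e s 0 + e s 1 * p.1 + e s 2 * p.2)) := by
      intro p
      rw [quadNodal_opposite, he, he, he]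
      ring
    simp only [nInner, h]
    rw [integral_const_mul, integral_mul_affine]
    clear h
    revert k s
    refine fun | 0 => ?_ | 1 => ?_ | 2 => ?_ <;> intro s <;> fin_cases s <;>
      simp [he', massZ, opposite] <;> norm_num

/-- The inner products of the fine nodal functions and the functions `hat`, times `240`. -/
def gramZ : Fin 15 → Fin 6 → ℤ :=
  ![![2, 0, 0, 0, -1, -1],
    ![0, 2, 0, -1, 0, -1],
    ![0, 0, 2, -1, -1, 0],
    ![0, -1, -1, 6, -2, -2],
    ![-1, 0, -1, -2, 6, -2],
    ![-1, -1, 0, -2, -2, 6],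
    ![0, 8, 0, 8, 0, 4],
    ![0, 0, 8, 8, 4, 0],
    ![0, 0, 8, 4, 8, 0],
    ![8, 0, 0, 0, 8, 4],
    ![8, 0, 0, 0, 4, 8],
    ![0, 8, 0, 4, 0, 8],
    ![4, 0, 0, 4, 16, 16],
    ![0, 4, 0, 16, 4, 16],
    ![0, 0, 4, 16, 16, 4]]

theorem continuousOn_quadNodal (r : Fin 6) : ContinuousOn (quadNodal r) refTriangle :=
  (continuous_quadNodal r).continuousOn

theorem continuousOn_coord (r : Fin 3) : ContinuousOn (fun l : Bary => l r) refTriangle :=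
  (continuous_apply r).continuousOn

/-- The usual assembly of a mass matrix from its elements: each child contributes `massZ` over 60
with the weight 1/4, hence the denominator 240. -/
theorem nInner_fineNodal_hat (a : Fin 15) (b : Fin 6) :
    nInner (fineNodal a) (hat b) = gramZ a b / 240 := by
  have h1 : ∀ c, EqOn (fineNodal a ∘ sub c)
      (fun μ => ∑ r, (if childNode c r = a then 1 else 0) * quadNodal r μ) refTriangle := by
    intro c μ hμ
    rw [Function.comp_apply, fineNodal_sub c a hμ]
    simp
  have h2 : ∀ c, EqOn (hat b ∘ sub c)
      (fun μ => ∑ s, (if childVertex c s = b then 1 else 0) * μ s) refTriangle := by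
    intro c μ hμ
    rw [Function.comp_apply, hat_sub c b hμ]
    simp
  have h3 : ∀ (a : Fin 15) (b : Fin 6), gramZ a b = ∑ c, ∑ r, (if childNode c r = a then 1 else 0) *
      ∑ s, (if childVertex c s = b then 1 else 0) * massZ r s := by decide +kernel
  rw [nInner_eq_sum_sub (continuous_fineNodal a).continuousOn (continuous_hat b).continuousOn, h3,
    Int.cast_sum, Finset.sum_div]
  refine Finset.sum_congr rfl fun c _ => ?_
  have hc : ContinuousOn (fun μ : Bary => ∑ s, (if childVertex c s = b then 1 else 0) * μ s)
      refTriangle :=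
    continuousOn_finsetSum _ fun s _ => continuousOn_const.mul (continuousOn_coord s)
  rw [nInner_congr (h1 c) (h2 c), nInner_sum_left _ _ _ _ (fun r _ => continuousOn_quadNodal r) hc]
  push_cast
  rw [Finset.sum_div, Finset.sum_div]
  refine Finset.sum_congr rfl fun r _ => ?_
  rw [nInner_sum_right _ _ _ _ (fun s _ => continuousOn_coord s) (continuousOn_quadNodal r),
    mul_div_assoc, mul_div_assoc, Finset.sum_div, Finset.sum_div]
  congr 1
  refine Finset.sum_congr rfl fun s _ => ?_
  rw [nInner_quadNodal]
  ring

/-- The inner products of `Θ ∪ Ξ` and `Φ̃`. -/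
def crossGram (i : Fin 15) (k : Fin 6) : ℚ :=
  if i = low k then 1 else
  ![0, 0, 0, 0, 0, 0, if k = 1 then 3 / 100 else 0, if k = 2 then 3 / 100 else 0,
    if k = 2 then 3 / 100 else 0, if k = 0 then 3 / 100 else 0, if k = 0 then 3 / 100 else 0,
    if k = 1 then 3 / 100 else 0, if k = 0 then -1 / 48 else if k = 3 then 27 / 240 else 0,
    if k = 1 then -1 / 48 else if k = 4 then 27 / 240 else 0,
    if k = 2 then -1 / 48 else if k = 5 then 27 / 240 else 0] i

theorem nInner_locAll_locPhi (i : Fin 15) (k : Fin 6) :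
    nInner (locAll.fn i) (locPhi.fn k) = crossGram i k := by
  -- 52488000 = 8100 · 27 · 240, the product of the three cleared denominators.
  have h : ∀ (i : Fin 15) (k : Fin 6), ((∑ a, coeffZ a i * ∑ b, dualZ b k * gramZ a b : ℤ) : ℚ) =
      52488000 * crossGram i k := by decide +kernel
  have h' : ((∑ a, coeffZ a i * ∑ b, dualZ b k * gramZ a b : ℤ) : ℝ) =
      52488000 * (crossGram i k : ℝ) := by exact_mod_cast h i k
  have hfine : ∀ a ∈ Finset.univ, ContinuousOn (fineNodal a) refTriangle := fun a _ =>
    (continuous_fineNodal a).continuousOn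
  have hhat : ∀ b ∈ Finset.univ, ContinuousOn (hat b) refTriangle := fun b _ =>
    (continuous_hat b).continuousOn
  change nInner (fun l => ∑ a, coeffMatrix a i * fineNodal a l)
    (fun l => ∑ b, dualMatrix b k * hat b l) = _
  have hc : ContinuousOn (fun l => ∑ b, dualMatrix b k * hat b l) refTriangle :=
    continuousOn_finsetSum _ fun b hb => continuousOn_const.mul (hhat b hb)
  rw [nInner_sum_left _ _ _ _ hfine hc]
  simp only [nInner_sum_right _ _ _ _ hhat (hfine _ (Finset.mem_univ _)), nInner_fineNodal_hat,
    coeffMatrix_apply, dualMatrix_apply]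
  push_cast at h'
  rw [← mul_right_inj' (show (52488000 : ℝ) ≠ 0 by norm_num), ← h', Finset.mul_sum]
  refine Finset.sum_congr rfl fun a _ => ?_
  rw [mul_assoc, ← mul_assoc, mul_left_comm, Finset.mul_sum]
  congr 1
  refine Finset.sum_congr rfl fun b _ => ?_
  ring

theorem crossGram_low (i k : Fin 6) : crossGram (low i) k = if i = k then 1 else 0 := by
  revert i k
  decide +kernel

theorem xiPhiMatrix_eq : ∀ (i : Fin 9) (k : Fin 6), xiPhiMatrix i k = crossGram (high i) k := by
  have h : ∀ (i : Fin 9) (k : Fin 6), ((![![0, 36, 0, 0, 0, 0], ![0, 0, 36, 0, 0, 0],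
      ![0, 0, 36, 0, 0, 0], ![36, 0, 0, 0, 0, 0], ![36, 0, 0, 0, 0, 0], ![0, 36, 0, 0, 0, 0],
      ![-25, 0, 0, 135, 0, 0], ![0, -25, 0, 0, 135, 0], ![0, 0, -25, 0, 0, 135]] i k : ℤ) : ℚ) =
      1200 * crossGram (high i) k := by decide +kernel
  have h' : ∀ (i : Fin 9) (k : Fin 6), xiPhiMatrix i k = (1200 : ℝ)⁻¹ *
      (![![0, 36, 0, 0, 0, 0], ![0, 0, 36, 0, 0, 0],
      ![0, 0, 36, 0, 0, 0], ![36, 0, 0, 0, 0, 0], ![36, 0, 0, 0, 0, 0], ![0, 36, 0, 0, 0, 0],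
      ![-25, 0, 0, 135, 0, 0], ![0, -25, 0, 0, 135, 0], ![0, 0, -25, 0, 0, 135]] i k : ℤ) := by
    unfold xiPhiMatrix
    simp only [Matrix.of_apply]
    repeat' refine vecCons_vecCons_eq_mul ?_ ?_
    all_goals repeat' refine vecCons_eq_mul ?_ ?_
    all_goals norm_num
  intro i k
  have h1 := congrArg (Rat.cast : ℚ → ℝ) (h i k)
  push_cast at h1
  rw [h', h1]
  ring

theorem refInner_locTheta_locPhi : (Matrix.of fun i k => refInner (locTheta.fn i) (locPhi.fn k)) =
    refVol • (1 : Matrix (Fin 6) (Fin 6) ℝ) := by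
  ext i k
  rw [Matrix.of_apply, refInner_eq, Matrix.smul_apply, smul_eq_mul, Matrix.one_apply]
  congr 1
  refine (nInner_locAll_locPhi (low i) k).trans ?_
  rw [crossGram_low]
  split_ifs <;> simp

theorem refInner_locXi_locPhi : (Matrix.of fun i k => refInner (locXi.fn i) (locPhi.fn k)) =
    refVol • xiPhiMatrix := by
  ext i k
  rw [Matrix.of_apply, refInner_eq, Matrix.smul_apply, smul_eq_mul, xiPhiMatrix_eq]
  congr 1
  exact nInner_locAll_locPhi (high i) k

/-! ### Finite element spaces -/

/-- The space `feSpace k 𝒯 Γ` as a submodule. -/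
def feSubmodule (k : ℕ) (𝒯 : Finset Tri) (Γ : Set Plane) : Submodule ℝ (Plane → ℝ) where
  carrier := feSpace k 𝒯 Γ
  zero_mem' := ⟨continuousOn_const, fun _ _ => rfl, fun _ _ => rfl, fun _ _ => ⟨0, by simp, by simp⟩⟩
  add_mem' := by
    rintro f g ⟨hf1, hf2, hf3, hf4⟩ ⟨hg1, hg2, hg3, hg4⟩
    refine ⟨hf1.add hg1, fun x hx => ?_, fun x hx => ?_, fun T hT => ?_⟩
    · rw [Pi.add_apply, hf2 x hx, hg2 x hx, add_zero]
    · rw [Pi.add_apply, hf3 x hx, hg3 x hx, add_zero]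
    · obtain ⟨p, hp, hp'⟩ := hf4 T hT
      obtain ⟨q, hq, hq'⟩ := hg4 T hT
      exact ⟨p + q, (MvPolynomial.totalDegree_add p q).trans (max_le hp hq),
        fun x hx => by rw [Pi.add_apply, hp' x hx, hq' x hx, map_add]⟩
  smul_mem' := by
    rintro a f ⟨hf1, hf2, hf3, hf4⟩
    refine ⟨hf1.const_smul a, fun x hx => ?_, fun x hx => ?_, fun T hT => ?_⟩
    · rw [Pi.smul_apply, hf2 x hx, smul_zero]
    · rw [Pi.smul_apply, hf3 x hx, smul_zero]
    · obtain ⟨p, hp, hp'⟩ := hf4 T hT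
      exact ⟨a • p, (MvPolynomial.totalDegree_smul_le a p).trans hp,
        fun x hx => by rw [Pi.smul_apply, hp' x hx, MvPolynomial.smul_eval, smul_eq_mul]⟩

theorem isPolyLE_bary (T : Tri) (i : Fin 3) :
    IsPolyLE 1 fun u : Fin 2 → ℝ => bary T (WithLp.toLp 2 u) i := by
  have h : (fun u : Fin 2 → ℝ => bary T (WithLp.toLp 2 u) i) = fun u =>
      ((T (i + 1) 1 - T (i + 2) 1) / signedArea (T 0) (T 1) (T 2) * u 0 +
        (T (i + 2) 0 - T (i + 1) 0) / signedArea (T 0) (T 1) (T 2) * u 1) +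
        (T (i + 1) 0 * T (i + 2) 1 - T (i + 1) 1 * T (i + 2) 0) /
          signedArea (T 0) (T 1) (T 2) := by
    funext u
    simp only [bary]
    rw [show ∀ b c : Plane, signedArea (WithLp.toLp 2 u) b c =
      (b 1 - c 1) * u 0 + (c 0 - b 0) * u 1 + (b 0 * c 1 - b 1 * c 0) from fun b c => by
        simp only [signedArea]
        ring]
    ring
  rw [h]
  exact (((IsPolyLE.coord 0).const_mul _).add ((IsPolyLE.coord 1).const_mul _)).add (.const _)

/-- Two triangulations occur: `𝒯` carries the labels and `𝒮` the polynomial pieces. They coincide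
for N; for Θ ∪ Ξ and Φ̃ the second is the red-refinement of the first. -/
theorem globalFn_mem_feSubmodule {ι : Type} [Fintype ι] {S : LocalCollection ι} (hS : S.IsAdmissible) {k : ℕ}
    {𝒯 𝒮 : Finset Tri} (h𝒯 : IsConforming 𝒯) {Γ : Set Plane} (hΓ : IsFaceUnion 𝒯 Γ)
    (hc : carrier 𝒮 = carrier 𝒯)
    (h : ∀ T' ∈ 𝒮, ∃ T ∈ 𝒯, hull T' ⊆ hull T ∧ ∀ i, ∃ F : (Fin 2 → ℝ) → ℝ, IsPolyLE k F ∧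
      ∀ x ∈ hull T', S.fn i (bary T x) = F x.ofLp) {x : Plane} (hx : x ∉ Γ) :
    globalFn S 𝒯 x ∈ feSubmodule k 𝒮 Γ := by
  refine ⟨hc ▸ continuousOn_globalFn hS h𝒯 x, fun y hy => globalFn_of_notMem_carrier S (hc ▸ hy),
    fun y hy => hS.globalFn_eq_zero_of_mem_gamma h𝒯 hΓ hx hy, fun T' hT' => ?_⟩
  obtain ⟨T, hT, hsub, hF⟩ := h T' hT'
  by_cases hxT : ∃ i, x = point T (S.node i)
  · obtain ⟨i, rfl⟩ := hxT
    obtain ⟨F, hF, hF'⟩ := hF i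
    obtain ⟨p, hp, hp'⟩ := hF.const_mul (scaling 𝒯 (point T (S.node i)))
    refine ⟨p, hp, fun y hy => ?_⟩
    rw [hS.globalFn_point h𝒯 hT i (hsub hy), hF' y hy]
    exact hp' y.ofLp
  · push Not at hxT
    refine ⟨0, by simp, fun y hy => ?_⟩
    rw [hS.globalFn_eq_zero h𝒯 hT (hsub hy) hxT, map_zero]

section Spaces

variable {𝒯 : Finset Tri} {Γ : Set Plane}

theorem globalFn_locN_mem (h𝒯 : IsConforming 𝒯) (hΓ : IsFaceUnion 𝒯 Γ) {x : Plane} (hx : x ∉ Γ) :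
    globalFn locN 𝒯 x ∈ feSubmodule 2 𝒯 Γ := by
  refine globalFn_mem_feSubmodule locN_isAdmissible h𝒯 hΓ rfl (fun T hT => ?_) hx
  exact ⟨T, hT, subset_rfl, fun i => ⟨_, IsPolyLE.quadNodal_comp (isPolyLE_bary T) i,
    fun y _ => rfl⟩⟩

theorem globalFn_locAll_mem (h𝒯 : IsConforming 𝒯) (hΓ : IsFaceUnion 𝒯 Γ) {x : Plane} (hx : x ∉ Γ) :
    globalFn locAll 𝒯 x ∈ feSubmodule 2 (red 𝒯) Γ := by
  refine globalFn_mem_feSubmodule locAll_isAdmissible h𝒯 hΓ (carrier_red 𝒯) (fun T' hT' => ?_) hx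
  obtain ⟨T, hT, c, rfl⟩ := mem_red.1 hT'
  have hTa := h𝒯.nondegenerate T hT
  refine ⟨T, hT, hull_child_subset T c, fun i => ⟨fun u => ∑ k, coeffMatrix k i *
    ∑ r, (if childNode c r = k then 1 else 0) *
      quadNodal r (bary (child T c) (WithLp.toLp 2 u)), ?_, fun y hy => ?_⟩⟩
  · exact IsPolyLE.sum _ fun k _ => (IsPolyLE.sum _ fun r _ =>
      (IsPolyLE.quadNodal_comp (isPolyLE_bary _) r).const_mul _).const_mul _
  · change ∑ k, coeffMatrix k i * fineNodal k (bary T y) = _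
    refine Finset.sum_congr rfl fun k _ => ?_
    rw [bary_child hTa c, fineNodal_sub c k ((mem_hull (child_affineIndependent hTa c)).1 hy)]
    simp

theorem globalFn_locPhi_mem (h𝒯 : IsConforming 𝒯) (hΓ : IsFaceUnion 𝒯 Γ) {x : Plane} (hx : x ∉ Γ) :
    globalFn locPhi 𝒯 x ∈ feSubmodule 1 (red 𝒯) Γ := by
  refine globalFn_mem_feSubmodule locPhi_isAdmissible h𝒯 hΓ (carrier_red 𝒯) (fun T' hT' => ?_) hx
  obtain ⟨T, hT, c, rfl⟩ := mem_red.1 hT'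
  have hTa := h𝒯.nondegenerate T hT
  refine ⟨T, hT, hull_child_subset T c, fun i => ⟨fun u => ∑ k, dualMatrix k i *
    ∑ r, (if childVertex c r = k then 1 else 0) * bary (child T c) (WithLp.toLp 2 u) r,
    ?_, fun y hy => ?_⟩⟩
  · exact IsPolyLE.sum _ fun k _ => (IsPolyLE.sum _ fun r _ =>
      (isPolyLE_bary _ r).const_mul _).const_mul _
  · change ∑ k, dualMatrix k i * hat k (bary T y) = _
    refine Finset.sum_congr rfl fun k _ => ?_
    rw [hat_bary_child hTa hy]
    simp

theorem feSubmodule_two_unisolvent (h𝒯 : IsConforming 𝒯) {f : Plane → ℝ}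
    (hf : f ∈ feSubmodule 2 𝒯 Γ) (h : ∀ x ∈ index locN 𝒯 Γ, f x = 0) : f = 0 := by
  obtain ⟨-, hf2, hf3, hf4⟩ := hf
  funext x
  by_cases hx : x ∈ carrier 𝒯
  · obtain ⟨T, hT, hxT⟩ := mem_carrier.1 hx
    have ha := h𝒯.nondegenerate T hT
    obtain ⟨p, hp, hp'⟩ := hf4 T hT
    have hpt : ∀ l : Bary, (fun s => (point T l) s) = fun s => ∑ i, l i * T i s := fun l => by
      funext s
      exact point_apply T l s
    rw [← point_bary ha x] at hxT ⊢
    rw [hp' _ hxT, hpt, quad_interpolation hp (fun i s => T i s) (bary_sum ha x)]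
    refine Finset.sum_eq_zero fun r _ => ?_
    rw [← hpt, ← hp' (point T (refNode (low r))) (locN_isAdmissible.point_node_mem T r)]
    refine mul_eq_zero_of_right _ ?_
    by_cases hΓ : point T (locN.node r) ∈ Γ
    · exact hf3 _ hΓ
    · exact h _ (mem_index.2 ⟨⟨T, hT, r, rfl⟩, hΓ⟩)
  · exact hf2 x hx

theorem feSubmodule_one_unisolvent (h𝒯 : IsConforming 𝒯) {f : Plane → ℝ}
    (hf : f ∈ feSubmodule 1 (red 𝒯) Γ) (h : ∀ x ∈ index locPhi 𝒯 Γ, f x = 0) : f = 0 := by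
  obtain ⟨-, hf2, hf3, hf4⟩ := hf
  funext x
  by_cases hx : x ∈ carrier (red 𝒯)
  · obtain ⟨T', hT', hxT⟩ := mem_carrier.1 hx
    have ha := h𝒯.red.nondegenerate T' hT'
    obtain ⟨p, hp, hp'⟩ := hf4 T' hT'
    obtain ⟨T, hT, c, rfl⟩ := mem_red.1 hT'
    have hpt : (fun s => (point (child T c) (bary (child T c) x)) s) =
        fun s => ∑ i, bary (child T c) x i * child T c i s := by
      funext s
      exact point_apply _ _ s
    rw [← point_bary ha x] at hxT ⊢
    rw [hp' _ hxT, hpt, linear_interpolation hp (fun i s => child T c i s) (bary_sum ha x)]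
    refine Finset.sum_eq_zero fun r _ => ?_
    rw [← hp' _ (vertex_mem_hull (child T c) r), child_eq]
    refine mul_eq_zero_of_right _ ?_
    by_cases hΓ : point T (refNode (low (childVertex c r))) ∈ Γ
    · exact hf3 _ hΓ
    · exact h _ (mem_index.2 ⟨⟨T, hT, childVertex c r, rfl⟩, hΓ⟩)
  · exact hf2 x hx

/-- The quadratic nodes of the four children are the fifteen quarter points of the parent. This is
why Θ ∪ Ξ has the right number of functions for the finer space. -/
theorem index_locN_red (𝒯 : Finset Tri) (Γ : Set Plane) :
    index locN (red 𝒯) Γ = index locAll 𝒯 Γ := by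
  ext x
  simp only [mem_index]
  refine and_congr_left fun _ => ⟨?_, ?_⟩
  · rintro ⟨T', hT', r, rfl⟩
    obtain ⟨T, hT, c, rfl⟩ := mem_red.1 hT'
    refine ⟨T, hT, childNode c r, ?_⟩
    change _ = point (child T c) (refNode (low r))
    rw [point_child, sub_refNode]
    rfl
  · rintro ⟨T, hT, k, rfl⟩
    obtain ⟨c, r, rfl⟩ := exists_childNode k
    refine ⟨_, child_mem_red hT c, r, ?_⟩
    change point (child T c) (refNode (low r)) = _
    rw [point_child, sub_refNode]
    rfl

theorem low_ne_high (i : Fin 6) (k : Fin 9) : low i ≠ high k := by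
  revert i k
  decide +kernel

theorem eq_low_or_high (i : Fin 15) : (∃ k, i = low k) ∨ ∃ k, i = high k := by
  revert i
  decide +kernel

theorem index_locAll (𝒯 : Finset Tri) (Γ : Set Plane) (x : Plane) :
    x ∈ index locAll 𝒯 Γ ↔ x ∈ index locTheta 𝒯 Γ ∨ x ∈ index locXi 𝒯 Γ := by
  simp only [mem_index, ← or_and_right]
  refine and_congr_left fun _ => ⟨?_, ?_⟩
  · rintro ⟨T, hT, i, rfl⟩
    obtain ⟨k, rfl⟩ | ⟨k, rfl⟩ := eq_low_or_high i
    · exact Or.inl ⟨T, hT, k, rfl⟩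
    · exact Or.inr ⟨T, hT, k, rfl⟩
  · rintro (⟨T, hT, k, rfl⟩ | ⟨T, hT, k, rfl⟩)
    · exact ⟨T, hT, low k, rfl⟩
    · exact ⟨T, hT, high k, rfl⟩

theorem disjoint_index (h𝒯 : IsConforming 𝒯) (Γ : Set Plane) :
    Disjoint (index locTheta 𝒯 Γ) (index locXi 𝒯 Γ) := by
  rw [Finset.disjoint_left]
  intro x hx hx'
  obtain ⟨⟨T, hT, i, rfl⟩, -⟩ := mem_index.1 hx
  obtain ⟨k, hk⟩ := locXi_isAdmissible.exists_label_of_mem_index h𝒯 hx' hT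
    (locTheta_isAdmissible.point_node_mem T i)
  exact low_ne_high i k (locAll_isAdmissible.point_node_injective (h𝒯.nondegenerate T hT) hk)

theorem globalFn_comp {ι κ : Type} [Fintype κ] {S : LocalCollection ι} {S' : LocalCollection κ}
    (hS : S.IsAdmissible) (hS' : S'.IsAdmissible) (h𝒯 : IsConforming 𝒯) (e : κ → ι)
    (hnode : ∀ i, S'.node i = S.node (e i)) (hfn : ∀ i, S'.fn i = S.fn (e i)) {x : Plane}
    (hx : x ∈ index S' 𝒯 Γ) : globalFn S' 𝒯 x = globalFn S 𝒯 x := by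
  funext y
  by_cases hy : y ∈ carrier 𝒯
  · obtain ⟨T, hT, hyT⟩ := mem_carrier.1 hy
    by_cases hxT : x ∈ hull T
    · obtain ⟨i, rfl⟩ := hS'.exists_label_of_mem_index h𝒯 hx hT hxT
      rw [hS'.globalFn_point h𝒯 hT i hyT, hnode, hS.globalFn_point h𝒯 hT _ hyT, hfn]
    · rw [hS'.globalFn_eq_zero_of_notMem h𝒯 hT hyT hxT, hS.globalFn_eq_zero_of_notMem h𝒯 hT hyT hxT]
  · rw [globalFn_of_notMem_carrier _ hy, globalFn_of_notMem_carrier _ hy]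

theorem globalFn_locTheta (h𝒯 : IsConforming 𝒯) {x : Plane} (hx : x ∈ index locTheta 𝒯 Γ) :
    globalFn locTheta 𝒯 x = globalFn locAll 𝒯 x :=
  globalFn_comp locAll_isAdmissible locTheta_isAdmissible h𝒯 low (fun _ => rfl) (fun _ => rfl) hx

theorem globalFn_locXi (h𝒯 : IsConforming 𝒯) {x : Plane} (hx : x ∈ index locXi 𝒯 Γ) :
    globalFn locXi 𝒯 x = globalFn locAll 𝒯 x :=
  globalFn_comp locAll_isAdmissible locXi_isAdmissible h𝒯 high (fun _ => rfl) (fun _ => rfl) hx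

/-! ### Riesz bases -/

/-- Lets coefficient vectors be functions on the whole plane, so that sums over different index sets
can be compared. -/
theorem exists_extension {α : Type*} (s : Finset α) (a : s → ℝ) :
    ∃ a' : α → ℝ, a = fun x : s => a' x := by
  classical
  exact ⟨fun x => if h : x ∈ s then a ⟨x, h⟩ else 0, by simp⟩

theorem mem_span_finset_iff {α : Type*} (s : Finset α) (g : α → Plane → ℝ) (f : Plane → ℝ) :
    f ∈ Submodule.span ℝ (range fun x : s => g x) ↔ ∃ a : α → ℝ, ∑ x ∈ s, a x • g x = f := by
  rw [Submodule.mem_span_range_iff_exists_fun]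
  constructor
  · rintro ⟨a, rfl⟩
    obtain ⟨a, rfl⟩ := exists_extension s a
    exact ⟨a, (Finset.sum_coe_sort s fun x => a x • g x).symm⟩
  · rintro ⟨a, rfl⟩
    exact ⟨fun x => a x, Finset.sum_coe_sort s fun x => a x • g x⟩

theorem isRieszBasis_iff {Ω : Set Plane} {c C : ℝ} {s : Finset Plane} {g : Plane → Plane → ℝ}
    {W : Set (Plane → ℝ)} : IsRieszBasis Ω c C (fun x : s => g x) W ↔
      (Submodule.span ℝ (range fun x : s => g x) : Set (Plane → ℝ)) = W ∧ ∀ a : Plane → ℝ,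
        c * ∑ x ∈ s, a x ^ 2 ≤ inner₂ Ω (∑ x ∈ s, a x • g x) (∑ x ∈ s, a x • g x) ∧
        inner₂ Ω (∑ x ∈ s, a x • g x) (∑ x ∈ s, a x • g x) ≤ C * ∑ x ∈ s, a x ^ 2 := by
  refine and_congr_right fun _ => ⟨fun h a => ?_, fun h a => ?_⟩
  · have := h fun x => a x
    rwa [Finset.sum_coe_sort s fun x => a x • g x, Finset.sum_coe_sort s fun x => a x ^ 2] at this
  · obtain ⟨a, rfl⟩ := exists_extension s a
    simp only
    rw [Finset.sum_coe_sort s fun x => a x • g x, Finset.sum_coe_sort s fun x => a x ^ 2]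
    exact h a

theorem IsRieszBasis.mono {ι : Type} [Fintype ι] {Ω : Set Plane} {c C c' C' : ℝ}
    {σ : ι → Plane → ℝ} {W : Set (Plane → ℝ)} (h : IsRieszBasis Ω c C σ W) (hc : c' ≤ c)
    (hC : C ≤ C') : IsRieszBasis Ω c' C' σ W := by
  refine ⟨h.1, fun a => ⟨le_trans ?_ (h.2 a).1, (h.2 a).2.trans ?_⟩⟩
  · exact mul_le_mul_of_nonneg_right hc (Finset.sum_nonneg fun i _ => sq_nonneg _)
  · exact mul_le_mul_of_nonneg_right hC (Finset.sum_nonneg fun i _ => sq_nonneg _)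

/-- The normalised Gram matrix of the collection has eigenvalues between `c` and `C`. -/
def GramBounds {ι : Type} [Fintype ι] (S : LocalCollection ι) (c C : ℝ) : Prop :=
  0 < c ∧ ∀ a : ι → ℝ,
    c * ∑ i, a i ^ 2 ≤ nInner (fun l => ∑ i, a i * S.fn i l) (fun l => ∑ i, a i * S.fn i l) ∧
    nInner (fun l => ∑ i, a i * S.fn i l) (fun l => ∑ i, a i * S.fn i l) ≤ C * ∑ i, a i ^ 2

/-- The lower bound yields independence; there are as many functions as labels, and the labels are
unisolvent for `W`, so the dimension count applies. -/
theorem isRieszBasis_globalFn {ι : Type} [Fintype ι] {S : LocalCollection ι} (hS : S.IsAdmissible)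
    (h𝒯 : IsConforming 𝒯) {c C : ℝ} (hc : GramBounds S c C) (W : Submodule ℝ (Plane → ℝ))
    (hmem : ∀ x ∉ Γ, globalFn S 𝒯 x ∈ W)
    (huni : ∀ f ∈ W, (∀ x ∈ index S 𝒯 Γ, f x = 0) → f = 0) :
    IsRieszBasis (domain 𝒯) c C (fun x : index S 𝒯 Γ => globalFn S 𝒯 x) W := by
  have hb := riesz_bounds_of_gram (Γ := Γ) hS h𝒯 hc.2
  refine isRieszBasis_iff.2 ⟨?_, hb⟩
  rw [span_eq_of_unisolvent W (fun x : index S 𝒯 Γ => globalFn S 𝒯 x)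
    (fun x => hmem x (mem_index.1 x.2).2) ?_
    (Subtype.val : index S 𝒯 Γ → Plane) (fun f hf h => huni f hf fun x hx => h ⟨x, hx⟩) rfl]
  rw [Fintype.linearIndependent_iff]
  intro a ha
  obtain ⟨a, rfl⟩ := exists_extension _ a
  rw [Finset.sum_coe_sort _ fun x => a x • globalFn S 𝒯 x] at ha
  have h1 := (hb a).1
  rw [ha] at h1
  have h2 : ∑ x ∈ index S 𝒯 Γ, a x ^ 2 ≤ 0 := by
    refine nonpos_of_mul_nonpos_right (h1.trans ?_) hc.1
    simp [inner₂]
  intro x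
  exact pow_eq_zero_iff two_ne_zero |>.1 ((Finset.sum_eq_zero_iff_of_nonneg fun x _ => sq_nonneg _).1
    (le_antisymm h2 (Finset.sum_nonneg fun x _ => sq_nonneg _)) x x.2)

theorem isRieszBasis_locN (h𝒯 : IsConforming 𝒯) (hΓ : IsFaceUnion 𝒯 Γ) {c C : ℝ}
    (hc : GramBounds locN c C) :
    IsRieszBasis (domain 𝒯) c C (fun x : index locN 𝒯 Γ => globalFn locN 𝒯 x) (feSpace 2 𝒯 Γ) :=
  isRieszBasis_globalFn locN_isAdmissible h𝒯 hc (feSubmodule 2 𝒯 Γ)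
    (fun _ hx => globalFn_locN_mem h𝒯 hΓ hx) fun _ hf h => feSubmodule_two_unisolvent h𝒯 hf h

theorem isRieszBasis_locAll (h𝒯 : IsConforming 𝒯) (hΓ : IsFaceUnion 𝒯 Γ) {c C : ℝ}
    (hc : GramBounds locAll c C) :
    IsRieszBasis (domain 𝒯) c C (fun x : index locAll 𝒯 Γ => globalFn locAll 𝒯 x)
      (feSpace 2 (red 𝒯) Γ) :=
  isRieszBasis_globalFn locAll_isAdmissible h𝒯 hc (feSubmodule 2 (red 𝒯) Γ)
    (fun _ hx => globalFn_locAll_mem h𝒯 hΓ hx) fun _ hf h =>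
      feSubmodule_two_unisolvent h𝒯.red hf (index_locN_red 𝒯 Γ ▸ h)

theorem isRieszBasis_locPhi (h𝒯 : IsConforming 𝒯) (hΓ : IsFaceUnion 𝒯 Γ) {c C : ℝ}
    (hc : GramBounds locPhi c C) :
    IsRieszBasis (domain 𝒯) c C (fun x : index locPhi 𝒯 Γ => globalFn locPhi 𝒯 x)
      (feSpace 1 (red 𝒯) Γ) :=
  isRieszBasis_globalFn locPhi_isAdmissible h𝒯 hc (feSubmodule 1 (red 𝒯) Γ)
    (fun _ hx => globalFn_locPhi_mem h𝒯 hΓ hx) fun _ hf h => feSubmodule_one_unisolvent h𝒯 hf h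

theorem sum_index_locAll (h𝒯 : IsConforming 𝒯) {M : Type*} [AddCommMonoid M] (g : Plane → M) :
    ∑ x ∈ index locAll 𝒯 Γ, g x = ∑ x ∈ index locTheta 𝒯 Γ, g x + ∑ x ∈ index locXi 𝒯 Γ, g x := by
  classical
  rw [← Finset.sum_union (disjoint_index h𝒯 Γ)]
  congr 1
  ext x
  rw [Finset.mem_union, index_locAll]

open Classical in
-- Splits a combination of Θ ∪ Ξ. The general `g` allows the same lemma to split both the function
-- (`t • f`) and the sum of squares (`t ^ 2`).
theorem sum_index_locAll_ite (h𝒯 : IsConforming 𝒯) {M : Type*} [AddCommMonoid M]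
    (g : ℝ → (Plane → ℝ) → M) (a b : Plane → ℝ) :
    ∑ x ∈ index locAll 𝒯 Γ, g (if x ∈ index locTheta 𝒯 Γ then a x else b x) (globalFn locAll 𝒯 x) =
      ∑ x ∈ index locTheta 𝒯 Γ, g (a x) (globalFn locTheta 𝒯 x) +
        ∑ x ∈ index locXi 𝒯 Γ, g (b x) (globalFn locXi 𝒯 x) := by
  rw [sum_index_locAll h𝒯]
  congr 1
  · exact Finset.sum_congr rfl fun x hx => by rw [if_pos hx, globalFn_locTheta h𝒯 hx]
  · exact Finset.sum_congr rfl fun x hx => by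
      rw [if_neg (Finset.disjoint_right.1 (disjoint_index h𝒯 Γ) hx), globalFn_locXi h𝒯 hx]

theorem isRieszBasis_theta_xi (h𝒯 : IsConforming 𝒯) (hΓ : IsFaceUnion 𝒯 Γ) {c C : ℝ}
    (hc : GramBounds locAll c C) :
    IsRieszBasis (domain 𝒯) c C (Sum.elim (fun x : index locTheta 𝒯 Γ => globalFn locTheta 𝒯 x)
      (fun x : index locXi 𝒯 Γ => globalFn locXi 𝒯 x)) (feSpace 2 (red 𝒯) Γ) := by
  classical
  have h := isRieszBasis_iff.1 (isRieszBasis_locAll h𝒯 hΓ hc)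
  refine ⟨?_, fun a => ?_⟩
  · rw [← h.1]
    congr 2
    ext f
    simp only [Sum.elim_range, mem_union, mem_range, Subtype.exists]
    constructor
    · rintro (⟨x, hx, rfl⟩ | ⟨x, hx, rfl⟩)
      · exact ⟨x, (index_locAll _ _ _).2 (Or.inl hx), (globalFn_locTheta h𝒯 hx).symm⟩
      · exact ⟨x, (index_locAll _ _ _).2 (Or.inr hx), (globalFn_locXi h𝒯 hx).symm⟩
    · rintro ⟨x, hx, rfl⟩
      obtain hx | hx := (index_locAll _ _ _).1 hx
      · exact Or.inl ⟨x, hx, globalFn_locTheta h𝒯 hx⟩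
      · exact Or.inr ⟨x, hx, globalFn_locXi h𝒯 hx⟩
  · obtain ⟨a1, h1⟩ := exists_extension _ fun x => a (Sum.inl x)
    obtain ⟨a2, h2⟩ := exists_extension _ fun x => a (Sum.inr x)
    have h3 := h.2 fun x => if x ∈ index locTheta 𝒯 Γ then a1 x else a2 x
    rw [sum_index_locAll_ite h𝒯 (fun t f => t • f), sum_index_locAll_ite h𝒯 (fun t _ => t ^ 2)] at h3
    simp only [Fintype.sum_sum_type, Sum.elim_inl, Sum.elim_inr, congrFun h1, congrFun h2]
    rwa [Finset.sum_coe_sort _ fun x => a1 x • globalFn locTheta 𝒯 x,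
      Finset.sum_coe_sort _ fun x => a1 x ^ 2,
      Finset.sum_coe_sort _ fun x => a2 x • globalFn locXi 𝒯 x,
      Finset.sum_coe_sort _ fun x => a2 x ^ 2]

end Spaces

/-! ### The inner product on the polygon -/

section Wavelets

variable {𝒯 : Finset Tri} {Γ : Set Plane}

theorem inner₂_comm (Ω : Set Plane) (f g : Plane → ℝ) : inner₂ Ω f g = inner₂ Ω g f := by
  simp only [inner₂, mul_comm]

theorem integrableOn_mul {f g : Plane → ℝ} (hf : ContinuousOn f (carrier 𝒯))
    (hg : ContinuousOn g (carrier 𝒯)) : IntegrableOn (fun x => f x * g x) (domain 𝒯) :=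
  ((hf.mul hg).integrableOn_compact (isCompact_carrier 𝒯)).mono_set interior_subset

theorem inner₂_add_left {f g h : Plane → ℝ} (hf : ContinuousOn f (carrier 𝒯))
    (hg : ContinuousOn g (carrier 𝒯)) (hh : ContinuousOn h (carrier 𝒯)) :
    inner₂ (domain 𝒯) (f + g) h = inner₂ (domain 𝒯) f h + inner₂ (domain 𝒯) g h := by
  simp only [inner₂, Pi.add_apply, add_mul]
  exact integral_add (integrableOn_mul hf hh) (integrableOn_mul hg hh)

theorem inner₂_smul_left (a : ℝ) (f h : Plane → ℝ) (Ω : Set Plane) :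
    inner₂ Ω (a • f) h = a * inner₂ Ω f h := by
  simp only [inner₂, Pi.smul_apply, smul_eq_mul, mul_assoc]
  exact integral_const_mul a _

theorem continuousOn_sum_smul {α : Type*} {D : Set Plane} (s : Finset α) (a : α → ℝ)
    {g : α → Plane → ℝ} (hg : ∀ x ∈ s, ContinuousOn (g x) D) :
    ContinuousOn (∑ x ∈ s, a x • g x) D := by
  classical
  induction s using Finset.induction_on with
  | empty => exact continuousOn_const
  | insert x s hx ih =>
    rw [Finset.sum_insert hx]
    exact ((hg x (Finset.mem_insert_self x s)).const_smul _).add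
      (ih fun y hy => hg y (Finset.mem_insert_of_mem hy))

theorem inner₂_sum_left {α : Type*} (s : Finset α) (a : α → ℝ) {g : α → Plane → ℝ} {h : Plane → ℝ}
    (hg : ∀ x ∈ s, ContinuousOn (g x) (carrier 𝒯)) (hh : ContinuousOn h (carrier 𝒯)) :
    inner₂ (domain 𝒯) (∑ x ∈ s, a x • g x) h = ∑ x ∈ s, a x * inner₂ (domain 𝒯) (g x) h := by
  classical
  induction s using Finset.induction_on with
  | empty => simp [inner₂]
  | insert x s hx ih =>
    have hg' : ∀ y ∈ s, ContinuousOn (g y) (carrier 𝒯) :=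
      fun y hy => hg y (Finset.mem_insert_of_mem hy)
    have hgx := hg x (Finset.mem_insert_self x s)
    rw [Finset.sum_insert hx, Finset.sum_insert hx, inner₂_add_left (hgx.const_smul _)
      (continuousOn_sum_smul s a hg') hh, inner₂_smul_left, ih hg']

theorem inner₂_sub_left {f g h : Plane → ℝ} (hf : ContinuousOn f (carrier 𝒯))
    (hg : ContinuousOn g (carrier 𝒯)) (hh : ContinuousOn h (carrier 𝒯)) :
    inner₂ (domain 𝒯) (f - g) h = inner₂ (domain 𝒯) f h - inner₂ (domain 𝒯) g h := by
  rw [sub_eq_add_neg, ← neg_one_smul ℝ g, inner₂_add_left hf (hg.const_smul _) hh, inner₂_smul_left]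
  ring

/-! ### Wavelets -/

/-- Local biorthogonality leaves only equal labels. For x = y each triangle at x contributes its
area, and the squared scaling factor normalises the total to one. -/
theorem inner₂_theta_phi (h𝒯 : IsConforming 𝒯) {x y : Plane} (hx : x ∈ index locTheta 𝒯 Γ) :
    inner₂ (domain 𝒯) (globalFn locTheta 𝒯 x) (globalFn locPhi 𝒯 y) = if x = y then 1 else 0 := by
  classical
  rw [inner₂_globalFn locTheta_isAdmissible locPhi_isAdmissible h𝒯]
  have hn : ∀ i k, nInner (locTheta.fn i) (locPhi.fn k) = if i = k then 1 else 0 := fun i k => by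
    refine (nInner_locAll_locPhi (low i) k).trans ?_
    rw [crossGram_low]
    split_ifs <;> simp
  have h : ∀ T ∈ 𝒯, (∑ i, ∑ k, if x = point T (locTheta.node i) ∧ y = point T (locPhi.node k) then
      nInner (locTheta.fn i) (locPhi.fn k) else 0) =
      if x = y then (if x ∈ hull T then 1 else 0) else 0 := by
    intro T hT
    have h1 : ∀ i k, (if x = point T (locTheta.node i) ∧ y = point T (locPhi.node k) then
        nInner (locTheta.fn i) (locPhi.fn k) else 0) =
        if i = k then (if x = y then (if x = point T (locTheta.node i) then 1 else 0) else 0)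
          else 0 := by
      intro i k
      rw [hn]
      by_cases hik : i = k
      · subst hik
        rw [if_pos rfl, if_pos rfl]
        by_cases hx : x = point T (locTheta.node i)
        · subst hx
          rw [if_pos rfl]
          exact if_congr ⟨fun h => h.2.symm, fun h => ⟨rfl, h.symm⟩⟩ rfl rfl
        · rw [if_neg fun h => hx h.1, if_neg hx, ite_self]
      · rw [if_neg hik, if_neg hik, ite_self]
    simp only [h1, Finset.sum_ite_eq, Finset.mem_univ, if_true]
    split_ifs with hxy hxT
    · obtain ⟨i, rfl⟩ := locTheta_isAdmissible.exists_label_of_mem_index h𝒯 hx hT hxT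
      rw [Finset.sum_eq_single i, if_pos rfl]
      · exact fun k _ hk => if_neg fun h =>
          hk (locTheta_isAdmissible.point_node_injective (h𝒯.nondegenerate T hT) h).symm
      · simp
    · refine Finset.sum_eq_zero fun i _ => if_neg fun h => hxT ?_
      rw [h]
      exact locTheta_isAdmissible.point_node_mem T i
    · simp
  rw [Finset.sum_congr rfl fun T hT => by rw [h T hT]]
  split_ifs with hxy
  · subst hxy
    obtain ⟨⟨T, hT, i, hi⟩, -⟩ := mem_index.1 hx
    have := (scaling_sq_mul h𝒯 hT (hi ▸ locTheta_isAdmissible.point_node_mem T i)).2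
    rw [star, Finset.sum_filter] at this
    simpa [pow_two] using this
  · simp

/-- The function of `Ψ` with label `x`. -/
def wavelet (𝒯 : Finset Tri) (Γ : Set Plane) (x : Plane) : Plane → ℝ :=
  globalFn locXi 𝒯 x - ∑ y ∈ index locTheta 𝒯 Γ,
    inner₂ (domain 𝒯) (globalFn locXi 𝒯 x) (globalFn locPhi 𝒯 y) • globalFn locTheta 𝒯 y

theorem psi_eq_wavelet (𝒯 : Finset Tri) (Γ : Set Plane) (j : ℕ) :
    psi 𝒯 Γ j = wavelet (level 𝒯 j) Γ := by
  funext x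
  rw [wavelet, domain_level]
  rfl

/-- Linearity of the correction: a combination of wavelets is the corrected combination of Ξ, with
the same coefficients. -/
theorem sum_smul_wavelet (a : Plane → ℝ) (h𝒯 : IsConforming 𝒯) :
    ∑ x ∈ index locXi 𝒯 Γ, a x • wavelet 𝒯 Γ x = ∑ x ∈ index locXi 𝒯 Γ, a x • globalFn locXi 𝒯 x -
      ∑ y ∈ index locTheta 𝒯 Γ, inner₂ (domain 𝒯) (∑ x ∈ index locXi 𝒯 Γ, a x • globalFn locXi 𝒯 x)
        (globalFn locPhi 𝒯 y) • globalFn locTheta 𝒯 y := by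
  simp only [wavelet, smul_sub, Finset.sum_sub_distrib, Finset.smul_sum, smul_smul]
  rw [Finset.sum_comm]
  congr 1
  refine Finset.sum_congr rfl fun y _ => ?_
  rw [inner₂_sum_left _ _ (fun x _ => continuousOn_globalFn locXi_isAdmissible h𝒯 x)
    (continuousOn_globalFn locPhi_isAdmissible h𝒯 y), Finset.sum_smul]

theorem inner₂_sum_theta_phi (h𝒯 : IsConforming 𝒯) (a : Plane → ℝ) {y : Plane}
    (hy : y ∈ index locTheta 𝒯 Γ) : inner₂ (domain 𝒯)
      (∑ x ∈ index locTheta 𝒯 Γ, a x • globalFn locTheta 𝒯 x) (globalFn locPhi 𝒯 y) = a y := by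
  classical
  rw [inner₂_sum_left _ _ (fun x _ => continuousOn_globalFn locTheta_isAdmissible h𝒯 x)
    (continuousOn_globalFn locPhi_isAdmissible h𝒯 y),
    Finset.sum_congr rfl fun x hx => by rw [inner₂_theta_phi h𝒯 hx]]
  simp [hy]

theorem continuousOn_sum_theta (h𝒯 : IsConforming 𝒯) (a : Plane → ℝ) (s : Finset Plane) :
    ContinuousOn (∑ x ∈ s, a x • globalFn locTheta 𝒯 x) (carrier 𝒯) :=
  continuousOn_sum_smul _ _ fun x _ => continuousOn_globalFn locTheta_isAdmissible h𝒯 x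

theorem continuousOn_wavelet (h𝒯 : IsConforming 𝒯) (x : Plane) :
    ContinuousOn (wavelet 𝒯 Γ x) (carrier 𝒯) :=
  (continuousOn_globalFn locXi_isAdmissible h𝒯 x).sub (continuousOn_sum_theta h𝒯 _ _)

theorem inner₂_wavelet_phi (h𝒯 : IsConforming 𝒯) (x : Plane) {y : Plane}
    (hy : y ∈ index locTheta 𝒯 Γ) :
    inner₂ (domain 𝒯) (wavelet 𝒯 Γ x) (globalFn locPhi 𝒯 y) = 0 := by
  rw [wavelet, inner₂_sub_left (continuousOn_globalFn locXi_isAdmissible h𝒯 x)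
    (continuousOn_sum_theta h𝒯 _ _) (continuousOn_globalFn locPhi_isAdmissible h𝒯 y),
    inner₂_sum_theta_phi h𝒯 _ hy, sub_self]

theorem wavelet_mem (h𝒯 : IsConforming 𝒯) (hΓ : IsFaceUnion 𝒯 Γ) {x : Plane}
    (hx : x ∈ index locXi 𝒯 Γ) : wavelet 𝒯 Γ x ∈ feSubmodule 2 (red 𝒯) Γ := by
  refine Submodule.sub_mem _ ?_ (sum_mem fun y hy => Submodule.smul_mem _ _ ?_)
  · rw [globalFn_locXi h𝒯 hx]
    exact globalFn_locAll_mem h𝒯 hΓ (mem_index.1 hx).2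
  · rw [globalFn_locTheta h𝒯 hy]
    exact globalFn_locAll_mem h𝒯 hΓ (mem_index.1 hy).2

/-- Wavelets are orthogonal to Φ̃ by biorthogonality. Conversely, expand `f` in Θ ∪ Ξ: orthogonality
to Φ̃ forces each Θ-coefficient to be minus the inner product of the Ξ-part with φ̃_y, so `f` is the
combination of wavelets with its own Ξ-coefficients. -/
theorem span_wavelet (h𝒯 : IsConforming 𝒯) (hΓ : IsFaceUnion 𝒯 Γ) {c C c' C' : ℝ}
    (hc : GramBounds locAll c C) (hc' : GramBounds locPhi c' C') :
    (Submodule.span ℝ (range fun x : index locXi 𝒯 Γ => wavelet 𝒯 Γ x) : Set (Plane → ℝ)) =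
      {f ∈ feSpace 2 (red 𝒯) Γ | ∀ g ∈ feSpace 1 (red 𝒯) Γ, inner₂ (domain 𝒯) f g = 0} := by
  classical
  have hA := (isRieszBasis_locAll h𝒯 hΓ hc).1
  have hP := (isRieszBasis_locPhi h𝒯 hΓ hc').1
  ext f
  rw [SetLike.mem_coe, mem_span_finset_iff]
  constructor
  · rintro ⟨a, rfl⟩
    refine ⟨sum_mem (S := feSubmodule 2 (red 𝒯) Γ) fun x hx =>
      Submodule.smul_mem _ _ (wavelet_mem h𝒯 hΓ hx), fun g hg => ?_⟩
    rw [← hP, SetLike.mem_coe, mem_span_finset_iff] at hg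
    obtain ⟨b, rfl⟩ := hg
    have hcw : ∀ x ∈ index locXi 𝒯 Γ, ContinuousOn (wavelet 𝒯 Γ x) (carrier 𝒯) :=
      fun x _ => continuousOn_wavelet h𝒯 x
    have hcp : ∀ x ∈ index locPhi 𝒯 Γ, ContinuousOn (globalFn locPhi 𝒯 x) (carrier 𝒯) :=
      fun x _ => continuousOn_globalFn locPhi_isAdmissible h𝒯 x
    rw [inner₂_sum_left _ _ hcw (continuousOn_sum_smul _ _ hcp)]
    refine Finset.sum_eq_zero fun x hx => ?_
    rw [inner₂_comm, inner₂_sum_left _ _ hcp (hcw x hx), Finset.sum_eq_zero, mul_zero]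
    intro y hy
    rw [inner₂_comm, inner₂_wavelet_phi h𝒯 x hy, mul_zero]
  · rintro ⟨hf, hort⟩
    rw [← hA, SetLike.mem_coe, mem_span_finset_iff] at hf
    obtain ⟨a, rfl⟩ := hf
    refine ⟨a, ?_⟩
    have h1 : ∑ x ∈ index locAll 𝒯 Γ, a x • globalFn locAll 𝒯 x =
        ∑ x ∈ index locTheta 𝒯 Γ, a x • globalFn locTheta 𝒯 x +
          ∑ x ∈ index locXi 𝒯 Γ, a x • globalFn locXi 𝒯 x := by
      have := sum_index_locAll_ite (Γ := Γ) h𝒯 (fun t f => t • f) a a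
      simpa only [ite_self] using this
    rw [h1] at hort ⊢
    rw [sum_smul_wavelet a h𝒯, sub_eq_iff_eq_add, add_right_comm]
    rw [right_eq_add, ← Finset.sum_add_distrib]
    refine Finset.sum_eq_zero fun y hy => ?_
    have h2 := hort (globalFn locPhi 𝒯 y)
      (globalFn_locPhi_mem h𝒯 hΓ (mem_index.1 hy).2)
    rw [inner₂_add_left (continuousOn_sum_theta h𝒯 _ _)
      (continuousOn_sum_globalFn locXi_isAdmissible h𝒯 a)
      (continuousOn_globalFn locPhi_isAdmissible h𝒯 y), inner₂_sum_theta_phi h𝒯 a hy] at h2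
    rw [← add_smul, h2, zero_smul]

theorem inner₂_self_nonneg (Ω : Set Plane) (f : Plane → ℝ) : 0 ≤ inner₂ Ω f f :=
  integral_nonneg fun x => mul_self_nonneg (f x)

/-- With d_y = ⟨f, φ̃_y⟩ and g = Σ d_y φ̃_y, the upper Riesz bound ‖g‖² ≤ C Σ d_y² gives 0 ≤ ‖Cf -
g‖² ≤ C²‖f‖² - C Σ d_y². -/
theorem bessel (h𝒯 : IsConforming 𝒯) {c C : ℝ} (hC : 0 < C) (hc : GramBounds locPhi c C)
    {f : Plane → ℝ} (hf : ContinuousOn f (carrier 𝒯)) :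
    ∑ y ∈ index locTheta 𝒯 Γ, inner₂ (domain 𝒯) f (globalFn locPhi 𝒯 y) ^ 2 ≤
      C * inner₂ (domain 𝒯) f f := by
  set d : Plane → ℝ := fun y => inner₂ (domain 𝒯) f (globalFn locPhi 𝒯 y)
  set g := ∑ y ∈ index locPhi 𝒯 Γ, d y • globalFn locPhi 𝒯 y with hgdef
  have hg : ContinuousOn g (carrier 𝒯) := continuousOn_sum_globalFn locPhi_isAdmissible h𝒯 d
  have h1 : inner₂ (domain 𝒯) g g ≤ C * ∑ y ∈ index locPhi 𝒯 Γ, d y ^ 2 :=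
    (riesz_bounds_of_gram locPhi_isAdmissible h𝒯 hc.2 d).2
  have h2 : inner₂ (domain 𝒯) g f = ∑ y ∈ index locPhi 𝒯 Γ, d y ^ 2 := by
    rw [hgdef, inner₂_sum_left _ _ (fun y _ => continuousOn_globalFn locPhi_isAdmissible h𝒯 y) hf]
    refine Finset.sum_congr rfl fun y _ => ?_
    rw [inner₂_comm, pow_two]
  have h3 := inner₂_self_nonneg (domain 𝒯) (C • f - g)
  have hCf := hf.const_smul C
  rw [inner₂_sub_left hCf hg (hCf.sub hg), inner₂_smul_left, inner₂_comm _ f, inner₂_comm _ g,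
    inner₂_sub_left hCf hg hf, inner₂_sub_left hCf hg hg, inner₂_smul_left, inner₂_smul_left,
    inner₂_comm _ f g, h2] at h3
  change ∑ y ∈ index locPhi 𝒯 Γ, d y ^ 2 ≤ _
  have h4 : C * ∑ y ∈ index locPhi 𝒯 Γ, d y ^ 2 ≤ C * (C * inner₂ (domain 𝒯) f f) := by
    linarith
  exact le_of_mul_le_mul_left h4 hC

/-- In terms of Θ ∪ Ξ, the combination Σ b_x ψ_x has Ξ-coefficients b and Θ-coefficients -d.
Dropping d gives the lower bound; |d|² ≤ C'‖Σ b_x ξ_x‖² ≤ C' C |b|² gives the upper one. -/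
theorem isRieszBasis_wavelet (h𝒯 : IsConforming 𝒯) (hΓ : IsFaceUnion 𝒯 Γ) {c C c' C' : ℝ}
    (hc : GramBounds locAll c C) (hC : 0 ≤ C) (hc' : GramBounds locPhi c' C') (hC' : 0 < C') :
    IsRieszBasis (domain 𝒯) c (C * (1 + C' * C)) (fun x : index locXi 𝒯 Γ => wavelet 𝒯 Γ x)
      {f ∈ feSpace 2 (red 𝒯) Γ | ∀ g ∈ feSpace 1 (red 𝒯) Γ, inner₂ (domain 𝒯) f g = 0} := by
  classical
  refine isRieszBasis_iff.2 ⟨span_wavelet h𝒯 hΓ hc hc', fun b => ?_⟩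
  have hA : ∀ a : Plane → ℝ, _ := riesz_bounds_of_gram (Γ := Γ) locAll_isAdmissible h𝒯 hc.2
  set f := ∑ x ∈ index locXi 𝒯 Γ, b x • globalFn locXi 𝒯 x with hf
  set d : Plane → ℝ := fun y => inner₂ (domain 𝒯) f (globalFn locPhi 𝒯 y) with hd
  have hw : ∑ x ∈ index locXi 𝒯 Γ, b x • wavelet 𝒯 Γ x =
      ∑ y ∈ index locTheta 𝒯 Γ, (-d y) • globalFn locTheta 𝒯 y + f := by
    rw [sum_smul_wavelet b h𝒯]
    simp only [neg_smul, Finset.sum_neg_distrib]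
    rw [neg_add_eq_sub]
  have h1 := hA fun x => if x ∈ index locTheta 𝒯 Γ then -d x else b x
  rw [sum_index_locAll_ite h𝒯 (fun t f => t • f), sum_index_locAll_ite h𝒯 (fun t _ => t ^ 2),
    ← hf, ← hw] at h1
  have h2 := (hA fun x => if x ∈ index locTheta 𝒯 Γ then 0 else b x).2
  rw [sum_index_locAll_ite h𝒯 (fun t f => t • f), sum_index_locAll_ite h𝒯 (fun t _ => t ^ 2),
    ← hf] at h2
  simp only [zero_smul, Finset.sum_const_zero, zero_add, ne_eq, OfNat.ofNat_ne_zero,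
    not_false_eq_true, zero_pow] at h2
  have h3 : ∑ y ∈ index locTheta 𝒯 Γ, d y ^ 2 ≤ C' * inner₂ (domain 𝒯) f f :=
    bessel h𝒯 hC' hc' (continuousOn_sum_globalFn locXi_isAdmissible h𝒯 b)
  simp only [neg_sq] at h1
  constructor
  · refine le_trans (mul_le_mul_of_nonneg_left ?_ hc.1.le) h1.1
    exact le_add_of_nonneg_left (Finset.sum_nonneg fun y _ => sq_nonneg _)
  · refine h1.2.trans ?_
    rw [mul_assoc]
    refine mul_le_mul_of_nonneg_left ?_ hC
    have := mul_le_mul_of_nonneg_left h2 hC'.le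
    linarith

/-! ### The constants -/

theorem exists_gramBounds {ι : Type} [Fintype ι] {S : LocalCollection ι} (hS : S.IsAdmissible) :
    ∃ c C, GramBounds S c C := by
  obtain ⟨c, C, hc, h⟩ := exists_gram_bounds S.fn hS.continuous hS.independent
  exact ⟨c, C, hc, h⟩

theorem GramBounds.le {ι : Type} [Fintype ι] {S : LocalCollection ι} {c C : ℝ}
    (h : GramBounds S c C) (i : ι) : c ≤ C := by
  classical
  have h1 := (h.2 (Pi.single i 1)).1.trans (h.2 (Pi.single i 1)).2
  have h2 : ∑ k, (Pi.single i (1 : ℝ) : ι → ℝ) k ^ 2 = 1 := by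
    rw [Finset.sum_eq_single i]
    · simp
    · intro k _ hk
      simp [hk]
    · simp
  rwa [h2, mul_one, mul_one] at h1

end Wavelets

theorem exists_riesz_constants : ∃ c C : ℝ, 0 < c ∧ c ≤ C ∧ ∀ (𝒯 : Finset Tri) (Γ : Set Plane),
    IsConforming 𝒯 → IsFaceUnion 𝒯 Γ →
      IsRieszBasis (domain 𝒯) c C (fun x : index locN 𝒯 Γ => globalFn locN 𝒯 x) (feSpace 2 𝒯 Γ) ∧
      IsRieszBasis (domain 𝒯) c C (Sum.elim (fun x : index locTheta 𝒯 Γ => globalFn locTheta 𝒯 x)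
        (fun x : index locXi 𝒯 Γ => globalFn locXi 𝒯 x)) (feSpace 2 (red 𝒯) Γ) ∧
      IsRieszBasis (domain 𝒯) c C (fun x : index locTheta 𝒯 Γ => globalFn locPhi 𝒯 x)
        (feSpace 1 (red 𝒯) Γ) ∧
      IsRieszBasis (domain 𝒯) c C (fun x : index locXi 𝒯 Γ => wavelet 𝒯 Γ x)
        {f ∈ feSpace 2 (red 𝒯) Γ | ∀ g ∈ feSpace 1 (red 𝒯) Γ, inner₂ (domain 𝒯) f g = 0} := by
  obtain ⟨c₁, C₁, h₁⟩ := exists_gramBounds locN_isAdmissible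
  obtain ⟨c₂, C₂, h₂⟩ := exists_gramBounds locAll_isAdmissible
  obtain ⟨c₃, C₃, h₃⟩ := exists_gramBounds locPhi_isAdmissible
  have hC₁ := h₁.1.trans_le (h₁.le 0)
  have hC₂ := h₂.1.trans_le (h₂.le 0)
  have hC₃ := h₃.1.trans_le (h₃.le 0)
  have hc₁ := h₁.1
  have hc₂ := h₂.1
  have hc₃ := h₃.1
  have hmul : 0 < C₂ * (1 + C₃ * C₂) := by positivity
  refine ⟨min c₁ (min c₂ c₃), C₁ + C₂ + C₃ + C₂ * (1 + C₃ * C₂), lt_min hc₁ (lt_min hc₂ hc₃),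
    ((min_le_left _ _).trans (h₁.le 0)).trans (by linarith), fun 𝒯 Γ h𝒯 hΓ => ⟨?_, ?_, ?_, ?_⟩⟩
  · exact (isRieszBasis_locN h𝒯 hΓ h₁).mono (min_le_left _ _) (by linarith)
  · exact (isRieszBasis_theta_xi h𝒯 hΓ h₂).mono ((min_le_right _ _).trans (min_le_left _ _))
      (by linarith)
  -- Θ and Φ̃ have the same labels by definition, so their index sets agree definitionally.
  · exact (isRieszBasis_locPhi h𝒯 hΓ h₃).mono ((min_le_right _ _).trans (min_le_right _ _))
      (by linarith)
  · exact (isRieszBasis_wavelet h𝒯 hΓ h₂ hC₂.le h₃ hC₃).mono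
      ((min_le_right _ _).trans (min_le_left _ _)) (by linarith)

/-! ### Supports -/

/-- The points of a triangle whose barycentric coordinates are multiples of `1/4`. -/
abbrev node (T : Tri) (k : Fin 15) : Plane := point T (refNode k)

/-- The index of the midpoint of the edge with the given end points. -/
def midNode (a b : Fin 3) : Fin 15 := low (opposite (-(a + b)))

/-- The indices of the nodes in the interior of the edge with the given end points. -/
def edgeNodes (a b : Fin 3) : Finset (Fin 15) := {midNode a b, edgeNode a b, edgeNode b a}

theorem node_eq_point {T : Tri} {k : Fin 15} {l : Bary} (h : ∀ i, (nodeN k i : ℝ) / 4 = l i) :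
    node T k = point T l := by
  rw [node, show refNode k = l from funext fun i => (refNode_eq k i).trans (h i)]

theorem node_edgeNode (T : Tri) (a b : Fin 3) :
    node T (edgeNode a b) = (3 / 4 : ℝ) • T a + (1 / 4 : ℝ) • T b := by
  have h : ∀ a b i : Fin 3, nodeN (edgeNode a b) i =
      3 * (if i = a then 1 else 0) + if i = b then 1 else 0 := by decide +kernel
  rw [node_eq_point (l := (3 / 4 : ℝ) • Pi.single a 1 + (1 / 4 : ℝ) • Pi.single b 1) fun i => ?_,
    point_add, point_smul, point_smul, point_single, point_single]
  rw [h]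
  push_cast
  simp only [Pi.add_apply, Pi.smul_apply, Pi.single_apply, smul_eq_mul]
  ring

/-- The three indices add up to zero in `Fin 3`, so `-(a + b)` is the third one. -/
theorem node_midNode (T : Tri) {a b : Fin 3} (hab : a ≠ b) :
    node T (midNode a b) = (1 / 2 : ℝ) • T a + (1 / 2 : ℝ) • T b := by
  have h : ∀ a b : Fin 3, a ≠ b → ∀ i : Fin 3, nodeN (midNode a b) i =
      2 * (if i = a then 1 else 0) + 2 * if i = b then 1 else 0 := by decide +kernel
  rw [node_eq_point (l := (1 / 2 : ℝ) • Pi.single a 1 + (1 / 2 : ℝ) • Pi.single b 1) fun i => ?_,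
    point_add, point_smul, point_smul, point_single, point_single]
  rw [h a b hab]
  push_cast
  simp only [Pi.add_apply, Pi.smul_apply, Pi.single_apply, smul_eq_mul]
  ring

theorem node_innerNode (T : Tri) (i : Fin 3) : node T (innerNode i) =
    (1 / 2 : ℝ) • T i + (1 / 4 : ℝ) • T (i + 1) + (1 / 4 : ℝ) • T (i + 2) := by
  have h : ∀ i k : Fin 3, nodeN (innerNode i) k =
      2 * (if k = i then 1 else 0) + (if k = i + 1 then 1 else 0) + if k = i + 2 then 1 else 0 := by
    decide +kernel
  rw [node_eq_point (l := (1 / 2 : ℝ) • Pi.single i 1 + (1 / 4 : ℝ) • Pi.single (i + 1) 1 +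
      (1 / 4 : ℝ) • Pi.single (i + 2) 1) fun k => ?_,
    point_add, point_add, point_smul, point_smul, point_smul, point_single, point_single,
    point_single]
  rw [h]
  push_cast
  simp only [Pi.add_apply, Pi.smul_apply, Pi.single_apply, smul_eq_mul]
  ring

theorem node_corner (T : Tri) (a : Fin 3) : node T (low (corner a)) = T a := by
  rw [node, refNode_corner, point_single]

theorem node_injective {T : Tri} (h : AffineIndependent ℝ T) : Function.Injective (node T) :=
  locAll_isAdmissible.point_node_injective h

theorem node_mem (T : Tri) (k : Fin 15) : node T k ∈ hull T := point_mem_hull T (refNode_mem k)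

theorem bary_node {T : Tri} (h : AffineIndependent ℝ T) (k : Fin 15) :
    bary T (node T k) = refNode k := bary_point h (refNode_mem k).2

/-- The values of a function of `Θ ∪ Ξ`, up to scaling. -/
def coeffAt (𝒯 : Finset Tri) (x z : Plane) : ℝ := globalFn locAll 𝒯 x z / scaling 𝒯 x

/-- The vertices of the second refinement. -/
def nodes (𝒯 : Finset Tri) : Finset Plane := index locAll 𝒯 ∅

/-- The nodes at which a function of `Θ ∪ Ξ` does not vanish. -/
def support (𝒯 : Finset Tri) (x : Plane) : Finset Plane := {z ∈ nodes 𝒯 | coeffAt 𝒯 x z ≠ 0}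

section Supports

variable {𝒯 : Finset Tri} {Γ : Set Plane}

theorem mem_nodes {z : Plane} : z ∈ nodes 𝒯 ↔ ∃ T ∈ 𝒯, ∃ k, node T k = z := by
  rw [nodes, mem_index]
  exact and_iff_left (notMem_empty z)

theorem support_subset (x : Plane) : support 𝒯 x ⊆ nodes 𝒯 := Finset.filter_subset _ _

theorem locAll_fn_refNode (i k : Fin 15) : locAll.fn i (refNode k) = coeffMatrix k i := by
  change ∑ m, coeffMatrix m i * fineNodal m (refNode k) = _
  simp [fineNodal_refNode]

/-- The fine nodal basis makes the value at a node equal to the coefficient there. Supports on the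
mesh thus become zero patterns of columns. -/
theorem coeffAt_node (h𝒯 : IsConforming 𝒯) {T : Tri} (hT : T ∈ 𝒯) (i k : Fin 15) :
    coeffAt 𝒯 (node T i) (node T k) = coeffMatrix k i := by
  have h := locAll_isAdmissible.globalFn_point h𝒯 hT i (node_mem T k)
  rw [bary_node (h𝒯.nondegenerate T hT), locAll_fn_refNode] at h
  rw [coeffAt]
  refine (congrArg (· / _) h).trans ?_
  exact mul_div_cancel_left₀ _ (scaling_sq_mul h𝒯 hT (node_mem T i)).1.ne'

theorem exists_of_coeffAt_ne_zero (h𝒯 : IsConforming 𝒯) {T : Tri} (hT : T ∈ 𝒯) {x z : Plane}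
    (hz : z ∈ hull T) (h : coeffAt 𝒯 x z ≠ 0) : ∃ i, x = node T i := by
  by_contra! hx
  exact h (by rw [coeffAt, locAll_isAdmissible.globalFn_eq_zero h𝒯 hT hz hx, zero_div])

theorem node_mem_support (h𝒯 : IsConforming 𝒯) {T : Tri} (hT : T ∈ 𝒯) {i k : Fin 15} :
    node T k ∈ support 𝒯 (node T i) ↔ coeffZ k i ≠ 0 := by
  rw [support, Finset.mem_filter, coeffAt_node h𝒯 hT, ne_eq, coeffMatrix_eq_zero_iff]
  exact and_iff_right (mem_nodes.2 ⟨T, hT, k, rfl⟩)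

theorem mem_support (h𝒯 : IsConforming 𝒯) {x z : Plane} : z ∈ support 𝒯 x ↔
    ∃ T ∈ 𝒯, ∃ i k, x = node T i ∧ z = node T k ∧ coeffZ k i ≠ 0 := by
  constructor
  · intro h
    obtain ⟨T, hT, k, rfl⟩ := mem_nodes.1 (support_subset x h)
    obtain ⟨i, rfl⟩ := exists_of_coeffAt_ne_zero h𝒯 hT (node_mem T k) (Finset.mem_filter.1 h).2
    exact ⟨T, hT, i, k, rfl, rfl, (node_mem_support h𝒯 hT).1 h⟩
  · rintro ⟨T, hT, i, k, rfl, rfl, h⟩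
    exact (node_mem_support h𝒯 hT).2 h

theorem exists_of_mem_support (h𝒯 : IsConforming 𝒯) {T : Tri} (hT : T ∈ 𝒯) {x : Plane} {k : Fin 15}
    (h : node T k ∈ support 𝒯 x) : ∃ i, x = node T i ∧ coeffZ k i ≠ 0 := by
  obtain ⟨i, rfl⟩ := exists_of_coeffAt_ne_zero h𝒯 hT (node_mem T k) (Finset.mem_filter.1 h).2
  exact ⟨i, rfl, (node_mem_support h𝒯 hT).1 h⟩

theorem IsConforming.vertex_mem (h𝒯 : IsConforming 𝒯) {T T' : Tri} (hT : T ∈ 𝒯) (hT' : T' ∈ 𝒯)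
    {i : Fin 15} (hx : node T i ∈ hull T') {a : Fin 3} (ha : nodeN i a ≠ 0) : ∃ a', T' a' = T a := by
  refine h𝒯.vertex_mem_range hT hT' (node_mem T i) hx ?_
  rw [bary_node (h𝒯.nondegenerate T hT), ne_eq, refNode_eq_zero_iff]
  exact ha

theorem IsConforming.vertex_mem_of_mem (h𝒯 : IsConforming 𝒯) {T T' : Tri} (hT : T ∈ 𝒯)
    (hT' : T' ∈ 𝒯) {a : Fin 3} (hx : T a ∈ hull T') : ∃ a', T' a' = T a := by
  have h : ∀ a, nodeN (low (corner a)) a ≠ 0 := by decide +kernel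
  exact h𝒯.vertex_mem hT hT' (i := low (corner a)) (by rwa [node_corner]) (h a)

/-- An inner node has weight at all three vertices, so another triangle containing it would have the
same vertices. -/
theorem IsConforming.eq_of_node_innerNode_mem (h𝒯 : IsConforming 𝒯) {T T' : Tri} (hT : T ∈ 𝒯)
    (hT' : T' ∈ 𝒯) {c : Fin 3} (hx : node T (innerNode c) ∈ hull T') : T' = T := by
  have h : ∀ c a, nodeN (innerNode c) a ≠ 0 := by decide +kernel
  obtain ⟨π, hπ, -⟩ := h𝒯.exists_matching hT hT'
  have h1 : T = T' ∘ π := funext fun k => by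
    obtain ⟨a, ha⟩ := h𝒯.vertex_mem hT hT' hx (h c k)
    exact hπ k ⟨a, ha⟩
  by_contra hne
  refine h𝒯.distinct T' hT' T hT hne ?_
  rw [h1, EquivLike.range_comp]

theorem IsConforming.exists_edge (h𝒯 : IsConforming 𝒯) {T T' : Tri} (hT : T ∈ 𝒯) (hT' : T' ∈ 𝒯)
    {a b : Fin 3} (hab : a ≠ b) {i : Fin 15} (hi : i ∈ edgeNodes a b) (hx : node T i ∈ hull T') :
    ∃ a' b', a' ≠ b' ∧ T' a' = T a ∧ T' b' = T b := by
  have h : ∀ a b, a ≠ b → ∀ i ∈ edgeNodes a b, nodeN i a ≠ 0 ∧ nodeN i b ≠ 0 := by decide +kernel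
  obtain ⟨h1, h2⟩ := h a b hab i hi
  obtain ⟨a', ha'⟩ := h𝒯.vertex_mem hT hT' hx h1
  obtain ⟨b', hb'⟩ := h𝒯.vertex_mem hT hT' hx h2
  refine ⟨a', b', ?_, ha', hb'⟩
  rintro rfl
  exact hab ((h𝒯.nondegenerate T hT).injective (ha'.symm.trans hb'))

theorem mem_edgeNodes {a b : Fin 3} {i : Fin 15} :
    i ∈ edgeNodes a b ↔ i = midNode a b ∨ i = edgeNode a b ∨ i = edgeNode b a := by
  simp [edgeNodes]

theorem exists_mem_edgeNodes {T T' : Tri} {a b a' b' : Fin 3} (hab : a ≠ b) (hab' : a' ≠ b')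
    (ha : T' a' = T a) (hb : T' b' = T b) {i : Fin 15} (hi : i ∈ edgeNodes a b) :
    ∃ i' ∈ edgeNodes a' b', node T i = node T' i' := by
  obtain rfl | rfl | rfl := mem_edgeNodes.1 hi
  · exact ⟨_, mem_edgeNodes.2 (Or.inl rfl), by rw [node_midNode T hab, node_midNode T' hab', ha, hb]⟩
  · exact ⟨_, mem_edgeNodes.2 (Or.inr (Or.inl rfl)), by rw [node_edgeNode, node_edgeNode, ha, hb]⟩
  · exact ⟨_, mem_edgeNodes.2 (Or.inr (Or.inr rfl)), by rw [node_edgeNode, node_edgeNode, ha, hb]⟩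

/-- The θ at the midpoint of an edge and the two ξ on that edge have the same zero pattern, so one
count serves for all of them. -/
theorem coeffZ_edge : ∀ a b, a ≠ b → ∀ i ∈ edgeNodes a b, ∀ k, coeffZ k i ≠ 0 ↔
    k ∈ edgeNodes a b ∨ k = innerNode a ∨ k = innerNode b := by
  decide +kernel

theorem coeffZ_corner : ∀ a k, coeffZ k (low (corner a)) ≠ 0 ↔
    k = low (corner a) ∨ ∃ b, a ≠ b ∧ k = edgeNode a b := by
  decide +kernel

theorem coeffZ_innerNode : ∀ c k, coeffZ k (innerNode c) ≠ 0 ↔ ∃ d, k = innerNode d := by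
  decide +kernel

theorem innerNode_injective : Function.Injective innerNode := by
  decide +kernel

/-- Three nodes in the interior of the edge, shared by all triangles at it, and two inner nodes in
each of these triangles; inner nodes of different triangles are different. -/
theorem card_support_edge (h𝒯 : IsConforming 𝒯) {T : Tri} (hT : T ∈ 𝒯) {a b : Fin 3} (hab : a ≠ b)
    {i : Fin 15} (hi : i ∈ edgeNodes a b) :
    (support 𝒯 (node T i)).card = 3 + 2 * (star 𝒯 (node T i)).card := by
  classical
  have hTa := h𝒯.nondegenerate T hT
  have hnot : ∀ a b, a ≠ b → ∀ i ∈ edgeNodes a b, ∀ c, innerNode c ≠ i := by decide +kernel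
  have hcard : ∀ a b, a ≠ b → (edgeNodes a b).card = 3 := by decide +kernel
  let B : Tri → Finset Plane := fun T' =>
    {z ∈ Finset.univ.image fun c => node T' (innerNode c) | z ∈ support 𝒯 (node T i)}
  have hB : ∀ T' ∈ star 𝒯 (node T i), (B T').card = 2 := by
    intro T' hT'
    obtain ⟨hT', hx⟩ := mem_star.1 hT'
    have hTa' := h𝒯.nondegenerate T' hT'
    obtain ⟨a', b', hab', ha', hb'⟩ := h𝒯.exists_edge hT hT' hab hi hx
    obtain ⟨i', hi', h⟩ := exists_mem_edgeNodes hab hab' ha' hb' hi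
    have : B T' = {node T' (innerNode a'), node T' (innerNode b')} := by
      ext z
      simp only [B, Finset.mem_filter, Finset.mem_image, Finset.mem_univ, true_and,
        Finset.mem_insert, Finset.mem_singleton]
      rw [h]
      constructor
      · rintro ⟨⟨c, rfl⟩, hc⟩
        rw [node_mem_support h𝒯 hT', coeffZ_edge a' b' hab' i' hi'] at hc
        rcases hc with hc | hc | hc
        · exact absurd rfl (hnot a' b' hab' _ hc c)
        · exact Or.inl (by rw [hc])
        · exact Or.inr (by rw [hc])
      · rintro (rfl | rfl)
        · exact ⟨⟨a', rfl⟩, (node_mem_support h𝒯 hT').2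
            ((coeffZ_edge a' b' hab' i' hi' _).2 (Or.inr (Or.inl rfl)))⟩
        · exact ⟨⟨b', rfl⟩, (node_mem_support h𝒯 hT').2
            ((coeffZ_edge a' b' hab' i' hi' _).2 (Or.inr (Or.inr rfl)))⟩
    rw [this, Finset.card_pair]
    exact fun h => hab' (innerNode_injective (node_injective hTa' h))
  have hdisj : ∀ S ∈ star 𝒯 (node T i), ∀ S' ∈ star 𝒯 (node T i), S ≠ S' →
      Disjoint (B S) (B S') := by
    intro S hS S' hS' hne
    rw [Finset.disjoint_left]
    intro z hz hz'
    simp only [B, Finset.mem_filter, Finset.mem_image, Finset.mem_univ, true_and] at hz hz'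
    obtain ⟨⟨c, rfl⟩, -⟩ := hz
    obtain ⟨⟨d, hd⟩, -⟩ := hz'
    exact hne (h𝒯.eq_of_node_innerNode_mem (mem_star.1 hS).1 (mem_star.1 hS').1
      (hd ▸ node_mem S' _)).symm
  have hunion : support 𝒯 (node T i) =
      (edgeNodes a b).image (node T) ∪ (star 𝒯 (node T i)).biUnion B := by
    ext z
    rw [Finset.mem_union, Finset.mem_image, Finset.mem_biUnion]
    constructor
    · intro hz
      obtain ⟨T', hT', i', k', hx, rfl, h⟩ := (mem_support h𝒯).1 hz
      obtain ⟨a', b', hab', ha', hb'⟩ := h𝒯.exists_edge hT hT' hab hi (hx ▸ node_mem T' i')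
      obtain ⟨i'', hi'', h'⟩ := exists_mem_edgeNodes hab hab' ha' hb' hi
      obtain rfl : i' = i'' := node_injective (h𝒯.nondegenerate T' hT') (hx.symm.trans h')
      have hin : ∀ c, k' = innerNode c → ∃ S ∈ star 𝒯 (node T i), node T' k' ∈ B S := by
        rintro c rfl
        refine ⟨T', mem_star.2 ⟨hT', hx ▸ node_mem T' i'⟩, ?_⟩
        simp only [B, Finset.mem_filter, Finset.mem_image, Finset.mem_univ, true_and]
        exact ⟨⟨c, rfl⟩, hz⟩
      rcases (coeffZ_edge a' b' hab' i' hi'' k').1 h with hk | hk | hk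
      · obtain ⟨k, hk, hk'⟩ := exists_mem_edgeNodes hab' hab ha'.symm hb'.symm hk
        exact Or.inl ⟨k, hk, hk'.symm⟩
      · exact Or.inr (hin _ hk)
      · exact Or.inr (hin _ hk)
    · rintro (⟨k, hk, rfl⟩ | ⟨S, -, hz⟩)
      · exact (node_mem_support h𝒯 hT).2 ((coeffZ_edge a b hab i hi k).2 (Or.inl hk))
      · exact (Finset.mem_filter.1 hz).2
  rw [hunion, Finset.card_union_of_disjoint, Finset.card_biUnion hdisj, Finset.sum_congr rfl hB,
    Finset.card_image_of_injective _ (node_injective hTa), hcard a b hab, Finset.sum_const,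
    smul_eq_mul, mul_comm]
  rw [Finset.disjoint_left]
  intro z hz hz'
  obtain ⟨k, hk, rfl⟩ := Finset.mem_image.1 hz
  obtain ⟨S, hS, hz'⟩ := Finset.mem_biUnion.1 hz'
  simp only [B, Finset.mem_filter, Finset.mem_image, Finset.mem_univ, true_and] at hz'
  obtain ⟨⟨c, hc⟩, -⟩ := hz'
  obtain rfl := h𝒯.eq_of_node_innerNode_mem (mem_star.1 hS).1 hT (hc ▸ node_mem T k)
  exact hnot a b hab k hk c (node_injective hTa hc)

/-- Besides the vertex, the support has one node on each edge that emanates from it, at a quarter of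
its length; this is an injective image of the set of neighbours. -/
theorem card_support_vertex (h𝒯 : IsConforming 𝒯) {T : Tri} (hT : T ∈ 𝒯) (a : Fin 3) :
    (support 𝒯 (T a)).card = 1 + valence 𝒯 (T a) := by
  let N : Set Plane := {z | ∃ T' ∈ 𝒯, ∃ i k : Fin 3, i ≠ k ∧ T' i = T a ∧ T' k = z}
  have hN : N.Finite := by
    refine (𝒯.finite_toSet.biUnion fun T' _ => finite_range T').subset ?_
    rintro z ⟨T', hT', i, k, -, -, rfl⟩
    exact mem_biUnion hT' (mem_range_self k)
  let f : Plane → Plane := fun z => (3 / 4 : ℝ) • T a + (1 / 4 : ℝ) • z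
  have hf : Function.Injective f := fun z z' h =>
    smul_right_injective _ (by norm_num : (1 / 4 : ℝ) ≠ 0) (add_left_cancel h)
  have hnotMem : T a ∉ f '' N := by
    rintro ⟨z, ⟨T', hT', i, k, hik, hi, rfl⟩, h⟩
    have h1 : f (T a) = T a := by
      simp only [f]
      rw [← add_smul]
      norm_num
    rw [← h1, ← hi] at h
    exact hik ((h𝒯.nondegenerate T' hT').injective (hf h)).symm
  have hs : (support 𝒯 (T a) : Set Plane) = insert (T a) (f '' N) := by
    ext z
    rw [SetLike.mem_coe, mem_support h𝒯, mem_insert_iff]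
    constructor
    · rintro ⟨T', hT', i, k, hx, rfl, h⟩
      obtain ⟨a', ha'⟩ := h𝒯.vertex_mem_of_mem hT hT' (hx ▸ node_mem T' i)
      rw [← ha', ← node_corner T' a'] at hx
      obtain rfl := node_injective (h𝒯.nondegenerate T' hT') hx
      obtain rfl | ⟨b, hb, rfl⟩ := (coeffZ_corner a' k).1 h
      · exact Or.inl (by rw [node_corner, ha'])
      · refine Or.inr ⟨T' b, ⟨T', hT', a', b, hb, ha', rfl⟩, ?_⟩
        rw [node_edgeNode, ha']
    · rintro (rfl | ⟨_, ⟨T', hT', a', b, hab, ha', rfl⟩, rfl⟩)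
      · refine ⟨T, hT, low (corner a), low (corner a), (node_corner T a).symm,
          (node_corner T a).symm, (coeffZ_corner a _).2 (Or.inl rfl)⟩
      · refine ⟨T', hT', low (corner a'), edgeNode a' b, ?_, ?_,
          (coeffZ_corner a' _).2 (Or.inr ⟨b, hab, rfl⟩)⟩
        · rw [node_corner, ha']
        · rw [node_edgeNode, ha']
  rw [← ncard_coe_finset, hs, ncard_insert_of_notMem hnotMem (hN.image f),
    ncard_image_of_injective _ hf, add_comm]
  rfl

theorem support_innerNode (h𝒯 : IsConforming 𝒯) {T : Tri} (hT : T ∈ 𝒯) (c : Fin 3) :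
    support 𝒯 (node T (innerNode c)) =
      Finset.univ.map ⟨_, (node_injective (h𝒯.nondegenerate T hT)).comp innerNode_injective⟩ := by
  ext z
  simp only [Finset.mem_map, Finset.mem_univ, true_and, Function.Embedding.coeFn_mk,
    Function.comp_apply]
  rw [mem_support h𝒯]
  constructor
  · rintro ⟨T', hT', i, k, hx, rfl, h⟩
    obtain rfl := h𝒯.eq_of_node_innerNode_mem hT hT' (hx ▸ node_mem T' i)
    obtain rfl := node_injective (h𝒯.nondegenerate T' hT') hx
    obtain ⟨d, rfl⟩ := (coeffZ_innerNode c k).1 h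
    exact ⟨d, rfl⟩
  · rintro ⟨d, rfl⟩
    exact ⟨T, hT, _, _, rfl, rfl, (coeffZ_innerNode c _).2 ⟨d, rfl⟩⟩

end Supports

/-! ### Values of wavelets at nodes -/

section Values

variable {𝒯 : Finset Tri} {Γ : Set Plane}

/-- The local value `w` is the same in every triangle at x, so the inner product is w s_x s_y times
the area of the star of x, which is s_x⁻². The last hypothesis excludes triangles at x without y,
unless w is zero. -/
theorem inner₂_xi_phi (h𝒯 : IsConforming 𝒯) {x y : Plane} (hx : x ∈ index locXi 𝒯 Γ)
    (hy : y ∈ index locTheta 𝒯 Γ) {w : ℝ}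
    (hw : ∀ T ∈ 𝒯, ∀ i k, x = node T (high i) → y = node T (low k) →
      (crossGram (high i) k : ℝ) = w)
    (hw0 : ∀ T ∈ 𝒯, x ∈ hull T → y ∉ hull T → w = 0) :
    inner₂ (domain 𝒯) (globalFn locXi 𝒯 x) (globalFn locPhi 𝒯 y) =
      w * (scaling 𝒯 y / scaling 𝒯 x) := by
  classical
  rw [inner₂_globalFn locXi_isAdmissible locPhi_isAdmissible h𝒯]
  have h : ∀ T ∈ 𝒯, (∑ i, ∑ k, if x = point T (locXi.node i) ∧ y = point T (locPhi.node k) then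
      nInner (locXi.fn i) (locPhi.fn k) else 0) = if x ∈ hull T then w else 0 := by
    intro T hT
    have ha := h𝒯.nondegenerate T hT
    have hzero : (∀ i k, ¬ (x = point T (locXi.node i) ∧ y = point T (locPhi.node k))) →
        (∑ i, ∑ k, if x = point T (locXi.node i) ∧ y = point T (locPhi.node k) then
          nInner (locXi.fn i) (locPhi.fn k) else 0) = 0 := fun h =>
      Finset.sum_eq_zero fun i _ => Finset.sum_eq_zero fun k _ => if_neg (h i k)
    split_ifs with hxT
    · by_cases hyT : y ∈ hull T
      · obtain ⟨i, hi⟩ := locXi_isAdmissible.exists_label_of_mem_index h𝒯 hx hT hxT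
        obtain ⟨k, hk⟩ := locTheta_isAdmissible.exists_label_of_mem_index h𝒯 hy hT hyT
        rw [Finset.sum_eq_single i, Finset.sum_eq_single k, if_pos ⟨hi, hk⟩]
        · exact (nInner_locAll_locPhi (high i) k).trans (hw T hT i k hi hk)
        · exact fun k' _ hk' => if_neg fun h =>
            hk' (locPhi_isAdmissible.point_node_injective ha (h.2.symm.trans hk))
        · simp
        · exact fun i' _ hi' => Finset.sum_eq_zero fun k' _ => if_neg fun h =>
            hi' (locXi_isAdmissible.point_node_injective ha (h.1.symm.trans hi))
        · simp
      · rw [hw0 T hT hxT hyT]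
        exact hzero fun i k h => hyT (h.2 ▸ locPhi_isAdmissible.point_node_mem T k)
    · exact hzero fun i k h => hxT (h.1 ▸ locXi_isAdmissible.point_node_mem T i)
  rw [Finset.sum_congr rfl fun T hT => by rw [h T hT]]
  obtain ⟨⟨T, hT, i, hi⟩, -⟩ := mem_index.1 hx
  obtain ⟨h1, h2⟩ := scaling_sq_mul h𝒯 hT (hi ▸ locXi_isAdmissible.point_node_mem T i)
  rw [star, Finset.sum_filter] at h2
  simp only [mul_ite, mul_zero]
  have h3 : (∑ T ∈ 𝒯, if x ∈ hull T then vol T * w else 0) =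
      (∑ T ∈ 𝒯, if x ∈ hull T then vol T else 0) * w := by
    rw [Finset.sum_mul]
    exact Finset.sum_congr rfl fun T _ => by split_ifs <;> simp
  rw [h3, ← mul_div_assoc, eq_div_iff h1.ne']
  linear_combination w * scaling 𝒯 y * h2

/-- One factor s_y / s_x comes from the inner product, the other from the scaling of θ_y relative to
that of ξ_x. -/
theorem wavelet_apply (h𝒯 : IsConforming 𝒯) {x : Plane} (hx : x ∈ index locXi 𝒯 Γ) (w : Plane → ℝ)
    (hw : ∀ T ∈ 𝒯, ∀ i k, x = node T (high i) →
      (crossGram (high i) k : ℝ) = w (node T (low k)))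
    (hw0 : ∀ T ∈ 𝒯, x ∈ hull T → ∀ y ∉ hull T, w y = 0) (z : Plane) :
    wavelet 𝒯 Γ x z = scaling 𝒯 x * (coeffAt 𝒯 x z - ∑ y ∈ index locTheta 𝒯 Γ,
      w y * ((scaling 𝒯 y / scaling 𝒯 x) ^ 2 * coeffAt 𝒯 y z)) := by
  have hpos : ∀ y ∈ index locAll 𝒯 Γ, scaling 𝒯 y ≠ 0 := fun y hy => by
    obtain ⟨⟨T, hT, i, rfl⟩, -⟩ := mem_index.1 hy
    exact (scaling_sq_mul h𝒯 hT (node_mem T i)).1.ne'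
  have hx0 := hpos x ((index_locAll _ _ _).2 (Or.inr hx))
  have hval : ∀ y ∈ index locAll 𝒯 Γ, globalFn locAll 𝒯 y z = scaling 𝒯 y * coeffAt 𝒯 y z :=
    fun y hy => (mul_div_cancel₀ _ (hpos y hy)).symm
  rw [wavelet, Pi.sub_apply, Finset.sum_apply, globalFn_locXi h𝒯 hx,
    hval x ((index_locAll _ _ _).2 (Or.inr hx)), mul_sub, Finset.mul_sum]
  congr 1
  refine Finset.sum_congr rfl fun y hy => ?_
  rw [← globalFn_locXi h𝒯 hx, inner₂_xi_phi h𝒯 hx hy (w := w y)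
    (fun T hT i k hxi hyk => by rw [hw T hT i k hxi, hyk])
    (fun T hT hxT hyT => hw0 T hT hxT y hyT), Pi.smul_apply, smul_eq_mul, globalFn_locTheta h𝒯 hy,
    hval y ((index_locAll _ _ _).2 (Or.inl hy))]
  field_simp

/-- The squared ratio is the area of the star of x over that of y, and the first star is contained
in the second. -/
theorem scaling_div_sq_le (h𝒯 : IsConforming 𝒯) {T : Tri} (hT : T ∈ 𝒯) {x y : Plane}
    (hx : x ∈ hull T) (hy : y ∈ hull T) (h : ∀ T' ∈ 𝒯, x ∈ hull T' → y ∈ hull T') :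
    0 < (scaling 𝒯 y / scaling 𝒯 x) ^ 2 ∧ (scaling 𝒯 y / scaling 𝒯 x) ^ 2 ≤ 1 := by
  obtain ⟨h1, h2⟩ := scaling_sq_mul h𝒯 hT hx
  obtain ⟨h3, h4⟩ := scaling_sq_mul h𝒯 hT hy
  have hle : ∑ T' ∈ star 𝒯 x, vol T' ≤ ∑ T' ∈ star 𝒯 y, vol T' := by
    refine Finset.sum_le_sum_of_subset_of_nonneg (fun T' hT' => ?_)
      fun T' hT' _ => (vol_pos (h𝒯.nondegenerate T' (mem_star.1 hT').1)).le
    obtain ⟨hT', hx'⟩ := mem_star.1 hT'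
    exact mem_star.2 ⟨hT', h T' hT' hx'⟩
  refine ⟨by positivity, ?_⟩
  rw [div_pow, div_le_one (by positivity)]
  have h5 := mul_le_mul_of_nonneg_left hle (by positivity : 0 ≤ scaling 𝒯 x ^ 2 * scaling 𝒯 y ^ 2)
  nlinarith

theorem locN_globalFn_apply (h𝒯 : IsConforming 𝒯) {x z : Plane} (hz : z ∈ index locN 𝒯 Γ) :
    globalFn locN 𝒯 x z ≠ 0 ↔ x = z := by
  obtain ⟨⟨T, hT, i, rfl⟩, -⟩ := mem_index.1 hz
  have hTa := h𝒯.nondegenerate T hT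
  have hmem := locN_isAdmissible.point_node_mem T i
  by_cases hx : ∃ k, x = point T (locN.node k)
  · obtain ⟨k, rfl⟩ := hx
    rw [locN_isAdmissible.globalFn_point h𝒯 hT k hmem, locN_isAdmissible.bary_node hTa]
    have h : locN.fn k (locN.node i) = if k = i then 1 else 0 := quadNodal_refNode k i
    rw [h, (locN_isAdmissible.point_node_injective hTa).eq_iff]
    have := (scaling_sq_mul h𝒯 hT (locN_isAdmissible.point_node_mem T k)).1.ne'
    by_cases hki : k = i
    · simpa [hki] using hki ▸ this
    · simp [hki]
  · push Not at hx
    rw [locN_isAdmissible.globalFn_eq_zero h𝒯 hT hmem hx]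
    simp [hx i]

/-- At a node only its own nodal function is non-zero, so the coefficient vanishes exactly when the
value of `f` does. -/
theorem isCombination (h𝒯 : IsConforming 𝒯) (hΓ : IsFaceUnion 𝒯 Γ) {f : Plane → ℝ}
    (hf : f ∈ feSpace 2 𝒯 Γ) :
    (∃ a : Plane → ℝ, f = ∑ z ∈ index locN 𝒯 Γ, a z • globalFn locN 𝒯 z) ∧
    ∀ a : Plane → ℝ, f = ∑ z ∈ index locN 𝒯 Γ, a z • globalFn locN 𝒯 z →
      {z ∈ (index locN 𝒯 Γ : Set Plane) | a z ≠ 0} =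
        {z ∈ (index locN 𝒯 Γ : Set Plane) | f z ≠ 0} := by
  obtain ⟨c, C, hc⟩ := exists_gramBounds locN_isAdmissible
  constructor
  · rw [← (isRieszBasis_locN h𝒯 hΓ hc).1, SetLike.mem_coe, mem_span_finset_iff] at hf
    obtain ⟨a, ha⟩ := hf
    exact ⟨a, ha.symm⟩
  · rintro a rfl
    ext z
    refine and_congr_right fun hz => ?_
    rw [Finset.sum_apply, Finset.sum_eq_single z, Pi.smul_apply, smul_eq_mul, mul_ne_zero_iff,
      locN_globalFn_apply h𝒯 hz]
    · simp
    · intro x _ hxz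
      rw [Pi.smul_apply, smul_eq_mul, mul_eq_zero]
      exact Or.inr (not_not.1 fun h => hxz ((locN_globalFn_apply h𝒯 hz).1 h))
    · exact fun h => absurd hz h

/-- Reduces the count to finding the nodes at which the wavelet is non-zero. Nodes on Γ need no
separate treatment, since the wavelet vanishes there. -/
theorem isCombinationOf_psi (h𝒯 : IsConforming 𝒯) (hΓ : IsDirichletPart 𝒯 Γ) (j : ℕ) {x : Plane}
    (hx : x ∈ index locXi (level 𝒯 j) Γ) (F : Finset Plane) (hF : F ⊆ nodes (level 𝒯 j))
    (h : ∀ z ∈ nodes (level 𝒯 j), wavelet (level 𝒯 j) Γ x z ≠ 0 ↔ z ∈ F) :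
    IsCombinationOf 𝒯 Γ (j + 1) (psi 𝒯 Γ j x) F.card := by
  have h𝒯' := h𝒯.level j
  have hΓ' := hΓ.level h𝒯 j
  have hmem := wavelet_mem h𝒯' hΓ' hx
  obtain ⟨h1, h2⟩ := isCombination h𝒯'.red (hΓ'.red h𝒯') hmem
  rw [psi_eq_wavelet, IsCombinationOf, idxN, nodal, level_succ]
  refine ⟨h1, fun a ha => ?_⟩
  rw [h2 a ha, ← ncard_coe_finset, index_locN_red]
  congr 1
  ext z
  rw [mem_ofPred_eq, SetLike.mem_coe, SetLike.mem_coe]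
  constructor
  · rintro ⟨hz, hz'⟩
    obtain ⟨T, hT, k, hk⟩ := (mem_index.1 hz).1
    exact (h z (mem_nodes.2 ⟨T, hT, k, hk⟩)).1 hz'
  · intro hz
    have hz' := (h z (hF hz)).2 hz
    obtain ⟨T, hT, k, hk⟩ := mem_nodes.1 (hF hz)
    exact ⟨mem_index.2 ⟨⟨T, hT, k, hk⟩, fun hzΓ => hz' (hmem.2.2.1 z hzΓ)⟩, hz'⟩

/-- An interior point of a triangle is not in `Γ`. -/
theorem node_innerNode_notMem (h𝒯 : IsConforming 𝒯) (hΓ : Γ ⊆ frontier (domain 𝒯)) {T : Tri}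
    (hT : T ∈ 𝒯) (c : Fin 3) : node T (innerNode c) ∉ Γ := by
  intro h
  have hTa := h𝒯.nondegenerate T hT
  have hpos : ∀ c i, 0 < nodeN (innerNode c) i := by decide +kernel
  have h1 : node T (innerNode c) ∈ domain 𝒯 := by
    refine mem_interior.2 ⟨{y | ∀ i, 0 < bary T y i}, fun y hy => ?_, ?_, fun i => ?_⟩
    · exact hull_subset_carrier hT ((mem_hull hTa).2 ⟨fun i => (hy i).le, bary_sum hTa y⟩)
    · simp only [ofPred_forall]
      exact isOpen_iInter_of_finite fun i =>
        isOpen_lt continuous_const ((continuous_apply i).comp (continuous_bary T))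
    · rw [bary_node hTa, refNode_eq]
      have := hpos c i
      positivity
  have h2 := hΓ h
  rw [domain, isOpen_interior.frontier_eq] at h2
  exact h2.2 h1

end Values

/-! ### The number of nodal functions in a wavelet -/

theorem crossGram_edgeNode : ∀ a b, a ≠ b → ∀ k, crossGram (edgeNode a b) k =
    if k = corner a then 3 / 100 else 0 := by
  decide +kernel

theorem crossGram_innerNode : ∀ c k, crossGram (innerNode c) k =
    if k = corner c then -1 / 48 else if k = opposite c then 27 / 240 else 0 := by
  decide +kernel

theorem midNode_add (c : Fin 3) : midNode (c + 1) (c + 2) = low (opposite c) := by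
  revert c
  decide +kernel

section Count

variable {𝒯 : Finset Tri} {Γ : Set Plane}

theorem mem_support_iff {x z : Plane} (hz : z ∈ nodes 𝒯) : z ∈ support 𝒯 x ↔ coeffAt 𝒯 x z ≠ 0 := by
  rw [support, Finset.mem_filter]
  exact and_iff_right hz

theorem coeffAt_eq_zero {x z : Plane} (hz : z ∈ nodes 𝒯) (h : z ∉ support 𝒯 x) :
    coeffAt 𝒯 x z = 0 :=
  not_not.1 fun h' => h ((mem_support_iff hz).2 h')

theorem coeffMatrix_of_coeffZ {k i : Fin 15} {n : ℤ} (h : coeffZ k i = n) :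
    coeffMatrix k i = n / 8100 := by
  rw [coeffMatrix_apply, h, mul_comm, div_eq_mul_inv]

theorem node_mem_index_locTheta {T : Tri} (hT : T ∈ 𝒯) (k : Fin 6) :
    node T (low k) ∈ index locTheta 𝒯 Γ ↔ node T (low k) ∉ Γ :=
  mem_index.trans (and_iff_right ⟨T, hT, k, rfl⟩)

open Classical in
-- The only correction is by θ at `T a`, with weight 3/100, and it is absent if this vertex is in Γ.
-- The supports, of sizes 3 + 2n and 1 + v, meet in x alone; with ρ ≤ 1 the ratio of the star areas,
-- the value there is proportional to 1 - (3/100) · 6ρ > 0. So the union has 3 + 2n + v nodes.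
theorem isCombinationOf_edge (h𝒯 : IsConforming 𝒯) (hΓ : IsDirichletPart 𝒯 Γ) (j : ℕ) {T : Tri}
    (hT : T ∈ level 𝒯 j) {a b : Fin 3} (hab : a ≠ b) (hxΓ : node T (edgeNode a b) ∉ Γ) :
    IsCombinationOf 𝒯 Γ (j + 1) (psi 𝒯 Γ j (node T (edgeNode a b)))
      (3 + 2 * (star (level 𝒯 j) (node T (edgeNode a b))).card +
        if T a ∈ Γ then 0 else valence (level 𝒯 j) (T a)) := by
  have h𝒮 := h𝒯.level j
  set 𝒮 := level 𝒯 j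
  have he : edgeNode a b ∈ edgeNodes a b := mem_edgeNodes.2 (Or.inr (Or.inl rfl))
  have hx : node T (edgeNode a b) ∈ index locXi 𝒮 Γ := by
    have h : ∀ a b, a ≠ b → ∃ i, edgeNode a b = high i := by decide +kernel
    obtain ⟨i, hi⟩ := h a b hab
    exact mem_index.2 ⟨⟨T, hT, i, by rw [hi]; rfl⟩, hxΓ⟩
  have hcard := card_support_edge h𝒮 hT hab he
  have hy : T a ∈ index locTheta 𝒮 Γ ↔ T a ∉ Γ := by
    have := node_mem_index_locTheta (Γ := Γ) hT (corner a)
    rwa [node_corner] at this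
  have hloc : ∀ T' ∈ 𝒮, node T (edgeNode a b) ∈ hull T' → ∃ a' b', a' ≠ b' ∧
      T' a' = T a ∧ node T (edgeNode a b) = node T' (edgeNode a' b') := by
    intro T' hT' hxT'
    obtain ⟨a', b', hab', ha', hb'⟩ := h𝒮.exists_edge hT hT' hab he hxT'
    exact ⟨a', b', hab', ha', by rw [node_edgeNode, node_edgeNode, ha', hb']⟩
  generalize node T (edgeNode a b) = x at *
  have hwav := wavelet_apply (Γ := Γ) h𝒮 hx (fun y => if y = T a then 3 / 100 else 0) ?_ ?_
  rotate_left
  · intro T' hT' i k hi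
    obtain ⟨a', b', hab', ha', hx'⟩ := hloc T' hT' (hi ▸ node_mem T' _)
    have hinj := node_injective (h𝒮.nondegenerate T' hT')
    have hk : node T' (low k) = T a ↔ k = corner a' := by
      rw [← ha', ← node_corner T' a', hinj.eq_iff, low_injective.eq_iff]
    rw [hinj (hi.symm.trans hx'), crossGram_edgeNode a' b' hab']
    simp only [hk]
    split_ifs <;> norm_num
  · intro T' hT' hxT' y hy
    obtain ⟨a', -, -, ha', -⟩ := hloc T' hT' hxT'
    refine if_neg fun h => hy ?_
    rw [h, ← ha']
    exact vertex_mem_hull T' a'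
  simp only [ite_mul, zero_mul, Finset.sum_ite_eq', hy] at hwav
  obtain ⟨⟨T₀, hT₀, i₀, hi₀⟩, -⟩ := mem_index.1 hx
  have hxT₀ : x ∈ hull T₀ := hi₀ ▸ locXi_isAdmissible.point_node_mem T₀ i₀
  have hs := (scaling_sq_mul h𝒮 hT₀ hxT₀).1
  by_cases hya : T a ∈ Γ
  · rw [if_pos hya, add_zero, ← hcard]
    refine isCombinationOf_psi h𝒯 hΓ j hx _ (support_subset x) fun z hz => ?_
    rw [hwav, if_neg (not_not.2 hya), sub_zero, mem_support_iff hz, mul_ne_zero_iff]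
    exact and_iff_right hs.ne'
  · have hboth : ∀ T' ∈ 𝒮, ∀ k, node T' k ∈ support 𝒮 x → node T' k ∈ support 𝒮 (T a) →
        node T' k = x ∧ coeffAt 𝒮 x (node T' k) = 1 ∧ coeffAt 𝒮 (T a) (node T' k) = 6 := by
      intro T' hT' k hk hk'
      have hinj := node_injective (h𝒮.nondegenerate T' hT')
      obtain ⟨i, rfl, h1⟩ := exists_of_mem_support h𝒮 hT' hk
      obtain ⟨i', hi', h2⟩ := exists_of_mem_support h𝒮 hT' hk'
      obtain ⟨a', b', hab', ha', hx'⟩ := hloc T' hT' (node_mem T' i)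
      obtain rfl := hinj hx'
      rw [← ha', ← node_corner T' a'] at hi' ⊢
      obtain rfl := hinj hi'
      have h : ∀ a b, a ≠ b → ∀ k, coeffZ k (edgeNode a b) ≠ 0 → coeffZ k (low (corner a)) ≠ 0 →
          k = edgeNode a b ∧ coeffZ k (edgeNode a b) = 8100 ∧
            coeffZ k (low (corner a)) = 48600 := by decide +kernel
      obtain ⟨h3, h4, h5⟩ := h a' b' hab' k h1 h2
      rw [coeffAt_node h𝒮 hT', coeffAt_node h𝒮 hT', coeffMatrix_of_coeffZ h4,
        coeffMatrix_of_coeffZ h5, h3]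
      norm_num
    have hinter : support 𝒮 x ∩ support 𝒮 (T a) = {x} := by
      ext z
      rw [Finset.mem_inter, Finset.mem_singleton]
      constructor
      · rintro ⟨hz, hz'⟩
        obtain ⟨T', hT', k, rfl⟩ := mem_nodes.1 (support_subset x hz)
        exact (hboth T' hT' k hz hz').1
      · rintro rfl
        obtain ⟨a', b', hab', ha', hx'⟩ := hloc T₀ hT₀ hxT₀
        have h : ∀ a b, a ≠ b → coeffZ (edgeNode a b) (edgeNode a b) ≠ 0 ∧
          coeffZ (edgeNode a b) (low (corner a)) ≠ 0 := by decide +kernel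
        rw [hx', ← ha', ← node_corner T₀ a']
        exact ⟨(node_mem_support h𝒮 hT₀).2 (h a' b' hab').1,
          (node_mem_support h𝒮 hT₀).2 (h a' b' hab').2⟩
    have hunion := Finset.card_union_add_card_inter (support 𝒮 x) (support 𝒮 (T a))
    rw [hinter, Finset.card_singleton, hcard, card_support_vertex h𝒮 hT] at hunion
    have hcard' : (support 𝒮 x ∪ support 𝒮 (T a)).card =
        3 + 2 * (star 𝒮 x).card + valence 𝒮 (T a) := by omega
    rw [if_neg hya, ← hcard']
    refine isCombinationOf_psi h𝒯 hΓ j hx _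
      (Finset.union_subset (support_subset _) (support_subset _)) fun z hz => ?_
    rw [hwav, if_pos hya, Finset.mem_union, mul_ne_zero_iff, and_iff_right hs.ne']
    obtain ⟨hρ, hρ'⟩ := scaling_div_sq_le h𝒮 hT₀ hxT₀ (y := T a) (by
        obtain ⟨a', -, -, ha', -⟩ := hloc T₀ hT₀ hxT₀
        exact ha' ▸ vertex_mem_hull T₀ a') fun T' hT' hxT' => by
        obtain ⟨a', -, -, ha', -⟩ := hloc T' hT' hxT'
        exact ha' ▸ vertex_mem_hull T' a'
    by_cases h1 : z ∈ support 𝒮 x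
    · refine iff_of_true ?_ (Or.inl h1)
      by_cases h2 : z ∈ support 𝒮 (T a)
      · obtain ⟨T', hT', k, rfl⟩ := mem_nodes.1 hz
        obtain ⟨-, h3, h4⟩ := hboth T' hT' k h1 h2
        rw [h3, h4]
        intro h
        linarith
      · rw [coeffAt_eq_zero hz h2, mul_zero, mul_zero, sub_zero]
        exact (mem_support_iff hz).1 h1
    · rw [coeffAt_eq_zero hz h1, zero_sub, neg_ne_zero, mul_ne_zero_iff, mul_ne_zero_iff,
        ← mem_support_iff hz]
      exact ⟨fun h => Or.inr h.2.2, fun h => ⟨by norm_num, hρ.ne', h.resolve_left h1⟩⟩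

open Classical in
-- The corrections are by θ at `T c` and at `m`, with weights -1/48 and 27/240. The support of ξ_x
-- consists of the three inner nodes and shares two of them with that of θ_m, where the value is
-- proportional to 1 - (27/240)(50/81)ρ > 0; the union has 4 + 2n nodes. The 1 + v nodes of θ at `T
-- c` are disjoint from both.
theorem isCombinationOf_interior (h𝒯 : IsConforming 𝒯) (hΓ : IsDirichletPart 𝒯 Γ) (j : ℕ) {T : Tri}
    (hT : T ∈ level 𝒯 j) (c : Fin 3) {m : Plane} (hm : m = node T (low (opposite c))) :
    IsCombinationOf 𝒯 Γ (j + 1) (psi 𝒯 Γ j (node T (innerNode c)))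
      ((if m ∈ Γ then 3 else 4 + 2 * (star (level 𝒯 j) m).card) +
        if T c ∈ Γ then 0 else 1 + valence (level 𝒯 j) (T c)) := by
  have h𝒮 := h𝒯.level j
  have hxΓ := node_innerNode_notMem (Γ := Γ) h𝒮 (by rw [domain_level]; exact hΓ.2) hT c
  set 𝒮 := level 𝒯 j
  have hTa := h𝒮.nondegenerate T hT
  have hinj := node_injective hTa
  set x := node T (innerNode c) with hxdef
  have hx : x ∈ index locXi 𝒮 Γ := by
    have h : ∀ c, ∃ i, innerNode c = high i := by decide +kernel
    obtain ⟨i, hi⟩ := h c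
    exact mem_index.2 ⟨⟨T, hT, i, by rw [hxdef, hi]; rfl⟩, hxΓ⟩
  have hTc : T c = node T (low (corner c)) := (node_corner T c).symm
  have hlow : ∀ c, corner c ≠ opposite c := by decide +kernel
  have hne : T c ≠ m := by
    rw [hTc, hm, hinj.ne_iff, low_injective.ne_iff]
    exact hlow c
  have hmT : m ∈ hull T := hm ▸ node_mem T _
  have hm' : m = node T (midNode (c + 1) (c + 2)) := by rw [midNode_add, hm]
  have hcc : ∀ c : Fin 3, c + 1 ≠ c + 2 ∧ c ≠ c + 1 ∧ c ≠ c + 2 := by decide +kernel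
  have hmid : midNode (c + 1) (c + 2) ∈ edgeNodes (c + 1) (c + 2) := mem_edgeNodes.2 (Or.inl rfl)
  have hcm : (support 𝒮 m).card = 3 + 2 * (star 𝒮 m).card := by
    rw [hm']
    exact card_support_edge h𝒮 hT (hcc c).1 hmid
  have hcx : (support 𝒮 x).card = 3 := by
    rw [support_innerNode h𝒮 hT, Finset.card_map]
    rfl
  have hyc : T c ∈ index locTheta 𝒮 Γ ↔ T c ∉ Γ := by
    rw [hTc]
    exact node_mem_index_locTheta hT _
  have hym : m ∈ index locTheta 𝒮 Γ ↔ m ∉ Γ := by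
    rw [hm]
    exact node_mem_index_locTheta hT _
  have hone : ∀ T' ∈ 𝒮, x ∈ hull T' → T' = T := fun T' hT' h =>
    h𝒮.eq_of_node_innerNode_mem hT hT' h
  have hwav := wavelet_apply (Γ := Γ) h𝒮 hx
    (fun y => (if y = T c then -1 / 48 else 0) + if y = m then 27 / 240 else 0) ?_ ?_
  rotate_left
  · intro T' hT' i k hi
    obtain rfl := hone T' hT' (hi ▸ node_mem T' _)
    have hk : node T' (low k) = T' c ↔ k = corner c := by
      rw [hTc, hinj.eq_iff, low_injective.eq_iff]
    have hk' : node T' (low k) = m ↔ k = opposite c := by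
      rw [hm, hinj.eq_iff, low_injective.eq_iff]
    rw [← hinj hi, crossGram_innerNode]
    simp only [hk, hk']
    by_cases h1 : k = corner c
    · rw [if_pos h1, if_pos h1, if_neg (h1 ▸ hlow c)]
      norm_num
    · rw [if_neg h1, if_neg h1]
      split_ifs <;> norm_num
  · intro T' hT' hxT' y hy
    obtain rfl := hone T' hT' hxT'
    rw [if_neg fun h => hy (by rw [h]; exact vertex_mem_hull T' c), if_neg fun h => hy (by rw [h]; exact hmT),
      add_zero]
  simp only [add_mul, Finset.sum_add_distrib, ite_mul, zero_mul, Finset.sum_ite_eq', hyc, hym]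
    at hwav
  have hs := (scaling_sq_mul h𝒮 hT (node_mem T (innerNode c))).1
  obtain ⟨hρ, hρ'⟩ := scaling_div_sq_le h𝒮 hT (node_mem T (innerNode c)) hmT fun T' hT' h => by
    rw [hone T' hT' h]
    exact hmT
  obtain ⟨hσ, -⟩ := scaling_div_sq_le h𝒮 hT (node_mem T (innerNode c)) (vertex_mem_hull T c)
    fun T' hT' h => by
      rw [hone T' hT' h]
      exact vertex_mem_hull T c
  have hcx_disj : ∀ z ∈ support 𝒮 (T c), z ∉ support 𝒮 x := by
    intro z hz hz'
    obtain ⟨T', hT', k, rfl⟩ := mem_nodes.1 (support_subset _ hz)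
    obtain ⟨i, hi, h1⟩ := exists_of_mem_support h𝒮 hT' hz'
    obtain rfl := hone T' hT' (hi ▸ node_mem T' i)
    obtain ⟨i', hi', h2⟩ := exists_of_mem_support h𝒮 hT' hz
    have h : ∀ c k, coeffZ k (innerNode c) ≠ 0 → coeffZ k (low (corner c)) = 0 := by decide +kernel
    rw [← hinj hi] at h1
    rw [hTc] at hi'
    rw [← hinj hi'] at h2
    exact h2 (h c k h1)
  have hcm_disj : ∀ z ∈ support 𝒮 (T c), z ∉ support 𝒮 m := by
    intro z hz hz'
    obtain ⟨T', hT', k, rfl⟩ := mem_nodes.1 (support_subset _ hz)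
    have hinj' := node_injective (h𝒮.nondegenerate T' hT')
    obtain ⟨i, hi, h1⟩ := exists_of_mem_support h𝒮 hT' hz'
    obtain ⟨i', hi', h2⟩ := exists_of_mem_support h𝒮 hT' hz
    obtain ⟨a, b, hab, ha, hb⟩ := h𝒮.exists_edge hT hT' (hcc c).1 hmid
      (hm' ▸ hi ▸ node_mem T' i)
    -- The triangle contains `T c` as well as both ends of the opposite edge, so the disjointness
    -- can be read off its own table.
    obtain ⟨d, hd⟩ := h𝒮.vertex_mem_of_mem hT hT' (hi' ▸ node_mem T' i')
    have hda : d ≠ a := fun h => (hcc c).2.1 (hTa.injective (by rw [← hd, ← ha, h]))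
    have hdb : d ≠ b := fun h => (hcc c).2.2 (hTa.injective (by rw [← hd, ← hb, h]))
    have hmm : m = node T' (midNode a b) := by
      rw [hm', node_midNode T (hcc c).1, node_midNode T' hab, ha, hb]
    rw [← hd, ← node_corner T' d] at hi'
    rw [← hinj' (hmm.symm.trans hi)] at h1
    rw [← hinj' hi'] at h2
    have h : ∀ a b d, a ≠ b → d ≠ a → d ≠ b → ∀ k, coeffZ k (midNode a b) ≠ 0 →
        coeffZ k (low (corner d)) = 0 := by decide +kernel
    exact h2 (h a b d hab hda hdb k h1)
  have hxm : ∀ z ∈ support 𝒮 x, z ∈ support 𝒮 m →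
      (z = node T (innerNode (c + 1)) ∨ z = node T (innerNode (c + 2))) ∧
        coeffAt 𝒮 x z = 1 ∧ coeffAt 𝒮 m z = 5000 / 8100 := by
    intro z hz hz'
    obtain ⟨T', hT', k, rfl⟩ := mem_nodes.1 (support_subset _ hz)
    obtain ⟨i, hi, h1⟩ := exists_of_mem_support h𝒮 hT' hz
    obtain rfl := hone T' hT' (hi ▸ node_mem T' i)
    rw [← hinj hi] at h1
    rw [hm, node_mem_support h𝒮 hT'] at hz'
    have h : ∀ c k, coeffZ k (innerNode c) ≠ 0 → coeffZ k (low (opposite c)) ≠ 0 →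
        (k = innerNode (c + 1) ∨ k = innerNode (c + 2)) ∧ coeffZ k (innerNode c) = 8100 ∧
          coeffZ k (low (opposite c)) = 5000 := by decide +kernel
    obtain ⟨h2, h3, h4⟩ := h c k h1 hz'
    refine ⟨h2.imp (fun h => by rw [h]) fun h => by rw [h], ?_, ?_⟩
    · rw [hxdef, coeffAt_node h𝒮 hT', coeffMatrix_of_coeffZ h3]
      norm_num
    · rw [hm, coeffAt_node h𝒮 hT', coeffMatrix_of_coeffZ h4]
      norm_num
  have hinter : support 𝒮 x ∩ support 𝒮 m =
      {node T (innerNode (c + 1)), node T (innerNode (c + 2))} := by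
    have h : ∀ c, (coeffZ (innerNode (c + 1)) (innerNode c) ≠ 0 ∧
        coeffZ (innerNode (c + 1)) (low (opposite c)) ≠ 0) ∧
        coeffZ (innerNode (c + 2)) (innerNode c) ≠ 0 ∧
        coeffZ (innerNode (c + 2)) (low (opposite c)) ≠ 0 := by decide +kernel
    ext z
    rw [Finset.mem_inter, Finset.mem_insert, Finset.mem_singleton]
    refine ⟨fun hz => (hxm z hz.1 hz.2).1, ?_⟩
    rw [hm, hxdef]
    rintro (rfl | rfl)
    · exact ⟨(node_mem_support h𝒮 hT).2 (h c).1.1, (node_mem_support h𝒮 hT).2 (h c).1.2⟩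
    · exact ⟨(node_mem_support h𝒮 hT).2 (h c).2.1, (node_mem_support h𝒮 hT).2 (h c).2.2⟩
  have hcxm : (support 𝒮 x ∪ support 𝒮 m).card = 4 + 2 * (star 𝒮 m).card := by
    have h := Finset.card_union_add_card_inter (support 𝒮 x) (support 𝒮 m)
    rw [hinter, Finset.card_pair fun h => (hcc c).1 (innerNode_injective (hinj h)), hcx, hcm] at h
    omega
  -- The nodes of ξ_x together with the correction at `m`, if there is one; the disjoint support at
  -- `T c` is added last.
  let G : Finset Plane := if m ∈ Γ then support 𝒮 x else support 𝒮 x ∪ support 𝒮 m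
  have hG : G ⊆ nodes 𝒮 := by
    simp only [G]
    split_ifs
    exacts [support_subset _, Finset.union_subset (support_subset _) (support_subset _)]
  have hGcard : G.card = if m ∈ Γ then 3 else 4 + 2 * (star 𝒮 m).card := by
    simp only [G]
    split_ifs
    exacts [hcx, hcxm]
  have hGc : ∀ z ∈ support 𝒮 (T c), z ∉ G := by
    intro z hz
    simp only [G]
    split_ifs
    · exact hcx_disj z hz
    · rw [Finset.mem_union, not_or]
      exact ⟨hcx_disj z hz, hcm_disj z hz⟩
  have hGz : ∀ z ∈ nodes 𝒮, coeffAt 𝒮 x z - (if m ∉ Γ then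
      27 / 240 * ((scaling 𝒮 m / scaling 𝒮 x) ^ 2 * coeffAt 𝒮 m z) else 0) ≠ 0 ↔ z ∈ G := by
    intro z hz
    by_cases hmΓ : m ∈ Γ
    · simp only [G, if_pos hmΓ, if_neg (not_not.2 hmΓ), sub_zero]
      exact (mem_support_iff hz).symm
    · simp only [G, if_neg hmΓ, if_pos hmΓ, Finset.mem_union]
      by_cases h1 : z ∈ support 𝒮 x
      · refine iff_of_true ?_ (Or.inl h1)
        by_cases h2 : z ∈ support 𝒮 m
        · obtain ⟨-, h3, h4⟩ := hxm z h1 h2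
          rw [h3, h4]
          intro h
          linarith
        · rw [coeffAt_eq_zero hz h2, mul_zero, mul_zero, sub_zero]
          exact (mem_support_iff hz).1 h1
      · rw [coeffAt_eq_zero hz h1, zero_sub, neg_ne_zero, mul_ne_zero_iff, mul_ne_zero_iff,
          ← mem_support_iff hz]
        exact ⟨fun h => Or.inr h.2.2, fun h => ⟨by norm_num, hρ.ne', h.resolve_left h1⟩⟩
  by_cases hcΓ : T c ∈ Γ
  · rw [if_pos hcΓ, add_zero, ← hGcard]
    refine isCombinationOf_psi h𝒯 hΓ j hx _ hG fun z hz => ?_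
    rw [hwav, if_neg (not_not.2 hcΓ), zero_add, mul_ne_zero_iff, and_iff_right hs.ne', hGz z hz]
  · rw [if_neg hcΓ, ← hGcard, ← card_support_vertex h𝒮 hT, ← Finset.card_union_of_disjoint
      (Finset.disjoint_right.2 hGc)]
    refine isCombinationOf_psi h𝒯 hΓ j hx _ (Finset.union_subset hG (support_subset _))
      fun z hz => ?_
    rw [hwav, if_pos hcΓ, mul_ne_zero_iff, and_iff_right hs.ne', Finset.mem_union]
    by_cases h1 : z ∈ support 𝒮 (T c)
    · refine iff_of_true ?_ (Or.inr h1)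
      have h2 := not_not.1 ((hGz z hz).not.2 (hGc z h1))
      intro h
      have h3 : (-1 / 48 : ℝ) * ((scaling 𝒮 (T c) / scaling 𝒮 x) ^ 2 * coeffAt 𝒮 (T c) z) = 0 := by
        linarith
      exact mul_ne_zero (by norm_num) (mul_ne_zero hσ.ne' ((mem_support_iff hz).1 h1)) h3
    · rw [coeffAt_eq_zero hz h1, mul_zero, mul_zero, zero_add, or_iff_left h1]
      exact hGz z hz

end Count

end QuadWavelet

end

/-! ### Assembly. -/

open QuadWavelet Classical in
theorem mainTheorem2 :
    -- the local collections
    (locTheta.IsAdmissible ∧ locXi.IsAdmissible ∧ locPhi.IsAdmissible ∧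
      IsLocalBasis locPhi.fn (refSpace 1) ∧
      (Matrix.of fun i k => refInner (locTheta.fn i) (locPhi.fn k)) =
        refVol • (1 : Matrix (Fin 6) (Fin 6) ℝ) ∧
      coeffMatrix.det ≠ 0 ∧
      IsLocalBasis (Sum.elim locTheta.fn locXi.fn) (refSpace 2) ∧
      (Matrix.of fun i k => refInner (locXi.fn i) (locPhi.fn k)) = refVol • xiPhiMatrix) ∧
    -- the global collections, with constants that depend on nothing
    (∃ c C : ℝ, 0 < c ∧ c ≤ C ∧ ∀ (𝒯 : Finset Tri) (Γ : Set Plane), IsConforming 𝒯 →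
      IsDirichletPart 𝒯 Γ → ∀ j : ℕ,
        IsRieszBasis (domain 𝒯) c C (fun x : idxN 𝒯 Γ j => nodal 𝒯 j x) (primal 𝒯 Γ j) ∧
        IsRieszBasis (domain 𝒯) c C
          (Sum.elim (fun x : idxTheta 𝒯 Γ j => theta 𝒯 j x) (fun x : idxXi 𝒯 Γ j => xi 𝒯 j x))
          (primal 𝒯 Γ (j + 1)) ∧
        IsRieszBasis (domain 𝒯) c C (fun x : idxTheta 𝒯 Γ j => phi 𝒯 j x) (dual 𝒯 Γ j) ∧
        (∀ x ∈ idxTheta 𝒯 Γ j, ∀ y ∈ idxTheta 𝒯 Γ j,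
          inner₂ (domain 𝒯) (theta 𝒯 j x) (phi 𝒯 j y) = if x = y then 1 else 0) ∧
        IsRieszBasis (domain 𝒯) c C (fun x : idxXi 𝒯 Γ j => psi 𝒯 Γ j x)
          (waveletSpace 𝒯 Γ j)) ∧
    -- the number of nodal functions in a wavelet
    (∀ (𝒯 : Finset Tri) (Γ : Set Plane), IsConforming 𝒯 → IsDirichletPart 𝒯 Γ → ∀ j : ℕ,
      ∀ T ∈ level 𝒯 j,
        -- wavelets with `x` on an edge, nearest to the vertex `T i`
        (∀ i k : Fin 3, i ≠ k → ∀ x : Plane, x = (3 / 4 : ℝ) • T i + (1 / 4 : ℝ) • T k → x ∉ Γ →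
          IsCombinationOf 𝒯 Γ (j + 1) (psi 𝒯 Γ j x)
            (3 + 2 * (star (level 𝒯 j) x).card +
              if T i ∈ Γ then 0 else valence (level 𝒯 j) (T i))) ∧
        -- wavelets with `x` interior to `T`, nearest to the vertex `T i`, the opposite edge
        -- having midpoint `m`
        (∀ i : Fin 3, ∀ x m : Plane,
          x = (1 / 2 : ℝ) • T i + (1 / 4 : ℝ) • T (i + 1) + (1 / 4 : ℝ) • T (i + 2) →
          m = midpoint ℝ (T (i + 1)) (T (i + 2)) →
          IsCombinationOf 𝒯 Γ (j + 1) (psi 𝒯 Γ j x)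
            ((if m ∈ Γ then 3 else 4 + 2 * (star (level 𝒯 j) m).card) +
              if T i ∈ Γ then 0 else 1 + valence (level 𝒯 j) (T i)))) := by
  refine ⟨⟨locTheta_isAdmissible, locXi_isAdmissible, locPhi_isAdmissible, locPhi_isLocalBasis,
    refInner_locTheta_locPhi, coeffMatrix_det_ne_zero, locAll_isLocalBasis,
    refInner_locXi_locPhi⟩, ?_, fun 𝒯 Γ h𝒯 hΓ j T hT => ⟨?_, ?_⟩⟩
  · obtain ⟨c, C, hc, hcC, h⟩ := exists_riesz_constants
    refine ⟨c, C, hc, hcC, fun 𝒯 Γ h𝒯 hΓ j => ?_⟩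
    -- The j-th refinement is treated as an initial triangulation of the same polygon, so the
    -- constants do not depend on j.
    obtain ⟨h1, h2, h3, h4⟩ := h (level 𝒯 j) Γ (h𝒯.level j) (hΓ.level h𝒯 j)
    rw [domain_level] at h1
    rw [← level_succ, domain_level] at h2 h3 h4
    refine ⟨h1, h2, h3, fun x hx y _ => ?_, ?_⟩
    · rw [← domain_level 𝒯 j]
      exact inner₂_theta_phi (h𝒯.level j) hx
    · rw [psi_eq_wavelet]
      exact h4
  · rintro i k hik x rfl hx
    rw [← node_edgeNode] at hx ⊢
    exact isCombinationOf_edge h𝒯 hΓ j hT hik hx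
  · rintro i x m rfl rfl
    have hcc : ∀ i : Fin 3, i + 1 ≠ i + 2 := by decide +kernel
    have hm : midpoint ℝ (T (i + 1)) (T (i + 2)) = node T (low (opposite i)) := by
      rw [← midNode_add, node_midNode T (hcc i), midpoint_eq_smul_add, smul_add, one_div,
        invOf_eq_inv]
    rw [← node_innerNode]
    exact isCombinationOf_interior h𝒯 hΓ j hT i hm
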